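/- Conventions. Manifolds are smooth, Hausdorff, second countable, finite-dimensional and without boundary. A complex structure $J$ is a smooth endomorphism field of the tangent bundle with $J^2=-1$ and vanishing Nijenhuis tensor. Two metrics are conformal, $g\sim g'$, if $g'=e^{f}g$ with $f$ smooth. A Hermitian metric $g$ on a complex manifold $(M,J)$, with Kähler form $\Omega(X,Y)=g(JX,Y)$, is locally conformal Kähler if $d\Omega=\omega\wedge\Omega$ for some closed $1$-form $\omega$; this property depends only on the conformal class $[g]$. If $\dim_{\mathbb C}M\ge 2$, then $\omega$ is unique and is called the Lee form of $g$; one writes $d^\omega f=df-f\omega$ for functions $f$, $\sharp\alpha$ for the vector field with $\iota_{\sharp\alpha}\Omega=\alpha$, and $\{f_1,f_2\}=\Omega(\sharp d^\omega f_1,\sharp d^\omega f_2)$. Theorem. Let $(M,[g],J)$ be a locally conformal Kähler manifold with $\dim_{\mathbb C}M\ge 2$, and let $\omega$ be the Lee form of the metric $g$. Let $G$ be a connected Lie group with Lie algebra $\mathfrak g$, acting smoothly on $M$ by automorphisms of $(M,[g],J)$, that is, $h^*J=J$ and $h^*g\sim g$ for all $h\in G$ (for instance, a connected Lie subgroup of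 the automorphism group of $(M,[g],J)$). Suppose that the action is twisted Hamiltonian with momentum map $\mu$: there is a linear map $\mathfrak g\to C^\infty(M)$, $X\mapsto\mu^X$, with $\iota_{X}\Omega=d^\omega\mu^X$ (where $X$ also denotes the fundamental vector field of $X\in\mathfrak g$) and $\mu^{[X,Y]}=\{\mu^X,\mu^Y\}$ for all $X,Y\in\mathfrak g$, and $\mu\colon M\to\mathfrak g^*$ is given by $\langle\mu(x),X\rangle=\mu^X(x)$. Suppose that $0$ is a regular value of $\mu$ and that $G$ acts freely and properly on $\mu^{-1}(0)$. Then $\mu^{-1}(0)$ is $G$-invariant; $\mu^{-1}(0)$ and $\mu^{-1}(0)/G$ carry structures of smooth manifolds for which the inclusion $i\colon\mu^{-1}(0)\to M$ is a smooth embedding and the projection $\pi\colon\mu^{-1}(0)\to\mu^{-1}(0)/G$ is a smooth submersion. Let $E_x\subset T_x(\mu^{-1}(0))$ be the $g$-orthogonal complement of the tangent space of the orbit $Gx$. There exist a complex structure $\bar J$ and a $\bar J$-Hermitian locally conformal Kähler metric $\bar g$ (with Kähler form $\bar\Omega$) on $\mu^{-1}(0)/G$ such that (a) $\bar J$ is induced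 by $J$: each $E_x$ is $J$-invariant and $d\pi(Ju)=\bar J\,d\pi(u)$ for $u\in E_x$; (b) $\pi^*\bar g\sim i^*g$ on the horizontal distribution $E$, and $\pi^*\bar\Omega\sim i^*\Omega$ on $\mu^{-1}(0)$. This structure is unique in the following sense: $\bar J$ is the only complex structure on $\mu^{-1}(0)/G$ satisfying (a); any metric $g'$ on $\mu^{-1}(0)/G$ that is locally conformal Kähler with respect to some complex structure and satisfies $\pi^*g'\sim i^*g$ on $E$ is conformal to $\bar g$; and so is any $\bar J$-Hermitian locally conformal Kähler metric on $\mu^{-1}(0)/G$ whose Kähler form $\Omega'$ satisfies $\pi^*\Omega'\sim i^*\Omega$. (When $\mu^{-1}(0)/G$ has complex dimension at most $1$, "locally conformal Kähler" is an empty condition on a Hermitian metric.) -/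

import Mathlib

open Bundle Manifold
open scoped ContDiff Topology

noncomputable section

namespace LCK

section Forms

variable {E : Type*} [NormedAddCommGroup E] [NormedSpace ℝ E]
  {M : Type*} [TopologicalSpace M] [ChartedSpace E M]

/-- Differential `k`-forms on `M` (no regularity required). -/
abbrev Form (E : Type*) [NormedAddCommGroup E] [NormedSpace ℝ E]
    (M : Type*) [TopologicalSpace M] [ChartedSpace E M] (k : ℕ) : Type _ :=
  ∀ x : M, TangentSpace 𝓘(ℝ, E) x [⋀^Fin k]→L[ℝ] ℝ

/-- The expression of a `k`-form in the preferred chart at `x₀`: its pullback by the inverse of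
the chart. It is meaningful on the target of the chart. -/
def formInChart {k : ℕ} (α : Form E M k) (x₀ : M) : E → E [⋀^Fin k]→L[ℝ] ℝ := fun y =>
  (α ((extChartAt 𝓘(ℝ, E) x₀).symm y)).compContinuousLinearMap
    (mfderiv 𝓘(ℝ, E) 𝓘(ℝ, E) (extChartAt 𝓘(ℝ, E) x₀).symm y)

/-- A form is smooth if its expressions in charts are. -/
def IsSmoothForm {k : ℕ} (α : Form E M k) : Prop :=
  ∀ x₀ : M, ContDiffOn ℝ ∞ (formInChart α x₀) (extChartAt 𝓘(ℝ, E) x₀).target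

/-- The exterior derivative of a form: at `x₀`, take the exterior derivative of the expression in
the chart at `x₀`, and pull it back by the chart. -/
def extDerivForm {k : ℕ} (α : Form E M k) : Form E M (k + 1) := fun x₀ =>
  (extDeriv (formInChart α x₀) (extChartAt 𝓘(ℝ, E) x₀ x₀)).compContinuousLinearMap
    (mfderiv 𝓘(ℝ, E) 𝓘(ℝ, E) (extChartAt 𝓘(ℝ, E) x₀) x₀)

/-- A field of covectors, seen as a `1`-form. -/
def oneForm (θ : ∀ x : M, TangentSpace 𝓘(ℝ, E) x →L[ℝ] ℝ) : Form E M 1 := fun x =>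
  ContinuousAlternatingMap.ofSubsingleton ℝ (TangentSpace 𝓘(ℝ, E) x) ℝ (0 : Fin 1) (θ x)

end Forms

section Structures

variable (E : Type*) [NormedAddCommGroup E] [NormedSpace ℝ E]
  (M : Type*) [TopologicalSpace M] [ChartedSpace E M] [IsManifold 𝓘(ℝ, E) ∞ M]

/-- A complex structure on the smooth manifold `M`: a smooth field `J` of endomorphisms of the
tangent bundle with `J² = -1` which is integrable, that is, whose Nijenhuis tensor
`[JX, JY] - J[JX, Y] - J[X, JY] - [X, Y]` vanishes. -/
@[ext]
structure ComplexStructure where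
  /-- The endomorphism of each tangent space. -/
  toFun : ∀ x : M, TangentSpace 𝓘(ℝ, E) x →L[ℝ] TangentSpace 𝓘(ℝ, E) x
  smooth : ContMDiff 𝓘(ℝ, E) (𝓘(ℝ, E).prod 𝓘(ℝ, E →L[ℝ] E)) ∞
    (fun x => (TotalSpace.mk' (E →L[ℝ] E) x (toFun x) :
      TotalSpace (E →L[ℝ] E)
        (fun x : M => TangentSpace 𝓘(ℝ, E) x →L[ℝ] TangentSpace 𝓘(ℝ, E) x)))
  sq : ∀ (x : M) (v : TangentSpace 𝓘(ℝ, E) x), toFun x (toFun x v) = -v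
  integrable : ∀ X Y : (∀ x : M, TangentSpace 𝓘(ℝ, E) x),
    ContMDiff 𝓘(ℝ, E) 𝓘(ℝ, E).tangent ∞ (fun x => (⟨x, X x⟩ : TangentBundle 𝓘(ℝ, E) M)) →
    ContMDiff 𝓘(ℝ, E) 𝓘(ℝ, E).tangent ∞ (fun x => (⟨x, Y x⟩ : TangentBundle 𝓘(ℝ, E) M)) →
    ∀ x : M,
      VectorField.mlieBracket 𝓘(ℝ, E) (fun y => toFun y (X y)) (fun y => toFun y (Y y)) x
        - toFun x (VectorField.mlieBracket 𝓘(ℝ, E) (fun y => toFun y (X y)) Y x)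
        - toFun x (VectorField.mlieBracket 𝓘(ℝ, E) X (fun y => toFun y (Y y)) x)
        - VectorField.mlieBracket 𝓘(ℝ, E) X Y x = 0

/-- Smooth Riemannian metrics on `M`. -/
abbrev RiemMetric : Type _ :=
  ContMDiffRiemannianMetric 𝓘(ℝ, E) ∞ E (fun x : M => TangentSpace 𝓘(ℝ, E) x)

variable {E M}

/-- Two metrics are conformal if `g' = e^f g` for a smooth function `f`. -/
def Conformal (g g' : RiemMetric E M) : Prop :=
  ∃ f : C^∞⟮𝓘(ℝ, E), M; 𝓘(ℝ, ℝ), ℝ⟯, ∀ (x : M) (u v : TangentSpace 𝓘(ℝ, E) x),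
    g'.inner x u v = Real.exp (f x) * g.inner x u v

/-- Hermitian metrics on the complex manifold `(M, J)`. -/
structure HermitianMetric (J : ComplexStructure E M) extends
    ContMDiffRiemannianMetric 𝓘(ℝ, E) ∞ E (fun x : M => TangentSpace 𝓘(ℝ, E) x) where
  hermitian : ∀ (x : M) (u v : TangentSpace 𝓘(ℝ, E) x),
    inner x (J.toFun x u) (J.toFun x v) = inner x u v

/-- The underlying Riemannian metric of a Hermitian metric. -/
abbrev HermitianMetric.metric {J : ComplexStructure E M} (g : HermitianMetric J) : RiemMetric E M :=
  g.toContMDiffRiemannianMetric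

variable {J : ComplexStructure E M}

theorem HermitianMetric.inner_J_self (g : HermitianMetric J) (x : M)
    (v : TangentSpace 𝓘(ℝ, E) x) : g.inner x (J.toFun x v) v = 0 := by
  have h := g.hermitian x (J.toFun x v) v
  rw [J.sq, map_neg, neg_apply, g.symm x v] at h
  linarith

/-- The Kähler form `Ω(u, v) = g(J u, v)`. -/
def kahlerForm (g : HermitianMetric J) : Form E M 2 := fun x =>
  { toFun := fun v => g.inner x (J.toFun x (v 0)) (v 1)
    map_update_add' := by
      intro _ m i a b
      fin_cases i <;> simp [Function.update]
    map_update_smul' := by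
      intro _ m i c a
      fin_cases i <;> simp [Function.update]
    map_eq_zero_of_eq' := by
      intro v i j hij hne
      have h01 : v 0 = v 1 := by
        fin_cases i <;> fin_cases j <;> simp_all
      change g.inner x (J.toFun x (v 0)) (v 1) = 0
      rw [h01]
      exact g.inner_J_self x (v 1)
    cont := by
      have h0 : Continuous fun v : Fin 2 → TangentSpace 𝓘(ℝ, E) x => J.toFun x (v 0) :=
        (J.toFun x).continuous.comp (continuous_apply 0)
      have h1 : Continuous fun v : Fin 2 → TangentSpace 𝓘(ℝ, E) x => v 1 := continuous_apply 1
      let b : E →L[ℝ] E →L[ℝ] ℝ := g.inner x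
      have hg : Continuous fun p : E × E => b p.1 p.2 := b.continuous₂
      exact hg.comp (h0.prodMk h1) }

/-- `θ` is the Lee form of the locally conformal Kähler metric `g`: a smooth closed `1`-form with
`dΩ = θ ∧ Ω`. -/
structure IsLeeForm (g : HermitianMetric J) (θ : ∀ x : M, TangentSpace 𝓘(ℝ, E) x →L[ℝ] ℝ) :
    Prop where
  smooth : IsSmoothForm (oneForm θ)
  closed : extDerivForm (oneForm θ) = 0
  d_kahlerForm : ∀ (x : M) (u v w : TangentSpace 𝓘(ℝ, E) x),
    extDerivForm (kahlerForm g) x ![u, v, w] =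
      θ x u * kahlerForm g x ![v, w] + θ x v * kahlerForm g x ![w, u]
        + θ x w * kahlerForm g x ![u, v]

/-- A Hermitian metric is locally conformal Kähler if `dΩ = θ ∧ Ω` for a closed `1`-form `θ`. -/
def IsLCK (g : HermitianMetric J) : Prop := ∃ θ, IsLeeForm g θ

/-- The covector `ι_v Ω`. -/
def flat (g : HermitianMetric J) (x : M) (v : TangentSpace 𝓘(ℝ, E) x) :
    TangentSpace 𝓘(ℝ, E) x →L[ℝ] ℝ :=
  g.inner x (J.toFun x v)

/-- The `Ω`-dual `♯α` of a covector: the vector `v` with `ι_v Ω = α`. -/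
def sharp (g : HermitianMetric J) (x : M) (α : TangentSpace 𝓘(ℝ, E) x →L[ℝ] ℝ) :
    TangentSpace 𝓘(ℝ, E) x :=
  Function.invFun (flat g x) α

theorem flat_injective (g : HermitianMetric J) (x : M) : Function.Injective (flat g x) := by
  intro v w h
  by_contra hne
  have hJ : J.toFun x (v - w) ≠ 0 := by
    intro h0
    have h1 := J.sq x (v - w)
    rw [h0, map_zero] at h1
    exact hne (sub_eq_zero.mp (neg_eq_zero.mp h1.symm))
  have h2 : g.inner x (J.toFun x (v - w)) = 0 := by
    rw [map_sub, map_sub]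
    exact sub_eq_zero.mpr h
  have h3 := g.pos x _ hJ
  rw [h2] at h3
  simp at h3

theorem flat_sharp [FiniteDimensional ℝ E] (g : HermitianMetric J) (x : M)
    (α : TangentSpace 𝓘(ℝ, E) x →L[ℝ] ℝ) : flat g x (sharp g x α) = α := by
  refine Function.invFun_eq ?_
  let b : E →L[ℝ] E →L[ℝ] ℝ := g.inner x
  let j : E →L[ℝ] E := J.toFun x
  let φ : E →ₗ[ℝ] (E →L[ℝ] ℝ) := (b.comp j).toLinearMap
  have hφ : Function.Injective φ := flat_injective g x
  have hfin : Module.finrank ℝ E = Module.finrank ℝ (E →L[ℝ] ℝ) := by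
    rw [← (LinearMap.toContinuousLinearMap (𝕜 := ℝ) (E := E) (F' := ℝ)).finrank_eq]
    exact (Subspace.dual_finrank_eq (K := ℝ) (V := E)).symm
  exact (LinearMap.injective_iff_surjective_of_finrank_eq_finrank hfin).mp hφ α

/-- The twisted differential `d^θ f = df - f θ` of a function. -/
def twistedDiff (θ : ∀ x : M, TangentSpace 𝓘(ℝ, E) x →L[ℝ] ℝ) (f : M → ℝ) (x : M) :
    TangentSpace 𝓘(ℝ, E) x →L[ℝ] ℝ :=
  mvfderiv 𝓘(ℝ, E) f x - f x • θ x

/-- The twisted Poisson bracket `{f₁, f₂} = Ω(♯ d^θ f₁, ♯ d^θ f₂)`. -/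
def twistedPoisson (g : HermitianMetric J) (θ : ∀ x : M, TangentSpace 𝓘(ℝ, E) x →L[ℝ] ℝ)
    (f₁ f₂ : M → ℝ) (x : M) : ℝ :=
  kahlerForm g x ![sharp g x (twistedDiff θ f₁ x), sharp g x (twistedDiff θ f₂ x)]

end Structures

section Action

variable {E : Type*} [NormedAddCommGroup E] [NormedSpace ℝ E]
  {M : Type*} [TopologicalSpace M] [ChartedSpace E M]
  {F : Type*} [NormedAddCommGroup F] [NormedSpace ℝ F]
  {G : Type*} [TopologicalSpace G] [ChartedSpace F G] [Group G] [MulAction G M]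

/-- The fundamental vector field of `X ∈ 𝔤 = T₁G`: at `x` it is the derivative at `1` of the orbit
map `h ↦ h • x`, applied to `X`. -/
def fundamentalField (X : GroupLieAlgebra 𝓘(ℝ, F) G) (x : M) : TangentSpace 𝓘(ℝ, E) x :=
  (mfderiv 𝓘(ℝ, F) 𝓘(ℝ, E) (fun h : G => h • x) 1 :
    TangentSpace 𝓘(ℝ, F) (1 : G) →L[ℝ] TangentSpace 𝓘(ℝ, E) ((1 : G) • x)) X

/-- The map `M → 𝔤*` induced by a linear map `𝔤 → C^∞(M)`. Here `𝔤 = T₁G` is identified with the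
model space `F` of `G`, which it is by definition. -/
def momentumMap [FiniteDimensional ℝ F]
    (μ : GroupLieAlgebra 𝓘(ℝ, F) G →ₗ[ℝ] C^∞⟮𝓘(ℝ, E), M; 𝓘(ℝ, ℝ), ℝ⟯) (x : M) :
    F →L[ℝ] ℝ :=
  LinearMap.toContinuousLinearMap
    ({ toFun := fun X : F => μ (X : GroupLieAlgebra 𝓘(ℝ, F) G) x
       map_add' := fun X Y => congrArg (fun f : C^∞⟮𝓘(ℝ, E), M; 𝓘(ℝ, ℝ), ℝ⟯ => f x)
         (μ.map_add (X : GroupLieAlgebra 𝓘(ℝ, F) G) (Y : GroupLieAlgebra 𝓘(ℝ, F) G))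
       map_smul' := fun c X => congrArg (fun f : C^∞⟮𝓘(ℝ, E), M; 𝓘(ℝ, ℝ), ℝ⟯ => f x)
         (μ.map_smul c (X : GroupLieAlgebra 𝓘(ℝ, F) G)) } : F →ₗ[ℝ] ℝ)

variable [FiniteDimensional ℝ F]
  (μ : GroupLieAlgebra 𝓘(ℝ, F) G →ₗ[ℝ] C^∞⟮𝓘(ℝ, E), M; 𝓘(ℝ, ℝ), ℝ⟯)

/-- The level set `μ⁻¹(0)`. -/
def zeroLevel : Set M := {x | momentumMap μ x = 0}

/-- `0` is a regular value of `μ : M → 𝔤*`. -/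
def ZeroIsRegularValue : Prop :=
  ∀ x ∈ zeroLevel μ,
    Function.Surjective (mfderiv 𝓘(ℝ, E) 𝓘(ℝ, F →L[ℝ] ℝ) (momentumMap μ) x)

/-- `G` acts freely on `μ⁻¹(0)`. -/
def FreeOnZeroLevel : Prop := ∀ x ∈ zeroLevel μ, ∀ h : G, h • x = x → h = 1

/-- `G` acts properly on `μ⁻¹(0)`: the map `(h, x) ↦ (h • x, x)` is proper on `G × μ⁻¹(0)`.
As `μ⁻¹(0)` is closed in `M`, it makes no difference whether `M × M` or `μ⁻¹(0) × μ⁻¹(0)` is taken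
as its codomain. -/
def ProperOnZeroLevel : Prop :=
  IsProperMap (fun p : G × zeroLevel μ => ((p.1 • (p.2 : M), (p.2 : M)) : M × M))

/-- Two points of `μ⁻¹(0)` are equivalent if they lie in the same `G`-orbit. -/
def orbitSetoid : Setoid (zeroLevel μ) := (MulAction.orbitRel G M).comap Subtype.val

/-- The orbit space `μ⁻¹(0)/G`, with the quotient topology. -/
abbrev ReducedSpace : Type _ := Quotient (orbitSetoid μ)

/-- The projection `π : μ⁻¹(0) → μ⁻¹(0)/G`. -/
def proj (x : zeroLevel μ) : ReducedSpace μ := Quotient.mk (orbitSetoid μ) x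

/-- The inclusion `i : μ⁻¹(0) → M`. -/
def incl (x : zeroLevel μ) : M := x

variable [IsManifold 𝓘(ℝ, E) ∞ M] {J : ComplexStructure E M}

variable (G) in
/-- Every element of `G` acts on `M` as an automorphism of `(M, [g], J)`: `h^*J = J` and `h^*g` is
conformal to `g`. -/
structure ActsByAutomorphisms (g : HermitianMetric J) : Prop where
  holomorphic : ∀ (h : G) (x : M) (v : TangentSpace 𝓘(ℝ, E) x),
    mfderiv 𝓘(ℝ, E) 𝓘(ℝ, E) (fun y : M => h • y) x (J.toFun x v) =
      J.toFun (h • x) (mfderiv 𝓘(ℝ, E) 𝓘(ℝ, E) (fun y : M => h • y) x v)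
  conformal : ∀ h : G, ∃ f : C^∞⟮𝓘(ℝ, E), M; 𝓘(ℝ, ℝ), ℝ⟯,
    ∀ (x : M) (u v : TangentSpace 𝓘(ℝ, E) x),
      g.inner (h • x) (mfderiv 𝓘(ℝ, E) 𝓘(ℝ, E) (fun y : M => h • y) x u)
        (mfderiv 𝓘(ℝ, E) 𝓘(ℝ, E) (fun y : M => h • y) x v) = Real.exp (f x) * g.inner x u v

/-- `μ` is a momentum map for the action of `G`, which is then twisted Hamiltonian: for `X ∈ 𝔤` one
has `ι_X Ω = d^θ μ^X`, and `μ` is a homomorphism of Lie algebras from `𝔤` to `C^∞(M)` with the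
twisted Poisson bracket. -/
structure IsMomentumMap (g : HermitianMetric J)
    (θ : ∀ x : M, TangentSpace 𝓘(ℝ, E) x →L[ℝ] ℝ) : Prop where
  hamiltonian : ∀ (X : GroupLieAlgebra 𝓘(ℝ, F) G) (x : M),
    flat g x (fundamentalField X x) = twistedDiff θ (μ X) x
  map_lie : ∀ (X Y : GroupLieAlgebra 𝓘(ℝ, F) G) (x : M),
    μ ⁅X, Y⁆ x = twistedPoisson g θ (μ X) (μ Y) x

variable {μ}
  {A : Type*} [NormedAddCommGroup A] [NormedSpace ℝ A] [ChartedSpace A (zeroLevel μ)]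
  {B : Type*} [NormedAddCommGroup B] [NormedSpace ℝ B] [ChartedSpace B (ReducedSpace μ)]

/-- `u ∈ T_x(μ⁻¹(0))` is horizontal: orthogonal to the tangent space `𝔤(x)` of the orbit. -/
def IsHorizontal (g : HermitianMetric J) (x : zeroLevel μ) (u : TangentSpace 𝓘(ℝ, A) x) : Prop :=
  ∀ X : GroupLieAlgebra 𝓘(ℝ, F) G,
    g.inner (incl μ x) (mfderiv 𝓘(ℝ, A) 𝓘(ℝ, E) (incl μ) x u) (fundamentalField X (incl μ x)) = 0

variable (A) [IsManifold 𝓘(ℝ, B) ∞ (ReducedSpace μ)]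

/-- `J'` is induced by `J`: the horizontal spaces are `J`-invariant, and `J'` is the image under
`π` of the restriction of `J` to them. -/
def IsInducedComplexStructure (g : HermitianMetric J)
    (J' : ComplexStructure B (ReducedSpace μ)) : Prop :=
  ∀ (x : zeroLevel μ) (u : TangentSpace 𝓘(ℝ, A) x), IsHorizontal g x u →
    ∃ w : TangentSpace 𝓘(ℝ, A) x, IsHorizontal g x w ∧
      mfderiv 𝓘(ℝ, A) 𝓘(ℝ, E) (incl μ) x w =
        J.toFun (incl μ x) (mfderiv 𝓘(ℝ, A) 𝓘(ℝ, E) (incl μ) x u) ∧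
      mfderiv 𝓘(ℝ, A) 𝓘(ℝ, B) (proj μ) x w =
        J'.toFun (proj μ x) (mfderiv 𝓘(ℝ, A) 𝓘(ℝ, B) (proj μ) x u)

/-- `π^*g' ∼ i^*g` for metrics, on horizontal vectors (`π^*g'` vanishes on vertical ones, while
`i^*g` does not). -/
def MetricCondition (g : HermitianMetric J) (g' : RiemMetric B (ReducedSpace μ)) : Prop :=
  ∃ f : C^∞⟮𝓘(ℝ, A), zeroLevel μ; 𝓘(ℝ, ℝ), ℝ⟯,
    ∀ (x : zeroLevel μ) (u v : TangentSpace 𝓘(ℝ, A) x), IsHorizontal g x u → IsHorizontal g x v →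
      g'.inner (proj μ x) (mfderiv 𝓘(ℝ, A) 𝓘(ℝ, B) (proj μ) x u)
        (mfderiv 𝓘(ℝ, A) 𝓘(ℝ, B) (proj μ) x v) =
      Real.exp (f x) * g.inner (incl μ x) (mfderiv 𝓘(ℝ, A) 𝓘(ℝ, E) (incl μ) x u)
        (mfderiv 𝓘(ℝ, A) 𝓘(ℝ, E) (incl μ) x v)

/-- `π^*Ω' ∼ i^*Ω` for the Kähler forms, on all vectors tangent to `μ⁻¹(0)`. -/
def FormCondition (g : HermitianMetric J) {J' : ComplexStructure B (ReducedSpace μ)}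
    (g' : HermitianMetric J') : Prop :=
  ∃ f : C^∞⟮𝓘(ℝ, A), zeroLevel μ; 𝓘(ℝ, ℝ), ℝ⟯,
    ∀ (x : zeroLevel μ) (u v : TangentSpace 𝓘(ℝ, A) x),
      kahlerForm g' (proj μ x) ![mfderiv 𝓘(ℝ, A) 𝓘(ℝ, B) (proj μ) x u,
        mfderiv 𝓘(ℝ, A) 𝓘(ℝ, B) (proj μ) x v] =
      Real.exp (f x) * kahlerForm g (incl μ x) ![mfderiv 𝓘(ℝ, A) 𝓘(ℝ, E) (incl μ) x u,
        mfderiv 𝓘(ℝ, A) 𝓘(ℝ, E) (incl μ) x v]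

end Action

end LCK

end

open Bundle Manifold
open scoped ContDiff Topology

noncomputable section

/-! At a point of the zero level the term `μ^X θ` vanishes, so `dμ^X = ι_X Ω` there, exactly as in
symplectic reduction. Since `dμ` is onto, the infinitesimal action is injective. The bracket
relation `Ω(X, Y) = μ^{[X,Y]} = 0` puts the orbit directions inside the tangent space of the level.
The normal space of the level is `J` applied to the orbit directions. So the tangent space of `M` is
the orthogonal sum of the orbit directions, their image under `J`, and the horizontal space, and the
last is `J`-invariant (`Slice.kahler_vert`, `Slice.J_hor`).

Invariance of the level: along an orbit, `dμ^Y` in the direction `X` is `μ^{[Y,X]} + μ^Y θ(X)`,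
which is linear in `μ`. By Gronwall `μ` stays zero if it starts at zero, and a connected group is
generated by a neighbourhood of `1` (`IsMomentumMap.smul_mem`).

Smooth structures: a chart of `M` is built as `(f, q, c) ↦ h_f • s(q, c)`, where `h_f` is the group
element with coordinate `f` and `s` is a local section of `μ`, that is, `μ(s(q, c)) = c`. The level
is `c = 0`. By freeness and properness two points of the level in a small chart lie on one orbit
exactly when their `q` agree (`exists_slice`). These slices give the charts `(f, q)` of the level
and `q` of the orbit space, in which the inclusion and the projection are linear.

Complex structure: the group carries horizontal spaces to horizontal spaces and commutes with `J`,
so `J` descends. For integrability, evaluate the Nijenhuis tensor of `J` on horizontal lifts of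
constant fields. The vertical parts of the brackets contribute vectors normal to the level, whereas
all other terms are tangent to it, so these parts drop out and the projection is the Nijenhuis
tensor of the reduced structure (`nijenhuis_reduction`).

Metric: the group preserves only the conformal class, so `g` itself need not descend. At each point
of the orbit space the bilinear forms induced by `g` up to a positive factor form a convex set, and
local choices are glued by a partition of unity (`exists_metric`). If `σ` is a local section of the
projection, the reduced Kähler form is `e^{f∘σ} σ^*Ω`, so `σ^*θ + d(f∘σ)` is a local Lee form. In
real dimension at least 3 the Lee form is unique and the local ones glue; in dimension at most 2
there are no nonzero 3-forms (`isLCK`).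

Uniqueness is pointwise: every tangent vector of the orbit space has a horizontal lift, which
determines the complex structure and makes any two admissible metrics proportional at each point;
the factor is then automatically smooth. -/

namespace LCK


/-! ### Integrability of fields of endomorphisms on a vector space -/

section FlatNijenhuis

variable {V : Type*} [NormedAddCommGroup V] [NormedSpace ℝ V]

/-- The Nijenhuis tensor of a field `J` of endomorphisms of a vector space, evaluated on constant
vector fields. -/
def nijenhuis (J : V → V →L[ℝ] V) (w u v : V) : V :=
  fderiv ℝ J w (J w u) v - fderiv ℝ J w (J w v) u + J w (fderiv ℝ J w v u)
    - J w (fderiv ℝ J w u v)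

/-- The Nijenhuis expression of two vector fields is tensorial. -/
theorem lieBracket_nijenhuis {J : V → V →L[ℝ] V} {w : V} {X Y : V → V}
    (hJ : DifferentiableAt ℝ J w) (hX : DifferentiableAt ℝ X w) (hY : DifferentiableAt ℝ Y w)
    (hsq : ∀ v, J w (J w v) = -v) :
    VectorField.lieBracket ℝ (fun y => J y (X y)) (fun y => J y (Y y)) w
      - J w (VectorField.lieBracket ℝ (fun y => J y (X y)) Y w)
      - J w (VectorField.lieBracket ℝ X (fun y => J y (Y y)) w)
      - VectorField.lieBracket ℝ X Y w = nijenhuis J w (X w) (Y w) := by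
  have e1 : ∀ Z : V → V, DifferentiableAt ℝ Z w → ∀ t, fderiv ℝ (fun y => J y (Z y)) w t =
      J w (fderiv ℝ Z w t) + fderiv ℝ J w t (Z w) := by
    intro Z hZ t
    rw [fderiv_clm_apply hJ hZ]
    simp
  simp only [VectorField.lieBracket, e1 X hX, e1 Y hY, nijenhuis, map_sub, map_add, hsq]
  abel

variable {F B C : Type*} [NormedAddCommGroup F] [NormedSpace ℝ F] [NormedAddCommGroup B]
  [NormedSpace ℝ B] [NormedAddCommGroup C] [NormedSpace ℝ C]

/-- Integrability descends from `J` to the field `J'` it induces on horizontal vectors: here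
`(F × B) × {0}` is the level set, whose orbits are the fibres of the projection to `B`, and `L` is
the horizontal lift. -/
theorem nijenhuis_reduction {J : (F × B) × C → (F × B) × C →L[ℝ] (F × B) × C}
    {L : (F × B) × C → B →L[ℝ] (F × B) × C} {J' : B → B →L[ℝ] B} {s₀ : F × B}
    {b : (F × B) × C →L[ℝ] (F × B) × C →L[ℝ] ℝ}
    (hJ : DifferentiableAt ℝ J (s₀, 0)) (hL : DifferentiableAt ℝ L (s₀, 0))
    (hJ' : DifferentiableAt ℝ J' s₀.2)
    (hsq : ∀ v, J (s₀, 0) (J (s₀, 0) v) = -v)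
    (hN : ∀ u v, nijenhuis J (s₀, 0) u v = 0)
    (hLB : ∀ w u, (L w u).1.2 = u) (hLC : ∀ w u, (L w u).2 = 0)
    (hJL : ∀ᶠ s in 𝓝 s₀, ∀ u, J (s, 0) (L (s, 0) u) = L (s, 0) (J' s.2 u))
    (hpos : ∀ v, v ≠ 0 → 0 < b v v)
    (hvert : ∀ (f : F) (t : F × B), b (J (s₀, 0) ((f, 0), 0)) (t, 0) = 0) (u v : B) :
    nijenhuis J' s₀.2 u v = 0 := by
  set w₀ : (F × B) × C := (s₀, 0) with hw₀
  have hLd : ∀ u : B, DifferentiableAt ℝ (fun w => L w u) w₀ := fun u =>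
    hL.clm_apply (differentiableAt_const u)
  have hJLd : ∀ u : B, DifferentiableAt ℝ (fun w => J w (L w u)) w₀ := fun u =>
    hJ.clm_apply (hLd u)
  -- derivatives along the level set
  have dLB : ∀ (u : B) (t : (F × B) × C), (fderiv ℝ (fun w => L w u) w₀ t).1.2 = 0 := by
    intro u t
    have h1 := ((ContinuousLinearMap.snd ℝ F B).comp
      (ContinuousLinearMap.fst ℝ (F × B) C)).hasFDerivAt.comp w₀ (hLd u).hasFDerivAt
    have h2 : HasFDerivAt (fun _ : (F × B) × C => u) (0 : (F × B) × C →L[ℝ] B) w₀ :=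
      hasFDerivAt_const u w₀
    have h3 : (((ContinuousLinearMap.snd ℝ F B).comp
      (ContinuousLinearMap.fst ℝ (F × B) C)) ∘ fun w => L w u) = fun _ => u := by
      funext w; exact hLB w u
    rw [h3] at h1
    exact congrArg (fun l : (F × B) × C →L[ℝ] B => l t) (h1.unique h2)
  have dLC : ∀ (u : B) (t : (F × B) × C), (fderiv ℝ (fun w => L w u) w₀ t).2 = 0 := by
    intro u t
    have h1 := (ContinuousLinearMap.snd ℝ (F × B) C).hasFDerivAt.comp w₀ (hLd u).hasFDerivAt
    have h2 : HasFDerivAt (fun _ : (F × B) × C => (0 : C)) (0 : (F × B) × C →L[ℝ] C) w₀ :=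
      hasFDerivAt_const 0 w₀
    have h3 : ((ContinuousLinearMap.snd ℝ (F × B) C) ∘ fun w => L w u) = fun _ => 0 := by
      funext w; exact hLC w u
    rw [h3] at h1
    exact congrArg (fun l : (F × B) × C →L[ℝ] C => l t) (h1.unique h2)
  -- The relation `J L = L J'` is known on the level set only, so it may be differentiated only in
  -- directions `(t, 0)`. All brackets below need just those directions.
  have key : ∀ (u : B) (t : F × B),
      (fderiv ℝ (fun w => J w (L w u)) w₀ (t, 0)).1.2 = fderiv ℝ J' s₀.2 t.2 u ∧
      (fderiv ℝ (fun w => J w (L w u)) w₀ (t, 0)).2 = 0 := by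
    intro u t
    have hi : HasFDerivAt (fun s : F × B => ((s, 0) : (F × B) × C))
        (ContinuousLinearMap.inl ℝ (F × B) C) s₀ :=
      (ContinuousLinearMap.inl ℝ (F × B) C).hasFDerivAt
    have h1 := (hJLd u).hasFDerivAt.comp s₀ hi
    have hB := ((ContinuousLinearMap.snd ℝ F B).comp
      (ContinuousLinearMap.fst ℝ (F × B) C)).hasFDerivAt.comp s₀ h1
    have hC := (ContinuousLinearMap.snd ℝ (F × B) C).hasFDerivAt.comp s₀ h1
    constructor
    · have h2 : HasFDerivAt (fun s : F × B => J' s.2 u)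
          ((ContinuousLinearMap.apply ℝ B u).comp
            ((fderiv ℝ J' s₀.2).comp (ContinuousLinearMap.snd ℝ F B))) s₀ := by
        have h3 : HasFDerivAt (fun s : F × B => J' s.2)
          ((fderiv ℝ J' s₀.2).comp (ContinuousLinearMap.snd ℝ F B)) s₀ :=
          hJ'.hasFDerivAt.comp s₀ (ContinuousLinearMap.snd ℝ F B).hasFDerivAt
        exact (ContinuousLinearMap.apply ℝ B u).hasFDerivAt.comp s₀ h3
      have h4 := hB.congr_of_eventuallyEq (f₁ := fun s : F × B => J' s.2 u) (by
        filter_upwards [hJL] with s hs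
        simp [hs, hLB])
      exact congrArg (fun l : F × B →L[ℝ] B => l t) (h4.unique h2)
    · have h2 : HasFDerivAt (fun _ : F × B => (0 : C)) (0 : F × B →L[ℝ] C) s₀ :=
        hasFDerivAt_const 0 s₀
      have h4 := hC.congr_of_eventuallyEq (f₁ := fun s : F × B => (0 : C)) (by
        filter_upwards [hJL] with s hs
        simp [hs, hLC])
      exact congrArg (fun l : F × B →L[ℝ] C => l t) (h4.unique h2)
  have hJL₀ : ∀ u, J w₀ (L w₀ u) = L w₀ (J' s₀.2 u) := hJL.self_of_nhds
  have hLt : ∀ u, L w₀ u = ((L w₀ u).1, 0) := fun u => Prod.ext rfl (hLC w₀ u)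
  -- The Nijenhuis identity is evaluated on the horizontal lifts of the constant fields `u` and `v`.
  have main := lieBracket_nijenhuis (X := fun w => L w u) (Y := fun w => L w v) hJ (hLd u) (hLd v)
    hsq
  rw [hN] at main
  simp only [VectorField.lieBracket, hJL₀] at main
  set DJu := fderiv ℝ (fun w => J w (L w u)) w₀
  set DJv := fderiv ℝ (fun w => J w (L w v)) w₀
  set Du := fderiv ℝ (fun w => L w u) w₀
  set Dv := fderiv ℝ (fun w => L w v) w₀
  have kB : ∀ (u' : B) x, (fderiv ℝ (fun w => J w (L w u')) w₀ (L w₀ x)).1.2 =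
      fderiv ℝ J' s₀.2 x u' := by
    intro u' x
    have := (key u' (L w₀ x).1).1
    rwa [← hLt, hLB] at this
  have kC : ∀ (u' : B) x, (fderiv ℝ (fun w => J w (L w u')) w₀ (L w₀ x)).2 = 0 := by
    intro u' x
    have := (key u' (L w₀ x).1).2
    rwa [← hLt] at this
  -- a tangent vector is the lift of its projection plus a vertical vector
  have split : ∀ z : (F × B) × C, z.2 = 0 → ∃ f : F, z = L w₀ z.1.2 + ((f, 0), 0) := by
    intro z hz
    refine ⟨z.1.1 - (L w₀ z.1.2).1.1, ?_⟩
    refine Prod.ext (Prod.ext ?_ ?_) ?_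
    · simp
    · simp [hLB]
    · simp [hLC, hz]
  -- The brackets `[JX, Y]` and `[X, JY]` are tangent to the level, hence horizontal lifts up to
  -- vertical errors `f₁` and `f₂`.
  obtain ⟨f₁, hf₁⟩ := split (Dv (L w₀ (J' s₀.2 u)) - DJu (L w₀ v)) (by
    simp only [Prod.snd_sub, Dv, DJu, dLC, kC, sub_zero])
  obtain ⟨f₂, hf₂⟩ := split (DJv (L w₀ u) - Du (L w₀ (J' s₀.2 v))) (by
    simp only [Prod.snd_sub, Du, DJv, dLC, kC, sub_zero])
  have p1 : (Dv (L w₀ (J' s₀.2 u)) - DJu (L w₀ v)).1.2 = - fderiv ℝ J' s₀.2 v u := by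
    simp only [Prod.fst_sub, Prod.snd_sub, Dv, DJu, dLB, kB, zero_sub]
  have p2 : (DJv (L w₀ u) - Du (L w₀ (J' s₀.2 v))).1.2 = fderiv ℝ J' s₀.2 u v := by
    simp only [Prod.fst_sub, Prod.snd_sub, Du, DJv, dLB, kB, sub_zero]
  rw [hf₁, hf₂, p1, p2] at main
  simp only [map_add, hJL₀] at main
  set T : (F × B) × C := DJv (L w₀ (J' s₀.2 u)) - DJu (L w₀ (J' s₀.2 v))
    - (Dv (L w₀ u) - Du (L w₀ v)) - L w₀ (J' s₀.2 (-fderiv ℝ J' s₀.2 v u))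
    - L w₀ (J' s₀.2 (fderiv ℝ J' s₀.2 u v)) with hT
  -- `T` collects all terms of the identity except the images under `J` of the vertical errors.
  have hTJ : T = J w₀ ((f₁ + f₂, 0), 0) := by
    have : J w₀ ((f₁ + f₂, 0), 0) = J w₀ ((f₁, 0), 0) + J w₀ ((f₂, 0), 0) := by
      rw [← map_add]; simp
    rw [this, hT, ← sub_eq_zero]
    rw [← main]
    abel
  have hTC : T.2 = 0 := by
    simp only [hT, Prod.snd_sub, DJu, DJv, Du, Dv, dLC, kC, hLC, sub_zero]
  -- `T` is tangent to the level, while `J` of a vertical vector is orthogonal to it, so `b T T =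
  -- 0`.
  have hT0 : T = 0 := by
    by_contra hne
    have h1 := hpos T hne
    have h2 : b T T = 0 := by
      have h3 := hvert (f₁ + f₂) T.1
      rw [← hTJ] at h3
      have h4 : (T.1, (0 : C)) = T := Prod.ext rfl hTC.symm
      rwa [h4] at h3
    exact h1.ne' h2
  -- The `B`-component of `T` is the Nijenhuis tensor of `J'`.
  have hfin : T.1.2 = 0 := by rw [hT0]; rfl
  simp only [hT, Prod.fst_sub, Prod.snd_sub, Prod.fst_add, Prod.snd_add, DJu, DJv, Du, Dv, dLB, kB,
    hLB, sub_zero, map_neg, sub_neg_eq_add] at hfin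
  rw [nijenhuis, ← hfin]

end FlatNijenhuis

theorem _root_.ContDiffAt.bilinearComp {W V D D' : Type*} [NormedAddCommGroup W] [NormedSpace ℝ W]
    [NormedAddCommGroup V] [NormedSpace ℝ V] [NormedAddCommGroup D] [NormedSpace ℝ D]
    [NormedAddCommGroup D'] [NormedSpace ℝ D'] {n : WithTop ℕ∞}
    {b : W → V →L[ℝ] V →L[ℝ] ℝ} {w : W}
    (hb : ContDiffAt ℝ n b w) (i : D →L[ℝ] V) (j : D' →L[ℝ] V) :
    ContDiffAt ℝ n (fun w => (b w).bilinearComp i j) w := by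
  have h1 : ContDiffAt ℝ n (fun w => (ContinuousLinearMap.precomp ℝ j).comp ((b w).comp i)) w :=
    contDiffAt_const.clm_comp (hb.clm_comp contDiffAt_const)
  exact h1

/-! ### Linear algebra of horizontal lifts -/

section HorizontalLift

variable {F B C : Type*} [NormedAddCommGroup F] [NormedSpace ℝ F] [NormedAddCommGroup B]
  [NormedSpace ℝ B] [NormedAddCommGroup C] [NormedSpace ℝ C]

variable (F B C) in
/-- The inclusion of the vertical directions. -/
def vertIncl : F →L[ℝ] (F × B) × C :=
  (ContinuousLinearMap.inl ℝ (F × B) C).comp (ContinuousLinearMap.inl ℝ F B)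

variable (F B C) in
/-- The inclusion of the transversal directions within the level set. -/
def transIncl : B →L[ℝ] (F × B) × C :=
  (ContinuousLinearMap.inl ℝ (F × B) C).comp (ContinuousLinearMap.inr ℝ F B)

@[simp] theorem vertIncl_apply (f : F) : vertIncl F B C f = ((f, 0), 0) := rfl

@[simp] theorem transIncl_apply (u : B) : transIncl F B C u = ((0, u), 0) := rfl

/-- The lift of a vector of `B` to `(F × B) × {0}` which is orthogonal to `F` with respect to the
bilinear form `b`. -/
def horLift (b : (F × B) × C →L[ℝ] (F × B) × C →L[ℝ] ℝ) : B →L[ℝ] (F × B) × C :=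
  transIncl F B C - (vertIncl F B C).comp
    ((b.bilinearComp (vertIncl F B C) (vertIncl F B C)).inverse.comp
      (b.bilinearComp (transIncl F B C) (vertIncl F B C)))

theorem horLift_fst_snd (b : (F × B) × C →L[ℝ] (F × B) × C →L[ℝ] ℝ) (u : B) :
    (horLift b u).1.2 = u := by
  simp [horLift]

theorem horLift_snd (b : (F × B) × C →L[ℝ] (F × B) × C →L[ℝ] ℝ) (u : B) :
    (horLift b u).2 = 0 := by
  simp [horLift]

variable [FiniteDimensional ℝ F]

theorem isInvertible_of_pos {b : F →L[ℝ] F →L[ℝ] ℝ} (hpos : ∀ v, v ≠ 0 → 0 < b v v) :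
    b.IsInvertible := by
  have hinj : Function.Injective b := by
    rw [injective_iff_map_eq_zero]
    intro v hv
    by_contra hne
    have := hpos v hne
    rw [hv] at this
    simp at this
  have hfin : Module.finrank ℝ F = Module.finrank ℝ (F →L[ℝ] ℝ) := by
    rw [← (LinearMap.toContinuousLinearMap (𝕜 := ℝ) (E := F) (F' := ℝ)).finrank_eq]
    exact (Subspace.dual_finrank_eq (K := ℝ) (V := F)).symm
  exact ⟨(LinearEquiv.ofInjectiveOfFinrankEq b.toLinearMap hinj hfin).toContinuousLinearEquiv, by
    ext; rfl⟩

theorem isInvertible_vert {b : (F × B) × C →L[ℝ] (F × B) × C →L[ℝ] ℝ}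
    (hpos : ∀ v, v ≠ 0 → 0 < b v v) :
    (b.bilinearComp (vertIncl F B C) (vertIncl F B C)).IsInvertible := by
  refine isInvertible_of_pos fun v hv => ?_
  refine hpos _ fun h => hv ?_
  simpa using h

/-- The subtracted term is the vertical vector that has the same pairing with all vertical vectors
as `u`. It exists because `b` is nondegenerate on the vertical space. -/
theorem horLift_orthogonal {b : (F × B) × C →L[ℝ] (F × B) × C →L[ℝ] ℝ}
    (hpos : ∀ v, v ≠ 0 → 0 < b v v) (u : B) (f : F) : b (horLift b u) ((f, 0), 0) = 0 := by
  obtain ⟨e, he⟩ := isInvertible_vert hpos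
  have h1 : ∀ (φ : F →L[ℝ] ℝ),
      b (vertIncl F B C ((b.bilinearComp (vertIncl F B C) (vertIncl F B C)).inverse φ))
        (vertIncl F B C f) = φ f := by
    intro φ
    change b.bilinearComp (vertIncl F B C) (vertIncl F B C)
      ((b.bilinearComp (vertIncl F B C) (vertIncl F B C)).inverse φ) f = φ f
    rw [← he]
    simp
  have h2 := h1 (b.bilinearComp (transIncl F B C) (vertIncl F B C) u)
  rw [← vertIncl_apply (B := B) (C := C) f]
  simp only [horLift, sub_apply, ContinuousLinearMap.comp_apply, map_sub, h2]
  simp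

/-- The difference of two candidates is vertical and orthogonal to the vertical space, so positivity
forces it to vanish. -/
theorem eq_horLift {b : (F × B) × C →L[ℝ] (F × B) × C →L[ℝ] ℝ}
    (hpos : ∀ v, v ≠ 0 → 0 < b v v) {z : (F × B) × C} (hz : z.2 = 0)
    (h : ∀ f : F, b z ((f, 0), 0) = 0) : z = horLift b z.1.2 := by
  by_contra hne
  have hne' : z - horLift b z.1.2 ≠ 0 := sub_ne_zero.mpr hne
  have h1 : z - horLift b z.1.2 = (((z - horLift b z.1.2).1.1, 0), 0) :=
    Prod.ext (Prod.ext rfl (by simp [horLift_fst_snd])) (by simp [horLift_snd, hz])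
  have h2 : b (z - horLift b z.1.2) (z - horLift b z.1.2) = 0 := by
    conv_lhs => rw [h1]
    rw [← h1, h1, ← h1]
    nth_rewrite 2 [h1]
    rw [map_sub, sub_apply, h, horLift_orthogonal hpos, sub_zero]
  exact (hpos _ hne').ne' h2

/-- The only nonlinear ingredient is the inverse of the vertical block, and inversion is smooth at
invertible operators. -/
theorem contDiffAt_horLift [FiniteDimensional ℝ B] [FiniteDimensional ℝ C]
    {W : Type*} [NormedAddCommGroup W] [NormedSpace ℝ W]
    {b : W → (F × B) × C →L[ℝ] (F × B) × C →L[ℝ] ℝ} {w : W}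
    (hb : ContDiffAt ℝ ∞ b w) (hpos : ∀ v, v ≠ 0 → 0 < b w v v) :
    ContDiffAt ℝ ∞ (fun w => horLift (b w)) w := by
  have hinv : ContDiffAt ℝ ∞
      (fun w => ((b w).bilinearComp (vertIncl F B C) (vertIncl F B C)).inverse) w :=
    ContDiffAt.comp (g := ContinuousLinearMap.inverse) w
      (isInvertible_vert hpos).contDiffAt_map_inverse
      (hb.bilinearComp (vertIncl F B C) (vertIncl F B C))
  exact contDiffAt_const.sub (contDiffAt_const.clm_comp (hinv.clm_comp (hb.bilinearComp _ _)))

/-- A vector which is orthogonal to `J F` is tangent to `F × B` if the latter is orthogonal to `J F`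
and `C` has the dimension of `F`. -/
theorem snd_eq_zero_of_orthogonal [FiniteDimensional ℝ C]
    (hdim : Module.finrank ℝ F = Module.finrank ℝ C)
    {b : (F × B) × C →L[ℝ] (F × B) × C →L[ℝ] ℝ} {J : (F × B) × C →L[ℝ] (F × B) × C}
    (hpos : ∀ v, v ≠ 0 → 0 < b v v) (hsq : ∀ v, J (J v) = -v)
    (hvert : ∀ (f : F) (t : F × B), b (J ((f, 0), 0)) (t, 0) = 0)
    {z : (F × B) × C} (hz : ∀ f : F, b (J ((f, 0), 0)) z = 0) : z.2 = 0 := by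
  -- `J F` pairs with a vector only through its `C`-component. By positivity the pairing of `F` with
  -- `C` is injective in `F`, and equality of dimensions makes it onto the dual of `C`, so it
  -- detects every nonzero `C`-component.
  let T : F →L[ℝ] C →L[ℝ] ℝ :=
    b.bilinearComp (J.comp (vertIncl F B C)) (ContinuousLinearMap.inr ℝ (F × B) C)
  have hT : ∀ f c, T f c = b (J ((f, 0), 0)) (0, c) := fun f c => rfl
  have hsplit : ∀ f (y : (F × B) × C), b (J ((f, 0), 0)) y = T f y.2 := by
    intro f y
    have : y = (y.1, 0) + (0, y.2) := by simp
    rw [hT]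
    conv_lhs => rw [this, map_add, hvert, zero_add]
  have hinj : Function.Injective T := by
    rw [injective_iff_map_eq_zero]
    intro f hf
    have h1 : b (J ((f, 0), 0)) = 0 := by
      refine ContinuousLinearMap.ext fun y => ?_
      rw [hsplit, hf]; rfl
    have h2 : J ((f, 0), 0) = 0 := by
      by_contra hne
      have := hpos _ hne
      rw [h1] at this
      simp at this
    have h3 := hsq ((f, 0), 0)
    rw [h2, map_zero] at h3
    have h4 := neg_eq_zero.mp h3.symm
    simpa using h4
  have hfin : Module.finrank ℝ F = Module.finrank ℝ (C →L[ℝ] ℝ) := by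
    rw [← (LinearMap.toContinuousLinearMap (𝕜 := ℝ) (E := C) (F' := ℝ)).finrank_eq, hdim]
    exact (Subspace.dual_finrank_eq (K := ℝ) (V := C)).symm
  have hsurj : Function.Surjective T :=
    (LinearMap.injective_iff_surjective_of_finrank_eq_finrank (f := T.toLinearMap) hfin).mp hinj
  by_contra hne
  obtain ⟨φ, hφ⟩ := SeparatingDual.exists_ne_zero (R := ℝ) hne
  obtain ⟨f, hf⟩ := hsurj φ
  apply hφ
  rw [← hf, ← hsplit, hz]

/-- The horizontal vectors are invariant under `J`. -/
theorem J_horLift [FiniteDimensional ℝ C]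
    (hdim : Module.finrank ℝ F = Module.finrank ℝ C)
    {b : (F × B) × C →L[ℝ] (F × B) × C →L[ℝ] ℝ} {J : (F × B) × C →L[ℝ] (F × B) × C}
    (hpos : ∀ v, v ≠ 0 → 0 < b v v) (hsymm : ∀ u v, b u v = b v u) (hsq : ∀ v, J (J v) = -v)
    (hherm : ∀ u v, b (J u) (J v) = b u v)
    (hvert : ∀ (f : F) (t : F × B), b (J ((f, 0), 0)) (t, 0) = 0) (u : B) :
    J (horLift b u) = horLift b (J (horLift b u)).1.2 := by
  refine eq_horLift hpos ?_ fun f => ?_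
  · refine snd_eq_zero_of_orthogonal hdim hpos hsq hvert fun f => ?_
    rw [hherm, hsymm, horLift_orthogonal hpos]
  -- `b(J h, f) = b(J J h, J f) = -b(h, J f)`, which vanishes as `h` is tangent to the level and `J
  -- f` is normal to it.
  · have h1 := hherm (J (horLift b u)) ((f, 0), 0)
    rw [hsq, map_neg, neg_apply] at h1
    have h2 : horLift b u = ((horLift b u).1, 0) := Prod.ext rfl (horLift_snd b u)
    rw [← h1, hsymm, h2, hvert, neg_zero]

end HorizontalLift


/-- A linear map on a finite-dimensional space amounts to its values on a basis. This reduces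
smoothness of fields of forms and endomorphisms to smoothness of their evaluations. -/
theorem contDiffAt_clm_of_apply {D E F : Type*} [NormedAddCommGroup D] [NormedSpace ℝ D]
    [NormedAddCommGroup E] [NormedSpace ℝ E] [NormedAddCommGroup F] [NormedSpace ℝ F]
    [FiniteDimensional ℝ E] {n : WithTop ℕ∞} {f : D → E →L[ℝ] F} {x : D}
    (h : ∀ y, ContDiffAt ℝ n (fun z => f z y) x) : ContDiffAt ℝ n f x := by
  let d := Module.finrank ℝ E
  have hd : d = Module.finrank ℝ (Fin d → ℝ) := (Module.finrank_fin_fun ℝ).symm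
  let e₁ := ContinuousLinearEquiv.ofFinrankEq hd
  let e₂ := (e₁.arrowCongr (1 : F ≃L[ℝ] F)).trans (ContinuousLinearEquiv.piRing (Fin d))
  rw [← Function.id_comp f, ← e₂.symm_comp_self]
  exact e₂.symm.contDiff.contDiffAt.comp x (contDiffAt_pi.mpr fun i => h _)

/-! ### Pulling tensor fields back to vector spaces -/

section Pullback

variable {E : Type*} [NormedAddCommGroup E] [NormedSpace ℝ E]
  {M : Type*} [TopologicalSpace M] [ChartedSpace E M]
  {V : Type*} [NormedAddCommGroup V] [NormedSpace ℝ V]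

/-- The derivative of a map from a vector space to a manifold, as a map between the model
spaces. -/
def tderiv (E : Type*) [NormedAddCommGroup E] [NormedSpace ℝ E] {M : Type*} [TopologicalSpace M]
    [ChartedSpace E M] (φ : V → M) (w : V) : V →L[ℝ] E := mfderiv 𝓘(ℝ, V) 𝓘(ℝ, E) φ w

/-- A bilinear form on the tangent space, as a form on the model space. -/
def bilinAt (g : ∀ x : M, TangentSpace 𝓘(ℝ, E) x →L[ℝ] TangentSpace 𝓘(ℝ, E) x →L[ℝ] ℝ) (x : M) :
    E →L[ℝ] E →L[ℝ] ℝ := g x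

/-- An endomorphism of the tangent space, as an endomorphism of the model space. -/
def endAt (A : ∀ x : M, TangentSpace 𝓘(ℝ, E) x →L[ℝ] TangentSpace 𝓘(ℝ, E) x) (x : M) :
    E →L[ℝ] E := A x

/-- The pullback of a field of bilinear forms. -/
def pullBilin (g : ∀ x : M, TangentSpace 𝓘(ℝ, E) x →L[ℝ] TangentSpace 𝓘(ℝ, E) x →L[ℝ] ℝ)
    (φ : V → M) (w : V) : V →L[ℝ] V →L[ℝ] ℝ :=
  (bilinAt g (φ w)).bilinearComp (tderiv E φ w) (tderiv E φ w)

/-- The pullback of a field of endomorphisms. -/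
def pullEnd (A : ∀ x : M, TangentSpace 𝓘(ℝ, E) x →L[ℝ] TangentSpace 𝓘(ℝ, E) x)
    (φ : V → M) (w : V) : V →L[ℝ] V :=
  (tderiv E φ w).inverse.comp ((endAt A (φ w)).comp (tderiv E φ w))

theorem tderiv_pullEnd {A : ∀ x : M, TangentSpace 𝓘(ℝ, E) x →L[ℝ] TangentSpace 𝓘(ℝ, E) x}
    {φ : V → M} {w : V} (h : (tderiv E φ w).IsInvertible) (u : V) :
    tderiv E φ w (pullEnd A φ w u) = endAt A (φ w) (tderiv E φ w u) := by
  obtain ⟨e, he⟩ := h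
  simp only [pullEnd, ContinuousLinearMap.comp_apply]
  rw [← he]
  simp

variable [IsManifold 𝓘(ℝ, E) ∞ M]

/-- The derivative of a smooth map, applied to a smooth vector field along a map, is smooth. -/
theorem contMDiffAt_mfderiv_apply {E' : Type*} [NormedAddCommGroup E'] [NormedSpace ℝ E']
    {M' : Type*} [TopologicalSpace M'] [ChartedSpace E' M'] [IsManifold 𝓘(ℝ, E') ∞ M']
    {b : V → M} {v : ∀ y : V, TangentSpace 𝓘(ℝ, E) (b y)} {f : M → M'} {w : V}
    (hf : ContMDiffAt 𝓘(ℝ, E) 𝓘(ℝ, E') ∞ f (b w))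
    (hv : ContMDiffAt 𝓘(ℝ, V) 𝓘(ℝ, E).tangent ∞
      (fun y => (⟨b y, v y⟩ : TangentBundle 𝓘(ℝ, E) M)) w) :
    ContMDiffAt 𝓘(ℝ, V) 𝓘(ℝ, E').tangent ∞
      (fun y => (⟨f (b y), mfderiv 𝓘(ℝ, E) 𝓘(ℝ, E') f (b y) (v y)⟩ :
        TangentBundle 𝓘(ℝ, E') M')) w := by
  have hb : ContMDiffAt 𝓘(ℝ, V) 𝓘(ℝ, E) ∞ b w := (contMDiffAt_totalSpace.mp hv).1
  have hϕ := ContMDiffAt.mfderiv (m := ∞) (n := ∞) (x₀ := w) (fun _ : V => f) b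
    (hf.comp_of_eq contMDiffAt_snd rfl) hb (by simp)
  exact ContMDiffAt.clm_apply_of_inCoordinates (b₁ := b) (b₂ := fun y => f (b y))
    (ϕ := fun y => mfderiv 𝓘(ℝ, E) 𝓘(ℝ, E') f (b y)) (v := v) hϕ hv (hf.comp w hb)

theorem contMDiffAt_tderiv {φ : V → M} {w : V} {u : V → V}
    (hφ : ContMDiffAt 𝓘(ℝ, V) 𝓘(ℝ, E) ∞ φ w) (hu : ContDiffAt ℝ ∞ u w) :
    ContMDiffAt 𝓘(ℝ, V) 𝓘(ℝ, E).tangent ∞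
      (fun y => (⟨φ y, tderiv E φ y (u y)⟩ : TangentBundle 𝓘(ℝ, E) M)) w := by
  have h1 : ContMDiffAt 𝓘(ℝ, V) 𝓘(ℝ, V).tangent ∞
      (fun y => (⟨y, u y⟩ : TangentBundle 𝓘(ℝ, V) V)) w :=
    contMDiffAt_vectorSpace_iff_contDiffAt.mpr hu
  exact contMDiffAt_mfderiv_apply (b := fun y : V => y) (v := u) hφ h1

theorem contDiffAt_pullBilin_apply
    {g : ∀ x : M, TangentSpace 𝓘(ℝ, E) x →L[ℝ] TangentSpace 𝓘(ℝ, E) x →L[ℝ] ℝ}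
    (hg : ContMDiff 𝓘(ℝ, E) (𝓘(ℝ, E).prod 𝓘(ℝ, E →L[ℝ] E →L[ℝ] ℝ)) ∞
      (fun x => TotalSpace.mk' (E →L[ℝ] E →L[ℝ] ℝ)
        (E := fun x : M => TangentSpace 𝓘(ℝ, E) x →L[ℝ] TangentSpace 𝓘(ℝ, E) x →L[ℝ] ℝ) x (g x)))
    {φ : V → M} {w : V} (hφ : ContMDiffAt 𝓘(ℝ, V) 𝓘(ℝ, E) ∞ φ w)
    {u v : ∀ y, TangentSpace 𝓘(ℝ, E) (φ y)}
    (hu : ContMDiffAt 𝓘(ℝ, V) 𝓘(ℝ, E).tangent ∞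
      (fun y => (⟨φ y, u y⟩ : TangentBundle 𝓘(ℝ, E) M)) w)
    (hv : ContMDiffAt 𝓘(ℝ, V) 𝓘(ℝ, E).tangent ∞
      (fun y => (⟨φ y, v y⟩ : TangentBundle 𝓘(ℝ, E) M)) w) :
    ContDiffAt ℝ ∞ (fun y => g (φ y) (u y) (v y)) w := by
  have h : ContMDiffAt 𝓘(ℝ, V) (𝓘(ℝ, E).prod 𝓘(ℝ, ℝ)) ∞
      (fun m ↦ TotalSpace.mk' ℝ (E := Bundle.Trivial M ℝ) (φ m) (g (φ m) (u m) (v m))) w := by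
    apply ContMDiffAt.clm_bundle_apply₂ (F₁ := E) (F₂ := E)
    · exact ContMDiffAt.comp w hg.contMDiffAt hφ
    · exact hu
    · exact hv
  simp only [contMDiffAt_totalSpace] at h
  exact h.2.contDiffAt

theorem contDiffAt_pullBilin [FiniteDimensional ℝ V]
    {g : ∀ x : M, TangentSpace 𝓘(ℝ, E) x →L[ℝ] TangentSpace 𝓘(ℝ, E) x →L[ℝ] ℝ}
    (hg : ContMDiff 𝓘(ℝ, E) (𝓘(ℝ, E).prod 𝓘(ℝ, E →L[ℝ] E →L[ℝ] ℝ)) ∞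
      (fun x => TotalSpace.mk' (E →L[ℝ] E →L[ℝ] ℝ)
        (E := fun x : M => TangentSpace 𝓘(ℝ, E) x →L[ℝ] TangentSpace 𝓘(ℝ, E) x →L[ℝ] ℝ) x (g x)))
    {φ : V → M} {w : V} (hφ : ContMDiffAt 𝓘(ℝ, V) 𝓘(ℝ, E) ∞ φ w) :
    ContDiffAt ℝ ∞ (pullBilin g φ) w := by
  refine contDiffAt_clm_of_apply fun u => contDiffAt_clm_of_apply fun v => ?_
  exact contDiffAt_pullBilin_apply hg hφ (contMDiffAt_tderiv hφ contDiffAt_const)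
    (contMDiffAt_tderiv hφ contDiffAt_const)

end Pullback

/-! ### Smooth parametrizations and tensor fields in coordinates -/

section LocalDiffeo

variable {E : Type*} [NormedAddCommGroup E] [NormedSpace ℝ E]
  {M : Type*} [TopologicalSpace M] [ChartedSpace E M]
  {V : Type*} [NormedAddCommGroup V] [NormedSpace ℝ V]

variable (E) in
/-- A local parametrization of a manifold by a vector space which is smooth in both directions. -/
structure IsParam (Φ : OpenPartialHomeomorph V M) : Prop where
  smooth : ContMDiffOn 𝓘(ℝ, V) 𝓘(ℝ, E) ∞ Φ Φ.source
  smooth_symm : ContMDiffOn 𝓘(ℝ, E) 𝓘(ℝ, V) ∞ Φ.symm Φ.target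

variable {Φ : OpenPartialHomeomorph V M} {w : V}

theorem IsParam.contMDiffAt (h : IsParam E Φ) (hw : w ∈ Φ.source) :
    ContMDiffAt 𝓘(ℝ, V) 𝓘(ℝ, E) ∞ Φ w :=
  h.smooth.contMDiffAt (Φ.open_source.mem_nhds hw)

theorem IsParam.contMDiffAt_symm (h : IsParam E Φ) {x : M} (hx : x ∈ Φ.target) :
    ContMDiffAt 𝓘(ℝ, E) 𝓘(ℝ, V) ∞ Φ.symm x :=
  h.smooth_symm.contMDiffAt (Φ.open_target.mem_nhds hx)

/-- The derivative of the inverse of a parametrization, as a map between model spaces. -/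
def symmDeriv (E : Type*) [NormedAddCommGroup E] [NormedSpace ℝ E] {M : Type*} [TopologicalSpace M]
    [ChartedSpace E M] (Φ : OpenPartialHomeomorph V M) (w : V) : E →L[ℝ] V :=
  mfderiv 𝓘(ℝ, E) 𝓘(ℝ, V) Φ.symm (Φ w)

theorem IsParam.mdifferentiable (h : IsParam E Φ) : Φ.MDifferentiable 𝓘(ℝ, V) 𝓘(ℝ, E) :=
  ⟨h.smooth.mdifferentiableOn (by simp), h.smooth_symm.mdifferentiableOn (by simp)⟩

theorem IsParam.symmDeriv_comp (h : IsParam E Φ) (hw : w ∈ Φ.source) :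
    (symmDeriv E Φ w).comp (tderiv E Φ w) = ContinuousLinearMap.id ℝ V :=
  h.mdifferentiable.symm_comp_deriv hw

theorem IsParam.comp_symmDeriv (h : IsParam E Φ) (hw : w ∈ Φ.source) :
    (tderiv E Φ w).comp (symmDeriv E Φ w) = ContinuousLinearMap.id ℝ E := by
  have := h.mdifferentiable.comp_symm_deriv (Φ.map_source hw)
  rw [Φ.left_inv hw] at this
  exact this

theorem IsParam.inverse_tderiv (h : IsParam E Φ) (hw : w ∈ Φ.source) :
    (tderiv E Φ w).inverse = symmDeriv E Φ w :=
  ContinuousLinearMap.inverse_eq (h.comp_symmDeriv hw) (h.symmDeriv_comp hw)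

theorem IsParam.isInvertible (h : IsParam E Φ) (hw : w ∈ Φ.source) :
    (tderiv E Φ w).IsInvertible :=
  ContinuousLinearMap.IsInvertible.of_inverse (h.comp_symmDeriv hw) (h.symmDeriv_comp hw)

variable [IsManifold 𝓘(ℝ, E) ∞ M]

theorem isParam_chartAt_symm (x : M) : IsParam E (chartAt E x).symm where
  smooth := contMDiffOn_chart_symm
  smooth_symm := contMDiffOn_chart

/-- On the source the inverse of the derivative of `Φ` is the derivative of `Φ.symm`, so the
pullback evaluated on a constant vector is a composition of derivatives of smooth maps with `A`. -/
theorem IsParam.contDiffAt_pullEnd [FiniteDimensional ℝ V] (h : IsParam E Φ) (hw : w ∈ Φ.source)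
    {A : ∀ x : M, TangentSpace 𝓘(ℝ, E) x →L[ℝ] TangentSpace 𝓘(ℝ, E) x}
    (hA : ContMDiff 𝓘(ℝ, E) (𝓘(ℝ, E).prod 𝓘(ℝ, E →L[ℝ] E)) ∞
      (fun x => TotalSpace.mk' (E →L[ℝ] E)
        (E := fun x : M => TangentSpace 𝓘(ℝ, E) x →L[ℝ] TangentSpace 𝓘(ℝ, E) x) x (A x))) :
    ContDiffAt ℝ ∞ (pullEnd A Φ) w := by
  refine contDiffAt_clm_of_apply fun u => ?_
  have h1 := contMDiffAt_tderiv (h.contMDiffAt hw) (contDiffAt_const (c := u))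
  have h2 : ContMDiffAt 𝓘(ℝ, V) 𝓘(ℝ, E).tangent ∞
      (fun y => (⟨Φ y, A (Φ y) (tderiv E Φ y u)⟩ : TangentBundle 𝓘(ℝ, E) M)) w :=
    ContMDiffAt.clm_bundle_apply (F₁ := E) (F₂ := E)
      (ContMDiffAt.comp w hA.contMDiffAt (h.contMDiffAt hw)) h1
  have h3 := contMDiffAt_mfderiv_apply (h.contMDiffAt_symm (Φ.map_source hw)) h2
  have h4 : ContMDiffAt 𝓘(ℝ, V) 𝓘(ℝ, V) ∞
      (fun y => symmDeriv E Φ y (endAt A (Φ y) (tderiv E Φ y u))) w :=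
    ContMDiffAt.comp w (contMDiff_snd_tangentBundle_modelSpace V 𝓘(ℝ, V)).contMDiffAt h3
  refine h4.contDiffAt.congr_of_eventuallyEq ?_
  filter_upwards [Φ.open_source.mem_nhds hw] with y hy
  simp only [pullEnd, h.inverse_tderiv hy, ContinuousLinearMap.comp_apply]

/-- A field of endomorphisms is smooth if it is so in charts. -/
theorem contMDiffAt_end_of_chart
    {A : ∀ x : M, TangentSpace 𝓘(ℝ, E) x →L[ℝ] TangentSpace 𝓘(ℝ, E) x} {x₀ : M}
    (h : ContDiffAt ℝ ∞ (pullEnd A (chartAt E x₀).symm) (chartAt E x₀ x₀)) :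
    ContMDiffAt 𝓘(ℝ, E) (𝓘(ℝ, E).prod 𝓘(ℝ, E →L[ℝ] E)) ∞
      (fun x => TotalSpace.mk' (E →L[ℝ] E)
        (E := fun x : M => TangentSpace 𝓘(ℝ, E) x →L[ℝ] TangentSpace 𝓘(ℝ, E) x) x (A x)) x₀ := by
  rw [contMDiffAt_hom_bundle]
  refine ⟨contMDiffAt_id, ?_⟩
  have h1 : ContMDiffAt 𝓘(ℝ, E) 𝓘(ℝ, E →L[ℝ] E) ∞
      (fun x => pullEnd A (chartAt E x₀).symm (chartAt E x₀ x)) x₀ :=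
    h.contMDiffAt.comp x₀ (contMDiffAt_of_mem_maximalAtlas
      (IsManifold.chart_mem_maximalAtlas x₀) (mem_chart_source E x₀))
  refine h1.congr_of_eventuallyEq ?_
  filter_upwards [(chartAt E x₀).open_source.mem_nhds (mem_chart_source E x₀)] with x hx
  have hx' : chartAt E x₀ x ∈ (chartAt E x₀).symm.source := (chartAt E x₀).map_source hx
  rw [pullEnd, (isParam_chartAt_symm x₀).inverse_tderiv hx']
  simp only [symmDeriv, ContinuousLinearMap.inCoordinates]
  rw [TangentBundle.continuousLinearMapAt_trivializationAt hx,
    TangentBundle.symmL_trivializationAt hx]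
  have e : (chartAt E x₀).symm (chartAt E x₀ x) = x := (chartAt E x₀).left_inv hx
  -- The base points `x` and `(chartAt E x₀).symm (chartAt E x₀ x)` agree only propositionally.
  -- Generalizing the second one allows substitution under the dependent types.
  have key : ∀ (y : M) (D : E →L[ℝ] E), y = x →
      (mfderiv 𝓘(ℝ, E) 𝓘(ℝ, E) (extChartAt 𝓘(ℝ, E) x₀) x : E →L[ℝ] E).comp ((endAt A x).comp D) =
      (mfderiv 𝓘(ℝ, E) 𝓘(ℝ, E) (extChartAt 𝓘(ℝ, E) x₀) y : E →L[ℝ] E).comp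
        ((endAt A y).comp D) := by
    rintro y D rfl; rfl
  refine Eq.trans ?_ (key _ _ e)
  rw [ModelWithCorners.range_eq_univ, mfderivWithin_univ]
  rfl

theorem symm_trivializationAt_apply {x₀ x : M} (hx : x ∈ (chartAt E x₀).source) (u : E) :
    ((trivializationAt E (TangentSpace 𝓘(ℝ, E)) x₀).symm x u : E) =
      tderiv E (chartAt E x₀).symm (chartAt E x₀ x) u := by
  have := TangentBundle.symmL_trivializationAt (I := 𝓘(ℝ, E)) hx
  rw [ModelWithCorners.range_eq_univ, mfderivWithin_univ] at this
  have h2 := DFunLike.congr_fun this u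
  exact ((trivializationAt E (TangentSpace 𝓘(ℝ, E)) x₀).symmL_apply hx u).symm.trans h2

/-- This identifies the fibre coordinate in the bundle of bilinear forms with the pullback by the
inverse chart, so smoothness of sections can be checked on pullbacks. -/
theorem bilin_trivializationAt_snd
    {g : ∀ x : M, TangentSpace 𝓘(ℝ, E) x →L[ℝ] TangentSpace 𝓘(ℝ, E) x →L[ℝ] ℝ} {x₀ x : M}
    (hx : x ∈ (chartAt E x₀).source) :
    (trivializationAt (E →L[ℝ] E →L[ℝ] ℝ)
      (fun x : M => TangentSpace 𝓘(ℝ, E) x →L[ℝ] TangentSpace 𝓘(ℝ, E) x →L[ℝ] ℝ) x₀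
        ⟨x, g x⟩).2 = pullBilin g (chartAt E x₀).symm (chartAt E x₀ x) := by
  refine ContinuousLinearMap.ext fun u => ContinuousLinearMap.ext fun v => ?_
  have hb : x ∈ (trivializationAt E (TangentSpace 𝓘(ℝ, E)) x₀).baseSet := hx
  rw [hom_trivializationAt_apply,
    inCoordinates_apply_eq₂ (F₃ := ℝ) (E₃ := fun _ : M => ℝ) hb hb (Set.mem_univ x)]
  have e : (chartAt E x₀).symm (chartAt E x₀ x) = x := (chartAt E x₀).left_inv hx
  have key : ∀ (y : M) (D D' : E), y = x →
      bilinAt g x D D' = bilinAt g y D D' := by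
    rintro y D D' rfl; rfl
  refine Eq.trans ?_ (key _ _ _ e)
  refine Eq.trans ?_ (congrArg₂ (fun a b => bilinAt g x a b) (symm_trivializationAt_apply hx u)
    (symm_trivializationAt_apply hx v))
  simp only [Bundle.Trivial.fiberBundle_trivializationAt', Trivial.linearMapAt_trivialization,
      LinearMap.id_coe, id_eq]
  rfl

/-- A field of bilinear forms is smooth if it is so in charts. -/
theorem contMDiffAt_bilin_of_chart
    {g : ∀ x : M, TangentSpace 𝓘(ℝ, E) x →L[ℝ] TangentSpace 𝓘(ℝ, E) x →L[ℝ] ℝ} {x₀ : M}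
    {x₁ : M} (hx₁ : x₁ ∈ (chartAt E x₀).source)
    (h : ContDiffAt ℝ ∞ (pullBilin g (chartAt E x₀).symm) (chartAt E x₀ x₁)) :
    ContMDiffAt 𝓘(ℝ, E) (𝓘(ℝ, E).prod 𝓘(ℝ, E →L[ℝ] E →L[ℝ] ℝ)) ∞
      (fun x => TotalSpace.mk' (E →L[ℝ] E →L[ℝ] ℝ)
        (E := fun x : M => TangentSpace 𝓘(ℝ, E) x →L[ℝ] TangentSpace 𝓘(ℝ, E) x →L[ℝ] ℝ)
          x (g x)) x₁ := by
  have h0 : ContMDiffAt 𝓘(ℝ, E) 𝓘(ℝ, E →L[ℝ] E →L[ℝ] ℝ) ∞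
      (fun x => pullBilin g (chartAt E x₀).symm (chartAt E x₀ x)) x₁ :=
    h.contMDiffAt.comp x₁ (contMDiffAt_of_mem_maximalAtlas
      (IsManifold.chart_mem_maximalAtlas x₀) hx₁)
  have hbase : x₁ ∈ (trivializationAt (E →L[ℝ] E →L[ℝ] ℝ)
      (fun x : M => TangentSpace 𝓘(ℝ, E) x →L[ℝ] TangentSpace 𝓘(ℝ, E) x →L[ℝ] ℝ) x₀).baseSet :=
    ⟨hx₁, hx₁, Set.mem_univ _⟩
  refine (Trivialization.contMDiffAt_section_iff (IB := 𝓘(ℝ, E)) (n := ∞)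
    (F := E →L[ℝ] E →L[ℝ] ℝ)
    (E := fun x : M => TangentSpace 𝓘(ℝ, E) x →L[ℝ] TangentSpace 𝓘(ℝ, E) x →L[ℝ] ℝ)
    (trivializationAt (E →L[ℝ] E →L[ℝ] ℝ)
      (fun x : M => TangentSpace 𝓘(ℝ, E) x →L[ℝ] TangentSpace 𝓘(ℝ, E) x →L[ℝ] ℝ) x₀) hbase).mpr ?_
  refine h0.congr_of_eventuallyEq ?_
  filter_upwards [(chartAt E x₀).open_source.mem_nhds hx₁] with x hx
  exact bilin_trivializationAt_snd hx

section Nijenhuis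

variable [FiniteDimensional ℝ V]

open VectorField in
/-- The Nijenhuis expression of two vector fields, computed in a parametrization. -/
theorem IsParam.tderiv_nijenhuis (h : IsParam E Φ) (hw : w ∈ Φ.source)
    {A : ∀ x : M, TangentSpace 𝓘(ℝ, E) x →L[ℝ] TangentSpace 𝓘(ℝ, E) x}
    (hA : ContMDiff 𝓘(ℝ, E) (𝓘(ℝ, E).prod 𝓘(ℝ, E →L[ℝ] E)) ∞
      (fun x => TotalSpace.mk' (E →L[ℝ] E)
        (E := fun x : M => TangentSpace 𝓘(ℝ, E) x →L[ℝ] TangentSpace 𝓘(ℝ, E) x) x (A x)))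
    (hsq : ∀ (x : M) (v : TangentSpace 𝓘(ℝ, E) x), A x (A x v) = -v)
    {X Y : ∀ x : M, TangentSpace 𝓘(ℝ, E) x}
    (hX : ContMDiff 𝓘(ℝ, E) 𝓘(ℝ, E).tangent ∞ (fun x => (⟨x, X x⟩ : TangentBundle 𝓘(ℝ, E) M)))
    (hY : ContMDiff 𝓘(ℝ, E) 𝓘(ℝ, E).tangent ∞ (fun x => (⟨x, Y x⟩ : TangentBundle 𝓘(ℝ, E) M))) :
    (tderiv E Φ w).inverse
      (mlieBracket 𝓘(ℝ, E) (fun y => A y (X y)) (fun y => A y (Y y)) (Φ w)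
        - A (Φ w) (mlieBracket 𝓘(ℝ, E) (fun y => A y (X y)) Y (Φ w))
        - A (Φ w) (mlieBracket 𝓘(ℝ, E) X (fun y => A y (Y y)) (Φ w))
        - mlieBracket 𝓘(ℝ, E) X Y (Φ w)) =
      nijenhuis (pullEnd A Φ) w ((tderiv E Φ w).inverse (X (Φ w)))
        ((tderiv E Φ w).inverse (Y (Φ w))) := by
  have : IsManifold 𝓘(ℝ, E) (minSmoothness ℝ 2) M :=
    IsManifold.of_le (n := ∞) (by simpa using ENat.LEInfty.out)
  have : IsManifold 𝓘(ℝ, E) (minSmoothness ℝ 3) M :=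
    IsManifold.of_le (n := ∞) (by simpa using ENat.LEInfty.out)
  have hAX : ∀ {Z : ∀ x : M, TangentSpace 𝓘(ℝ, E) x},
      ContMDiff 𝓘(ℝ, E) 𝓘(ℝ, E).tangent ∞ (fun x => (⟨x, Z x⟩ : TangentBundle 𝓘(ℝ, E) M)) →
      ContMDiff 𝓘(ℝ, E) 𝓘(ℝ, E).tangent ∞
        (fun x => (⟨x, A x (Z x)⟩ : TangentBundle 𝓘(ℝ, E) M)) := fun hZ =>
    ContMDiff.clm_bundle_apply (F₁ := E) (F₂ := E) (b := fun x : M => x) hA hZ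
  let P : (∀ x : M, TangentSpace 𝓘(ℝ, E) x) → V → V := fun Z y =>
    (tderiv E Φ y).inverse (Z (Φ y))
  have hP : ∀ Z, P Z = mpullback 𝓘(ℝ, V) 𝓘(ℝ, E) Φ Z := fun Z => rfl
  have hbr : ∀ {Z Z' : ∀ x : M, TangentSpace 𝓘(ℝ, E) x},
      ContMDiff 𝓘(ℝ, E) 𝓘(ℝ, E).tangent ∞ (fun x => (⟨x, Z x⟩ : TangentBundle 𝓘(ℝ, E) M)) →
      ContMDiff 𝓘(ℝ, E) 𝓘(ℝ, E).tangent ∞ (fun x => (⟨x, Z' x⟩ : TangentBundle 𝓘(ℝ, E) M)) →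
      (tderiv E Φ w).inverse (mlieBracket 𝓘(ℝ, E) Z Z' (Φ w)) = lieBracket ℝ (P Z) (P Z') w := by
    intro Z Z' hZ hZ'
    have h2 : ∀ Q Q' : V → V, mlieBracket 𝓘(ℝ, V) Q Q' w = lieBracket ℝ Q Q' w := by
      intro Q Q'
      have := congrFun (mlieBracketWithin_eq_lieBracketWithin (𝕜 := ℝ) (V := Q) (W := Q')
        (s := Set.univ)) w
      exact this.trans (congrFun (lieBracketWithin_univ (𝕜 := ℝ) (V := Q) (W := Q')) w)
    rw [← h2]
    exact mpullback_mlieBracket (f := Φ) (x₀ := w) (n := ∞) (I := 𝓘(ℝ, V))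
      (hZ.contMDiffAt.mdifferentiableAt (by simp)) (hZ'.contMDiffAt.mdifferentiableAt (by simp))
      (h.contMDiffAt hw) (by simpa using ENat.LEInfty.out)
  have hPd : ∀ {Z : ∀ x : M, TangentSpace 𝓘(ℝ, E) x},
      ContMDiff 𝓘(ℝ, E) 𝓘(ℝ, E).tangent ∞ (fun x => (⟨x, Z x⟩ : TangentBundle 𝓘(ℝ, E) M)) →
      DifferentiableAt ℝ (P Z) w := by
    intro Z hZ
    have h3 := contMDiffAt_mfderiv_apply (h.contMDiffAt_symm (Φ.map_source hw)) (b := Φ)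
      (v := fun y => Z (Φ y)) (hZ.contMDiffAt.comp w (h.contMDiffAt hw))
    have h4 : ContMDiffAt 𝓘(ℝ, V) 𝓘(ℝ, V) ∞ (fun y => symmDeriv E Φ y (Z (Φ y))) w :=
      ContMDiffAt.comp w (contMDiff_snd_tangentBundle_modelSpace V 𝓘(ℝ, V)).contMDiffAt h3
    refine (h4.contDiffAt.congr_of_eventuallyEq ?_).differentiableAt (by simp)
    filter_upwards [Φ.open_source.mem_nhds hw] with y hy
    simp only [P, h.inverse_tderiv hy]
  have hA' : ∀ {y : V} (_ : y ∈ Φ.source) (z : E), (tderiv E Φ y).inverse (endAt A (Φ y) z) =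
      pullEnd A Φ y ((tderiv E Φ y).inverse z) := by
    intro y hy z
    obtain ⟨e, he⟩ := h.isInvertible hy
    simp [pullEnd, ← he]
  have hPA : ∀ Z, P (fun y => A y (Z y)) =ᶠ[𝓝 w] fun y => pullEnd A Φ y (P Z y) := by
    intro Z
    filter_upwards [Φ.open_source.mem_nhds hw] with y hy
    exact hA' hy (Z (Φ y))
  have main := lieBracket_nijenhuis (J := pullEnd A Φ) (w := w) (X := P X) (Y := P Y)
    ((h.contDiffAt_pullEnd hw hA).differentiableAt (by simp)) (hPd hX) (hPd hY) (by
      intro v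
      obtain ⟨e, he⟩ := h.isInvertible hw
      simp only [pullEnd, ← he, ContinuousLinearMap.comp_apply, ContinuousLinearMap.inverse_equiv,
        ContinuousLinearEquiv.coe_coe, ContinuousLinearEquiv.apply_symm_apply]
      have : endAt A (Φ w) (endAt A (Φ w) (e v)) = -e v := hsq _ _
      rw [this, map_neg, ContinuousLinearEquiv.symm_apply_apply])
  rw [← Filter.EventuallyEq.lieBracket_vectorField_eq (hPA X) (hPA Y),
    ← Filter.EventuallyEq.lieBracket_vectorField_eq (hPA X) (Filter.EventuallyEq.refl _ _),
    ← Filter.EventuallyEq.lieBracket_vectorField_eq (Filter.EventuallyEq.refl _ _) (hPA Y),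
    ← hbr hX hY, ← hbr (hAX hX) (hAX hY), ← hbr (hAX hX) hY, ← hbr hX (hAX hY)] at main
  have lin : ∀ a b c d : E, (tderiv E Φ w).inverse
      (a - endAt A (Φ w) b - endAt A (Φ w) c - d) = (tderiv E Φ w).inverse a
        - pullEnd A Φ w ((tderiv E Φ w).inverse b) - pullEnd A Φ w ((tderiv E Φ w).inverse c)
        - (tderiv E Φ w).inverse d := by
    intro a b c d
    rw [map_sub, map_sub, map_sub, hA' hw, hA' hw]
  exact (lin _ _ _ _).trans main

end Nijenhuis

end LocalDiffeo


/-! ### The inverse function theorem for parametrizations -/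

section Param

variable {E : Type*} [NormedAddCommGroup E] [NormedSpace ℝ E]
  {M : Type*} [TopologicalSpace M] [ChartedSpace E M]
  {V : Type*} [NormedAddCommGroup V] [NormedSpace ℝ V]
  {Φ : OpenPartialHomeomorph V M} {w : V}

theorem IsParam.inverse_apply (h : IsParam E Φ) (hw : w ∈ Φ.source) (u : V) :
    (tderiv E Φ w).inverse (tderiv E Φ w u) = u := by
  rw [h.inverse_tderiv hw]
  exact DFunLike.congr_fun (h.symmDeriv_comp hw) u

theorem IsParam.apply_inverse (h : IsParam E Φ) (hw : w ∈ Φ.source) (u : E) :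
    tderiv E Φ w ((tderiv E Φ w).inverse u) = u := by
  rw [h.inverse_tderiv hw]
  exact DFunLike.congr_fun (h.comp_symmDeriv hw) u

theorem IsParam.injective (h : IsParam E Φ) (hw : w ∈ Φ.source) :
    Function.Injective (tderiv E Φ w) :=
  Function.LeftInverse.injective (h.inverse_apply hw)

theorem IsParam.contMDiffAt_of_comp {P : Type*} {E' : Type*} [NormedAddCommGroup E']
    [NormedSpace ℝ E'] [TopologicalSpace P] [ChartedSpace E' P] (h : IsParam E Φ)
    (hw : w ∈ Φ.source) {f : M → P}
    (hf : ContMDiffAt 𝓘(ℝ, V) 𝓘(ℝ, E') ∞ (fun y => f (Φ y)) w) :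
    ContMDiffAt 𝓘(ℝ, E) 𝓘(ℝ, E') ∞ f (Φ w) := by
  have h1 : ContMDiffAt 𝓘(ℝ, E) 𝓘(ℝ, E') ∞ (fun x => f (Φ (Φ.symm x))) (Φ w) :=
    ContMDiffAt.comp (g := fun y => f (Φ y)) (Φ w) (by rwa [Φ.left_inv hw])
      (h.contMDiffAt_symm (Φ.map_source hw))
  refine h1.congr_of_eventuallyEq ?_
  filter_upwards [Φ.open_target.mem_nhds (Φ.map_source hw)] with x hx
  rw [Φ.right_inv hx]

theorem pullBilin_apply
    (g : ∀ x : M, TangentSpace 𝓘(ℝ, E) x →L[ℝ] TangentSpace 𝓘(ℝ, E) x →L[ℝ] ℝ)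
    (φ : V → M) (w u v : V) :
    pullBilin g φ w u v = bilinAt g (φ w) (tderiv E φ w u) (tderiv E φ w v) := rfl

theorem tderiv_comp {W : Type*} [NormedAddCommGroup W] [NormedSpace ℝ W] {φ : V → M} {f : W → V}
    {y : W} (hφ : MDifferentiableAt 𝓘(ℝ, V) 𝓘(ℝ, E) φ (f y)) (hf : DifferentiableAt ℝ f y) :
    tderiv E (fun z => φ (f z)) y = (tderiv E φ (f y)).comp (fderiv ℝ f y) := by
  have := mfderiv_comp (I := 𝓘(ℝ, W)) (I' := 𝓘(ℝ, V)) (I'' := 𝓘(ℝ, E)) y hφ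
    hf.mdifferentiableAt
  rw [mfderiv_eq_fderiv] at this
  exact this

theorem tderiv_congr {φ ψ : V → M} (h : φ =ᶠ[𝓝 w] ψ) : tderiv E φ w = tderiv E ψ w :=
  h.mfderiv_eq

variable [IsManifold 𝓘(ℝ, E) ∞ M]

/-- The inverse function theorem, for a map from a vector space to a manifold. -/
theorem exists_isParam [CompleteSpace V] {φ : V → M} {U : Set V} (hU : IsOpen U) (hw : w ∈ U)
    (hφ : ContMDiffOn 𝓘(ℝ, V) 𝓘(ℝ, E) ∞ φ U) (hinv : (tderiv E φ w).IsInvertible) :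
    ∃ Φ : OpenPartialHomeomorph V M, IsParam E Φ ∧ (Φ : V → M) = φ ∧ w ∈ Φ.source ∧
      Φ.source ⊆ U := by
  let c := chartAt E (φ w)
  have hc : IsParam E c.symm := isParam_chartAt_symm (φ w)
  let U₁ : Set V := U ∩ φ ⁻¹' c.source
  have hU₁ : IsOpen U₁ := hφ.continuousOn.isOpen_inter_preimage hU c.open_source
  have hw₁ : w ∈ U₁ := ⟨hw, mem_chart_source E (φ w)⟩
  let f : V → E := fun y => c (φ y)
  have hf : ContDiffOn ℝ ∞ f U₁ := by
    rw [← contMDiffOn_iff_contDiffOn]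
    exact (contMDiffOn_chart (n := ∞) (I := 𝓘(ℝ, E)) (x := φ w)).comp
      (hφ.mono Set.inter_subset_left) fun y hy => hy.2
  have hfd : ∀ y ∈ U₁, ContDiffAt ℝ ∞ f y := fun y hy => hf.contDiffAt (hU₁.mem_nhds hy)
  have hinv' : ∃ f' : V ≃L[ℝ] E, (f' : V →L[ℝ] E) = fderiv ℝ f w := by
    obtain ⟨e, he⟩ := hinv
    have h1 : tderiv E (fun z => c.symm (f z)) w = _ :=
      tderiv_comp (hc.contMDiffAt (c.map_source hw₁.2) |>.mdifferentiableAt (by simp))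
        ((hfd w hw₁).differentiableAt (by simp))
    have h2 : tderiv E (fun z => c.symm (f z)) w = tderiv E φ w := by
      refine tderiv_congr ?_
      filter_upwards [hU₁.mem_nhds hw₁] with y hy
      exact c.left_inv hy.2
    obtain ⟨e', he'⟩ := hc.isInvertible (c.map_source hw₁.2)
    refine ⟨e.trans e'.symm, ?_⟩
    refine ContinuousLinearMap.ext fun u => ?_
    have h3 := DFunLike.congr_fun (h2.symm.trans h1) u
    rw [← he] at h3
    simp only [ContinuousLinearMap.comp_apply] at h3
    have h4 : e u = e' (fderiv ℝ f w u) := h3.trans (DFunLike.congr_fun he'.symm _)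
    simp [h4]
  obtain ⟨f', hf'⟩ := hinv'
  have hder : HasFDerivAt f (f' : V →L[ℝ] E) w := by
    rw [hf']; exact ((hfd w hw₁).differentiableAt (by simp)).hasFDerivAt
  let e₀ := (hfd w hw₁).toOpenPartialHomeomorph f hder (by simp)
  have he₀ : (e₀ : V → E) = f := rfl
  -- The local inverse is smooth at the images of points with invertible derivative. These points
  -- form an open set, to which the local inverse is restricted.
  let S : Set V := U₁ ∩ fderiv ℝ f ⁻¹' Set.range ((↑) : (V ≃L[ℝ] E) → V →L[ℝ] E)
  have hS : IsOpen S := (hf.continuousOn_fderiv_of_isOpen hU₁ (by simp)).isOpen_inter_preimage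
    hU₁ ContinuousLinearEquiv.isOpen
  let e₁ := e₀.restrOpen S hS
  have hsrc : ∀ y ∈ e₁.source, y ∈ S := fun y hy => hy.2
  have hleft : ∀ y ∈ (e₁.trans c.symm).source, (e₁.trans c.symm) y = φ y := fun y hy =>
    c.left_inv (hsrc y hy.1).1.2
  -- The composite `e₁.trans c.symm` agrees with `φ` only on its source. It is rebuilt so that the
  -- underlying function is `φ` everywhere.
  let Φ : OpenPartialHomeomorph V M :=
    { toFun := φ
      invFun := (e₁.trans c.symm).symm
      source := (e₁.trans c.symm).source
      target := (e₁.trans c.symm).target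
      map_source' := fun y hy => by
        rw [← hleft y hy]; exact (e₁.trans c.symm).map_source hy
      map_target' := fun y hy => (e₁.trans c.symm).map_target hy
      left_inv' := fun y hy => by
        rw [← hleft y hy]; exact (e₁.trans c.symm).left_inv hy
      right_inv' := fun y hy => by
        rw [← hleft _ ((e₁.trans c.symm).map_target hy)]; exact (e₁.trans c.symm).right_inv hy
      open_source := (e₁.trans c.symm).open_source
      open_target := (e₁.trans c.symm).open_target
      continuousOn_toFun := (e₁.trans c.symm).continuousOn.congr fun y hy => (hleft y hy).symm
      continuousOn_invFun := (e₁.trans c.symm).continuousOn_symm }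
  refine ⟨Φ, ⟨hφ.mono fun y hy => (hsrc y hy.1).1.1, ?_⟩, rfl, ?_, fun y hy => (hsrc y hy.1).1.1⟩
  · intro x hx
    have hx1 : x ∈ c.source := hx.1
    have hx2 : c x ∈ e₁.target := hx.2
    have hx3 := hsrc _ (e₁.map_target hx2)
    obtain ⟨e, he⟩ := hx3.2
    have h1 : ContDiffAt ℝ ∞ e₁.symm (c x) := by
      refine e₁.contDiffAt_symm (f₀' := e) hx2 ?_ (hfd _ hx3.1)
      rw [he]
      exact ((hfd _ hx3.1).differentiableAt (by simp)).hasFDerivAt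
    exact (ContMDiffAt.comp x h1.contMDiffAt (contMDiffAt_of_mem_maximalAtlas
      (IsManifold.chart_mem_maximalAtlas (φ w)) hx1)).contMDiffWithinAt
  · refine ⟨⟨(hfd w hw₁).mem_toOpenPartialHomeomorph_source hder (by simp), hw₁, ⟨f', hf'⟩⟩, ?_⟩
    exact c.map_source hw₁.2

end Param

/-! ### Integrability in terms of the Nijenhuis tensor in coordinates -/

section Fields

variable {E : Type*} [NormedAddCommGroup E] [NormedSpace ℝ E] [FiniteDimensional ℝ E]
  {M : Type*} [TopologicalSpace M] [T2Space M] [SecondCountableTopology M]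
  [ChartedSpace E M] [IsManifold 𝓘(ℝ, E) ∞ M]
  {V : Type*} [NormedAddCommGroup V] [NormedSpace ℝ V] [FiniteDimensional ℝ V]
  {Φ : OpenPartialHomeomorph V M} {w : V}

/-- A partition of unity argument: prescribing the value at one point and nothing elsewhere is a
convex condition on the fibres, and it has local smooth solutions. -/
theorem exists_smooth_vectorField (x : M) (u : TangentSpace 𝓘(ℝ, E) x) :
    ∃ X : ∀ x : M, TangentSpace 𝓘(ℝ, E) x,
      ContMDiff 𝓘(ℝ, E) 𝓘(ℝ, E).tangent ∞ (fun x => (⟨x, X x⟩ : TangentBundle 𝓘(ℝ, E) M)) ∧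
      X x = u := by
  classical
  have : LocallyCompactSpace M := ChartedSpace.locallyCompactSpace E M
  let t : ∀ y : M, Set (TangentSpace 𝓘(ℝ, E) y) := fun y => {v | ∀ h : y = x, h ▸ v = u}
  obtain ⟨s, hs⟩ := exists_contMDiffSection_forall_mem_convex_of_local (n := (⊤ : ℕ∞)) 𝓘(ℝ, E)
    (F_fiber := E) (fun y : M => TangentSpace 𝓘(ℝ, E) y) t (by
      intro y v hv v' hv' a b _ _ hab h
      subst h
      change a • v + b • v' = u
      rw [show v = u from hv rfl, show v' = u from hv' rfl, ← add_smul, hab, one_smul]) (by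
      intro x₀
      by_cases hx : x₀ = x
      · subst hx
        obtain ⟨U, hU, hsm⟩ := FiberBundle.exists_contMDiffOn_extend (I := 𝓘(ℝ, E)) (k := ∞) (F := E)
          (V := fun y : M => TangentSpace 𝓘(ℝ, E) y) u
        refine ⟨U, hU, _, hsm, ?_⟩
        rintro y - rfl
        exact FiberBundle.extend_apply_self E u
      · refine ⟨{x}ᶜ, isOpen_compl_singleton.mem_nhds hx, fun y => 0,
          (contMDiff_zeroSection ℝ (fun y : M => TangentSpace 𝓘(ℝ, E) y)).contMDiffOn, ?_⟩
        intro y hy h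
        exact absurd h hy)
  exact ⟨s, s.contMDiff, hs x rfl⟩

/-- Integrability is stated for global fields. By tensoriality it suffices to extend the images of
`u` and `v` to such fields. -/
theorem IsParam.nijenhuis_eq_zero (h : IsParam E Φ) (hw : w ∈ Φ.source)
    (J : ComplexStructure E M) (u v : V) : nijenhuis (pullEnd J.toFun Φ) w u v = 0 := by
  obtain ⟨X, hX, hXw⟩ := exists_smooth_vectorField (Φ w) (tderiv E Φ w u)
  obtain ⟨Y, hY, hYw⟩ := exists_smooth_vectorField (Φ w) (tderiv E Φ w v)
  have h1 := h.tderiv_nijenhuis hw J.smooth J.sq hX hY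
  rw [hXw, hYw, J.integrable X Y hX hY (Φ w), h.inverse_apply hw, h.inverse_apply hw] at h1
  exact h1.symm.trans (map_zero (tderiv E Φ w).inverse)

end Fields

section Integrable

open VectorField

variable {E : Type*} [NormedAddCommGroup E] [NormedSpace ℝ E]
  {M : Type*} [TopologicalSpace M]
  [ChartedSpace E M] [IsManifold 𝓘(ℝ, E) ∞ M]
  {V : Type*} [NormedAddCommGroup V] [NormedSpace ℝ V] [FiniteDimensional ℝ V]
  {Φ : OpenPartialHomeomorph V M} {w : V}

/-- The Nijenhuis expression pulled back by `Φ` is the flat tensor, and the derivative of `Φ` is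
invertible. This is the direction used to establish integrability on the orbit space. -/
theorem IsParam.integrable_of_nijenhuis (h : IsParam E Φ) (hw : w ∈ Φ.source)
    {A : ∀ x : M, TangentSpace 𝓘(ℝ, E) x →L[ℝ] TangentSpace 𝓘(ℝ, E) x}
    (hA : ContMDiff 𝓘(ℝ, E) (𝓘(ℝ, E).prod 𝓘(ℝ, E →L[ℝ] E)) ∞
      (fun x => TotalSpace.mk' (E →L[ℝ] E)
        (E := fun x : M => TangentSpace 𝓘(ℝ, E) x →L[ℝ] TangentSpace 𝓘(ℝ, E) x) x (A x)))
    (hsq : ∀ (x : M) (v : TangentSpace 𝓘(ℝ, E) x), A x (A x v) = -v)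
    {X Y : ∀ x : M, TangentSpace 𝓘(ℝ, E) x}
    (hX : ContMDiff 𝓘(ℝ, E) 𝓘(ℝ, E).tangent ∞ (fun x => (⟨x, X x⟩ : TangentBundle 𝓘(ℝ, E) M)))
    (hY : ContMDiff 𝓘(ℝ, E) 𝓘(ℝ, E).tangent ∞ (fun x => (⟨x, Y x⟩ : TangentBundle 𝓘(ℝ, E) M)))
    (hN : ∀ u v, nijenhuis (pullEnd A Φ) w u v = 0) :
    mlieBracket 𝓘(ℝ, E) (fun y => A y (X y)) (fun y => A y (Y y)) (Φ w)
        - A (Φ w) (mlieBracket 𝓘(ℝ, E) (fun y => A y (X y)) Y (Φ w))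
        - A (Φ w) (mlieBracket 𝓘(ℝ, E) X (fun y => A y (Y y)) (Φ w))
        - mlieBracket 𝓘(ℝ, E) X Y (Φ w) = 0 := by
  have h1 := (h.tderiv_nijenhuis hw hA hsq hX hY).trans (hN _ _)
  have h2 := congrArg (tderiv E Φ w) h1
  exact (h.apply_inverse hw _).symm.trans (h2.trans (map_zero (tderiv E Φ w)))

end Integrable

/-! ### Pointwise proportional metrics -/

section Conformal

variable {E : Type*} [NormedAddCommGroup E] [NormedSpace ℝ E] [FiniteDimensional ℝ E]
  {M : Type*} [TopologicalSpace M] [ChartedSpace E M] [IsManifold 𝓘(ℝ, E) ∞ M]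

/-- Two metrics that are proportional at each point are conformal. -/
theorem conformal_of_forall_exists {g g' : RiemMetric E M}
    (h : ∀ x : M, ∃ r : ℝ, 0 < r ∧ ∀ u v : TangentSpace 𝓘(ℝ, E) x,
      g'.inner x u v = r * g.inner x u v) : Conformal g g' := by
  choose r hr hg using h
  have hg' : ∀ x (u v : E), bilinAt g'.inner x u v = r x * bilinAt g.inner x u v := hg
  rcases subsingleton_or_nontrivial E with hE | hE
  · refine ⟨0, fun x u v => ?_⟩
    have hu : u = 0 := Subsingleton.elim (α := E) u 0
    subst hu
    simp
  · obtain ⟨e, he⟩ := exists_ne (0 : E)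
    -- In a chart the factor is the quotient of the two metrics on the fixed nonzero vector `e`, a
    -- quotient of positive smooth functions. In dimension zero, treated above, no such vector
    -- exists and any factor works.
    have hsm : ContMDiff 𝓘(ℝ, E) 𝓘(ℝ, ℝ) ∞ fun x => Real.log (r x) := by
      intro x
      have hp := isParam_chartAt_symm (E := E) x
      have hx : chartAt E x x ∈ (chartAt E x).symm.source :=
        (chartAt E x).map_source (mem_chart_source E x)
      have hgoal : ContMDiffAt 𝓘(ℝ, E) 𝓘(ℝ, ℝ) ∞ (fun x => Real.log (r x))
          ((chartAt E x).symm (chartAt E x x)) := by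
        refine hp.contMDiffAt_of_comp hx (ContDiffAt.contMDiffAt ?_)
        have hne : ∀ y ∈ (chartAt E x).symm.source, tderiv E (chartAt E x).symm y e ≠ 0 :=
          fun y hy h0 => he (hp.injective hy (h0.trans (map_zero _).symm))
        have hG : ∀ G : RiemMetric E M, ∀ y ∈ (chartAt E x).symm.source,
            0 < pullBilin G.inner (chartAt E x).symm y e e :=
          fun G y hy => by
            rw [pullBilin_apply]
            exact G.pos ((chartAt E x).symm y) (tderiv E (chartAt E x).symm y e) (hne y hy)
        have h1 : ContDiffAt ℝ ∞ (fun y => Real.log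
            (pullBilin g'.inner (chartAt E x).symm y e e /
              pullBilin g.inner (chartAt E x).symm y e e)) (chartAt E x x) := by
          have hs : ∀ G : RiemMetric E M, ContDiffAt ℝ ∞
              (fun y => pullBilin G.inner (chartAt E x).symm y e e) (chartAt E x x) :=
            fun G => ((contDiffAt_pullBilin G.contMDiff (hp.contMDiffAt hx)).clm_apply
              contDiffAt_const).clm_apply contDiffAt_const
          exact ((hs g').div (hs g) (hG g _ hx).ne').log
            (div_pos (hG g' _ hx) (hG g _ hx)).ne'
        refine h1.congr_of_eventuallyEq ?_
        filter_upwards [(chartAt E x).symm.open_source.mem_nhds hx] with y hy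
        have h2 : pullBilin g'.inner (chartAt E x).symm y e e =
            r ((chartAt E x).symm y) * pullBilin g.inner (chartAt E x).symm y e e := by
          rw [pullBilin_apply, pullBilin_apply, hg']
        rw [h2, mul_div_assoc, div_self (hG g y hy).ne', mul_one]
      rwa [(chartAt E x).left_inv (mem_chart_source E x)] at hgoal
    refine ⟨⟨_, hsm⟩, fun x u v => ?_⟩
    rw [hg x u v]
    change _ = Real.exp (Real.log (r x)) * _
    rw [Real.exp_log (hr x)]

end Conformal


/-! ### Alternating forms and exterior derivatives on a vector space -/

section Flat

variable {V : Type*} [NormedAddCommGroup V] [NormedSpace ℝ V]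

/-- A linear form, seen as an alternating form. -/
def altOne : (V →L[ℝ] ℝ) →L[ℝ] V [⋀^Fin 1]→L[ℝ] ℝ :=
  ((ContinuousAlternatingMap.ofSubsingletonLIE (𝕜 := ℝ) (E := V) (F := ℝ) (0 : Fin 1)).toContinuousLinearEquiv :
    (V →L[ℝ] ℝ) →L[ℝ] V [⋀^Fin 1]→L[ℝ] ℝ)

@[simp] theorem altOne_apply (η : V →L[ℝ] ℝ) (v : Fin 1 → V) : altOne η v = η (v 0) := rfl

theorem contDiffAt_altOne_iff {D : Type*} [NormedAddCommGroup D] [NormedSpace ℝ D]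
    {η : D → V →L[ℝ] ℝ} {x : D} {n : WithTop ℕ∞} :
    ContDiffAt ℝ n (fun y => altOne (η y)) x ↔ ContDiffAt ℝ n η x :=
  (ContinuousAlternatingMap.ofSubsingletonLIE (𝕜 := ℝ) (E := V)
    (F := ℝ) (0 : Fin 1)).toContinuousLinearEquiv.comp_contDiffAt_iff

/-- The alternating part of a bilinear form. -/
def altTwo : (V →L[ℝ] V →L[ℝ] ℝ) →L[ℝ] V [⋀^Fin 2]→L[ℝ] ℝ :=
  (1 / 2 : ℝ) • (ContinuousAlternatingMap.alternatizeUncurryFinCLM ℝ V ℝ).comp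
    (ContinuousLinearMap.compL ℝ V (V →L[ℝ] ℝ) (V [⋀^Fin 1]→L[ℝ] ℝ) altOne)

theorem altTwo_apply (b : V →L[ℝ] V →L[ℝ] ℝ) (v : Fin 2 → V) :
    altTwo b v = (b (v 0) (v 1) - b (v 1) (v 0)) / 2 := by
  simp only [altTwo, smul_apply, ContinuousLinearMap.comp_apply,
    ContinuousAlternatingMap.alternatizeUncurryFinCLM_apply, ContinuousAlternatingMap.smul_apply,
    ContinuousAlternatingMap.alternatizeUncurryFin_apply, ContinuousLinearMap.compL_apply,
    altOne_apply, Fin.removeNth]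
  simp
  ring

theorem altTwo_apply_of_skew {b : V →L[ℝ] V →L[ℝ] ℝ} (hb : ∀ u v, b u v = -b v u)
    (v : Fin 2 → V) : altTwo b v = b (v 0) (v 1) := by
  rw [altTwo_apply, hb (v 1) (v 0)]
  ring

set_option synthInstance.maxHeartbeats 200000 in
theorem contDiff_altTwo :
    ContDiff ℝ ∞ (fun b : V →L[ℝ] V →L[ℝ] ℝ => (altTwo b : V [⋀^Fin 2]→L[ℝ] ℝ)) :=
  ContinuousLinearMap.contDiff (𝕜 := ℝ) (E := V →L[ℝ] V →L[ℝ] ℝ) (F := V [⋀^Fin 2]→L[ℝ] ℝ) altTwo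

theorem alt_swap (ϖ : V [⋀^Fin 2]→L[ℝ] ℝ) (u v : V) : ϖ ![u, v] = -ϖ ![v, u] := by
  have h : ϖ (![v, u] ∘ Equiv.swap 0 1) = -ϖ ![v, u] :=
    ϖ.toAlternatingMap.map_swap ![v, u] (show (0 : Fin 2) ≠ 1 by decide)
  rw [← h]
  congr 1
  ext i
  fin_cases i <;> rfl

/-- The Leibniz rule for the product of a function and a `2`-form. -/
theorem extDeriv_mul_apply {c : V → ℝ} {ϖ : V → V [⋀^Fin 2]→L[ℝ] ℝ} {q : V}
    (hc : DifferentiableAt ℝ c q) (hϖ : DifferentiableAt ℝ ϖ q) (u v w : V) :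
    extDeriv (fun y => c y • ϖ y) q ![u, v, w] =
      fderiv ℝ c q u * ϖ q ![v, w] + fderiv ℝ c q v * ϖ q ![w, u] + fderiv ℝ c q w * ϖ q ![u, v]
        + c q * extDeriv ϖ q ![u, v, w] := by
  rw [extDeriv_apply (hc.fun_smul hϖ), extDeriv_apply hϖ]
  have hev : ∀ m : Fin 2 → V, DifferentiableAt ℝ (fun y => ϖ y m) q := fun m => by fun_prop
  have hmul : ∀ (m : Fin 2 → V) (z : V), fderiv ℝ (fun y => (c y • ϖ y) m) q z =
      fderiv ℝ c q z * ϖ q m + c q * fderiv ℝ (fun y => ϖ y m) q z := by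
    intro m z
    have : (fun y => (c y • ϖ y) m) = fun y => c y * ϖ y m := rfl
    rw [this, fderiv_fun_mul hc (hev m)]
    simp
    ring
  have hsum : ∀ f : Fin (2 + 1) → ℝ, ∑ i, f i = f 0 + f 1 + f 2 := fun f => Fin.sum_univ_three f
  simp only [hmul]
  rw [hsum, hsum]
  have e0 : Fin.removeNth 0 ![u, v, w] = ![v, w] := by ext i; fin_cases i <;> rfl
  have e1 : Fin.removeNth 1 ![u, v, w] = ![u, w] := by ext i; fin_cases i <;> rfl
  have e2 : Fin.removeNth 2 ![u, v, w] = ![u, v] := by ext i; fin_cases i <;> rfl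
  rw [e0, e1, e2, alt_swap (ϖ q) w u]
  simp
  ring

/-- This is `d ∘ d = 0`, with `h` viewed as a form of degree zero. -/
theorem extDeriv_altOne_fderiv {h : V → ℝ} {q : V} (hh : ContDiffAt ℝ ∞ h q) :
    extDeriv (fun y => altOne (fderiv ℝ h y)) q = 0 := by
  have h1 : (fun y => altOne (fderiv ℝ h y)) =
      extDeriv (fun y => ContinuousAlternatingMap.constOfIsEmpty ℝ V (Fin 0) (h y)) := by
    funext y
    rw [extDeriv_constOfIsEmpty]
    rfl
  rw [h1]
  refine extDeriv_extDeriv_apply (r := ∞) ?_ (by simpa using ENat.LEInfty.out)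
  exact (ContinuousAlternatingMap.constOfIsEmptyLIE ℝ V ℝ
    (Fin 0)).toContinuousLinearEquiv.contDiff.contDiffAt.comp q hh

/-- A covector whose wedge product with a nondegenerate Hermitian form vanishes is zero if the
dimension is at least `3`. -/
theorem eq_zero_of_wedge_eq_zero [FiniteDimensional ℝ V] (hd : 3 ≤ Module.finrank ℝ V)
    {b : V →L[ℝ] V →L[ℝ] ℝ} {j : V →L[ℝ] V} (hpos : ∀ v, v ≠ 0 → 0 < b v v)
    (hsq : ∀ v, j (j v) = -v) (hherm : ∀ u v, b (j u) (j v) = b u v)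
    (hsymm : ∀ u v, b u v = b v u) {η : V →L[ℝ] ℝ}
    (h : ∀ u v w, η u * b (j v) w + η v * b (j w) u + η w * b (j u) v = 0) : η = 0 := by
  refine ContinuousLinearMap.ext fun u => ?_
  -- Orthogonality to `u` and `j u` amounts to two linear conditions, so dimension at least 3 leaves
  -- a nonzero solution `v`.
  let L : V →ₗ[ℝ] ℝ × ℝ := ((b u).prod (b (j u)) : V →L[ℝ] ℝ × ℝ)
  have hker : LinearMap.ker L ≠ ⊥ := by
    refine LinearMap.ker_ne_bot_of_finrank_lt ?_
    simp only [Module.finrank_prod, Module.finrank_self]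
    omega
  obtain ⟨v, hv, hv0⟩ := (Submodule.ne_bot_iff _).mp hker
  have hL : (b u v, b (j u) v) = (0, 0) := hv
  have h1 : b u v = 0 := congrArg Prod.fst hL
  have h2 : b (j u) v = 0 := congrArg Prod.snd hL
  -- On the triple `u, v, j v` only the term `η u * b v v` survives.
  have h3 := h u v (j v)
  have h5 : b (j (j v)) u = 0 := by
    rw [hsymm, hsq, map_neg, h1, neg_zero]
  rw [hherm, h5, h2] at h3
  have h4 := (hpos v hv0).ne'
  simpa [h4] using h3

end Flat

/-! ### Pullbacks of differential forms and the exterior derivative -/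

section Forms

variable {E : Type*} [NormedAddCommGroup E] [NormedSpace ℝ E]
  {M : Type*} [TopologicalSpace M] [ChartedSpace E M]
  {V : Type*} [NormedAddCommGroup V] [NormedSpace ℝ V]

/-- The value of a differential form, on the model space. -/
def formAt {k : ℕ} (α : Form E M k) (x : M) : E [⋀^Fin k]→L[ℝ] ℝ := α x

/-- The pullback of a differential form. -/
def pullForm {k : ℕ} (α : Form E M k) (φ : V → M) (w : V) : V [⋀^Fin k]→L[ℝ] ℝ :=
  (formAt α (φ w)).compContinuousLinearMap (tderiv E φ w)

theorem formInChart_eq {k : ℕ} (α : Form E M k) (x₀ : M) :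
    formInChart α x₀ = pullForm α (extChartAt 𝓘(ℝ, E) x₀).symm := rfl

/-- A field of covectors, in the model space. -/
def covAt (θ : ∀ x : M, TangentSpace 𝓘(ℝ, E) x →L[ℝ] ℝ) (x : M) : E →L[ℝ] ℝ := θ x

/-- The pullback of a field of covectors. -/
def pullCov (θ : ∀ x : M, TangentSpace 𝓘(ℝ, E) x →L[ℝ] ℝ) (φ : V → M) (w : V) : V →L[ℝ] ℝ :=
  (covAt θ (φ w)).comp (tderiv E φ w)

theorem pullForm_oneForm (θ : ∀ x : M, TangentSpace 𝓘(ℝ, E) x →L[ℝ] ℝ) (φ : V → M) (w : V) :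
    pullForm (oneForm θ) φ w = altOne (pullCov θ φ w) := by
  ext v
  rfl

theorem pullForm_two (α : Form E M 2) (φ : V → M) (q u v : V) :
    pullForm α φ q ![u, v] = formAt α (φ q)
      ![tderiv E φ q u, tderiv E φ q v] := by
  refine congrArg (formAt α (φ q)) ?_
  ext i
  fin_cases i <;> rfl

theorem pullForm_three (α : Form E M 3) (φ : V → M) (q u v w : V) :
    pullForm α φ q ![u, v, w] = formAt α (φ q)
      ![tderiv E φ q u, tderiv E φ q v, tderiv E φ q w] := by
  refine congrArg (formAt α (φ q)) ?_
  ext i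
  fin_cases i <;> rfl

variable [IsManifold 𝓘(ℝ, E) ∞ M]

theorem pullForm_eventuallyEq {k : ℕ} (α : Form E M k) {φ : V → M} {w : V}
    (hφ : ContMDiffAt 𝓘(ℝ, V) 𝓘(ℝ, E) ∞ φ w)
    (hφ' : ∀ᶠ y in 𝓝 w, MDifferentiableAt 𝓘(ℝ, V) 𝓘(ℝ, E) φ y) :
    pullForm α φ =ᶠ[𝓝 w] fun y =>
      (formInChart α (φ w) (chartAt E (φ w) (φ y))).compContinuousLinearMap
        (fderiv ℝ (fun z => chartAt E (φ w) (φ z)) y) := by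
  let c := chartAt E (φ w)
  have hc : IsParam E c.symm := isParam_chartAt_symm (φ w)
  filter_upwards [hφ.continuousAt.eventually (c.open_source.mem_nhds (mem_chart_source E (φ w))),
    (eventually_eventually_nhds.mpr
      (hφ.continuousAt.eventually (c.open_source.mem_nhds (mem_chart_source E (φ w))))), hφ']
    with y hy hy2 hy3
  have hf : DifferentiableAt ℝ (fun z => c (φ z)) y := by
    rw [← mdifferentiableAt_iff_differentiableAt]
    exact MDifferentiableAt.comp y ((contMDiffAt_of_mem_maximalAtlas (n := ∞)
      (IsManifold.chart_mem_maximalAtlas (φ w)) hy).mdifferentiableAt (by simp)) hy3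
  have h1 : tderiv E (fun z => c.symm (c (φ z))) y = _ :=
    tderiv_comp (hc.contMDiffAt (c.map_source hy) |>.mdifferentiableAt (by simp)) hf
  have h2 : tderiv E (fun z => c.symm (c (φ z))) y = tderiv E φ y :=
    tderiv_congr (hy2.mono fun z hz => c.left_inv hz)
  have h3 : c.symm (c (φ y)) = φ y := c.left_inv hy
  ext v
  have key : ∀ x : M, x = φ y → formAt α (φ y) (tderiv E φ y ∘ v) =
      formAt α x (tderiv E φ y ∘ v) := by
    rintro x rfl; rfl
  refine (key _ h3).trans ?_
  rw [← h2, h1]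
  rfl

/-- The exterior derivative commutes with pullbacks to vector spaces. -/
theorem extDeriv_pullForm {k : ℕ} {α : Form E M k} (hα : IsSmoothForm α) {φ : V → M} {w : V}
    (hφ : ContMDiffAt 𝓘(ℝ, V) 𝓘(ℝ, E) ∞ φ w)
    (hφ' : ∀ᶠ y in 𝓝 w, MDifferentiableAt 𝓘(ℝ, V) 𝓘(ℝ, E) φ y) :
    extDeriv (pullForm α φ) w = pullForm (extDerivForm α) φ w := by
  rw [(pullForm_eventuallyEq α hφ hφ').extDeriv_eq]
  let c := chartAt E (φ w)
  have hcs : ContMDiffAt 𝓘(ℝ, E) 𝓘(ℝ, E) ∞ c (φ w) := contMDiffAt_of_mem_maximalAtlas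
      (IsManifold.chart_mem_maximalAtlas (φ w)) (mem_chart_source E (φ w))
  have hf : ContDiffAt ℝ ∞ (fun z => c (φ z)) w :=
    contMDiffAt_iff_contDiffAt.mp (hcs.comp w hφ)
  have ht : (extChartAt 𝓘(ℝ, E) (φ w)).target ∈ 𝓝 (c (φ w)) := extChartAt_target_mem_nhds (I := 𝓘(ℝ, E)) (φ w)
  rw [extDeriv_pullback (f := fun z => c (φ z)) (r := ∞)
    (((hα (φ w)).contDiffAt ht).differentiableAt (by simp)) hf (by simpa using ENat.LEInfty.out)]
  have h1 : fderiv ℝ (fun z => c (φ z)) w =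
      (mfderiv 𝓘(ℝ, E) 𝓘(ℝ, E) c (φ w) : E →L[ℝ] E).comp (tderiv E φ w) := by
    rw [← mfderiv_eq_fderiv]
    exact mfderiv_comp w (hcs.mdifferentiableAt (by simp)) (hφ.mdifferentiableAt (by simp))
  rw [h1]
  rfl

theorem contDiffAt_pullCov {θ : ∀ x : M, TangentSpace 𝓘(ℝ, E) x →L[ℝ] ℝ}
    (hθ : IsSmoothForm (oneForm θ)) {φ : V → M} {w : V}
    (hφ : ContMDiffAt 𝓘(ℝ, V) 𝓘(ℝ, E) ∞ φ w)
    (hφ' : ∀ᶠ y in 𝓝 w, MDifferentiableAt 𝓘(ℝ, V) 𝓘(ℝ, E) φ y) :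
    ContDiffAt ℝ ∞ (pullCov θ φ) w := by
  let c := chartAt E (φ w)
  have hcs : ContMDiffAt 𝓘(ℝ, E) 𝓘(ℝ, E) ∞ c (φ w) := contMDiffAt_of_mem_maximalAtlas
      (IsManifold.chart_mem_maximalAtlas (φ w)) (mem_chart_source E (φ w))
  have hf : ContDiffAt ℝ ∞ (fun z => c (φ z)) w :=
    contMDiffAt_iff_contDiffAt.mp (hcs.comp w hφ)
  have ht : (extChartAt 𝓘(ℝ, E) (φ w)).target ∈ 𝓝 (c (φ w)) := extChartAt_target_mem_nhds (I := 𝓘(ℝ, E)) (φ w)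
  have h1 : ContDiffAt ℝ ∞ (pullCov θ (extChartAt 𝓘(ℝ, E) (φ w)).symm) (c (φ w)) := by
    rw [← contDiffAt_altOne_iff]
    exact (hθ (φ w)).contDiffAt ht
  have h2 := (ContDiffAt.comp (x := w) (f := fun z => c (φ z)) h1 hf).clm_comp
    (hf.fderiv_right (m := ∞) (by simp))
  refine h2.congr_of_eventuallyEq ?_
  filter_upwards [pullForm_eventuallyEq (oneForm θ) hφ hφ'] with y hy
  refine ContinuousLinearMap.ext fun u => ?_
  exact DFunLike.congr_fun hy (fun _ : Fin 1 => u)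

end Forms

/-! ### The Kähler form in parametrizations -/

section Kahler

variable {E : Type*} [NormedAddCommGroup E] [NormedSpace ℝ E]
  {M : Type*} [TopologicalSpace M] [ChartedSpace E M] [IsManifold 𝓘(ℝ, E) ∞ M]
  {V : Type*} [NormedAddCommGroup V] [NormedSpace ℝ V]
  {J : ComplexStructure E M} (g : HermitianMetric J)

/-- The pullback of the Kähler form, as a bilinear form. -/
def pullKahler (φ : V → M) (w : V) : V →L[ℝ] V →L[ℝ] ℝ :=
  (bilinAt g.inner (φ w)).bilinearComp ((endAt J.toFun (φ w)).comp (tderiv E φ w)) (tderiv E φ w)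

theorem pullKahler_apply (φ : V → M) (w u v : V) : pullKahler g φ w u v =
    bilinAt g.inner (φ w) (endAt J.toFun (φ w) (tderiv E φ w u)) (tderiv E φ w v) := rfl

theorem kahler_skew (x : M) (u v : E) : bilinAt g.inner x (endAt J.toFun x u) v =
    -bilinAt g.inner x (endAt J.toFun x v) u := by
  have h1 : bilinAt g.inner x (endAt J.toFun x (endAt J.toFun x u)) (endAt J.toFun x v) =
    bilinAt g.inner x (endAt J.toFun x u) v := g.hermitian x _ _
  have h2 : endAt J.toFun x (endAt J.toFun x u) = -u := J.sq x u
  have h3 : bilinAt g.inner x (-u) (endAt J.toFun x v) =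
      -bilinAt g.inner x (endAt J.toFun x v) u := by
    have : bilinAt g.inner x (-u) (endAt J.toFun x v) =
      bilinAt g.inner x (endAt J.toFun x v) (-u) := g.symm x _ _
    rw [this, map_neg]
  rw [← h1, h2, h3]

theorem pullForm_kahlerForm (φ : V → M) (w : V) :
    pullForm (kahlerForm g) φ w = altTwo (pullKahler g φ w) := by
  ext v
  rw [altTwo_apply_of_skew]
  · rfl
  · intro u v
    exact kahler_skew g _ _ _

variable [FiniteDimensional ℝ V]

/-- The form is the image under the linear map `altTwo` of a field of bilinear forms, whose
evaluations on constant vectors are smooth because `g` and `J` are. -/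
theorem contDiffAt_pullForm_kahlerForm {φ : V → M} {w : V}
    (hφ : ContMDiffAt 𝓘(ℝ, V) 𝓘(ℝ, E) ∞ φ w) :
    ContDiffAt ℝ ∞ (pullForm (kahlerForm g) φ) w := by
  have h0 : pullForm (kahlerForm g) φ = fun y => altTwo (pullKahler g φ y) :=
    funext fun y => pullForm_kahlerForm g φ y
  rw [h0]
  suffices h : ContDiffAt ℝ ∞ (pullKahler g φ) w from
    ContDiffAt.comp w contDiff_altTwo.contDiffAt h
  refine contDiffAt_clm_of_apply fun u => contDiffAt_clm_of_apply fun v => ?_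
  have h1 := contMDiffAt_tderiv hφ (contDiffAt_const (c := u))
  have h2 : ContMDiffAt 𝓘(ℝ, V) 𝓘(ℝ, E).tangent ∞
      (fun y => (⟨φ y, J.toFun (φ y) (tderiv E φ y u)⟩ : TangentBundle 𝓘(ℝ, E) M)) w :=
    ContMDiffAt.clm_bundle_apply (F₁ := E) (F₂ := E)
      (ContMDiffAt.comp w J.smooth.contMDiffAt hφ) h1
  exact contDiffAt_pullBilin_apply g.contMDiff hφ h2
    (contMDiffAt_tderiv hφ (contDiffAt_const (c := v)))

variable [FiniteDimensional ℝ E]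

theorem isSmoothForm_kahlerForm : IsSmoothForm (kahlerForm g) := by
  intro x₀ y hy
  rw [formInChart_eq]
  refine (contDiffAt_pullForm_kahlerForm g ?_).contDiffWithinAt
  exact (contMDiffOn_extChartAt_symm x₀).contMDiffAt (extChartAt_target_mem_nhds' hy)

end Kahler

/-! ### Local nature of the locally conformal Kähler condition -/

section LCK

variable {E : Type*} [NormedAddCommGroup E] [NormedSpace ℝ E] [FiniteDimensional ℝ E]
  {M : Type*} [TopologicalSpace M] [ChartedSpace E M] [IsManifold 𝓘(ℝ, E) ∞ M]
  {J : ComplexStructure E M}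

/-- The equation `dΩ = ξ ∧ Ω` at a point. -/
def LeeAt (g : HermitianMetric J) (x : M) (ξ : E →L[ℝ] ℝ) : Prop :=
  ∀ u v w : E, formAt (extDerivForm (kahlerForm g)) x ![u, v, w] =
    ξ u * bilinAt g.inner x (endAt J.toFun x v) w + ξ v * bilinAt g.inner x (endAt J.toFun x w) u
      + ξ w * bilinAt g.inner x (endAt J.toFun x u) v

/-- The difference of two solutions has zero wedge product with `Ω`. Uniqueness at each point is
what lets locally defined Lee forms agree on overlaps. -/
theorem LeeAt.unique {g : HermitianMetric J} (hd : 3 ≤ Module.finrank ℝ E) {x : M}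
    {ξ ξ' : E →L[ℝ] ℝ} (h : LeeAt g x ξ) (h' : LeeAt g x ξ') : ξ = ξ' := by
  rw [← sub_eq_zero]
  refine eq_zero_of_wedge_eq_zero hd (b := bilinAt g.inner x) (j := endAt J.toFun x)
    (g.pos x) (J.sq x) (g.hermitian x) (g.symm x) fun u v w => ?_
  have h1 := (h u v w).symm.trans (h' u v w)
  simp only [sub_apply]
  linear_combination h1

variable {V : Type*} [NormedAddCommGroup V] [NormedSpace ℝ V]

theorem extDeriv_pullForm_kahlerForm (g : HermitianMetric J) {φ : V → M} {U : Set V}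
    (hU : IsOpen U) (hφ : ContMDiffOn 𝓘(ℝ, V) 𝓘(ℝ, E) ∞ φ U) {q : V} (hq : q ∈ U) (u v w : V) :
    extDeriv (pullForm (kahlerForm g) φ) q ![u, v, w] =
      formAt (extDerivForm (kahlerForm g)) (φ q)
      ![tderiv E φ q u, tderiv E φ q v, tderiv E φ q w] := by
  rw [extDeriv_pullForm (isSmoothForm_kahlerForm g) (hφ.contMDiffAt (hU.mem_nhds hq)),
    pullForm_three]
  filter_upwards [hU.mem_nhds hq] with y hy
  exact (hφ.contMDiffAt (hU.mem_nhds hy)).mdifferentiableAt (by simp)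

/-- In real dimension at least `3`, being locally conformal Kähler is a local property. -/
theorem isLCK_of_local {g : HermitianMetric J} (hd : 3 ≤ Module.finrank ℝ E)
    (h : ∀ p : M, ∃ η : E → E →L[ℝ] ℝ, ∀ q ∈ (chartAt E p).target, ContDiffAt ℝ ∞ η q ∧
      extDeriv (fun y => altOne (η y)) q = 0 ∧
      ∀ u v w, extDeriv (pullForm (kahlerForm g) (chartAt E p).symm) q ![u, v, w] =
        η q u * pullKahler g (chartAt E p).symm q v w + η q v * pullKahler g (chartAt E p).symm q w u
          + η q w * pullKahler g (chartAt E p).symm q u v) : IsLCK g := by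
  choose η hη using h
  have hp : ∀ p : M, IsParam E (chartAt E p).symm := isParam_chartAt_symm
  have hlee : ∀ (p : M), ∀ q ∈ (chartAt E p).target, LeeAt g ((chartAt E p).symm q)
      ((η p q).comp (tderiv E (chartAt E p).symm q).inverse) := by
    intro p q hq a b c
    have h1 := (hη p q hq).2.2 ((tderiv E (chartAt E p).symm q).inverse a)
      ((tderiv E (chartAt E p).symm q).inverse b) ((tderiv E (chartAt E p).symm q).inverse c)
    rw [extDeriv_pullForm_kahlerForm g (chartAt E p).open_target (hp p).smooth hq] at h1
    simp only [pullKahler_apply, (hp p).apply_inverse hq] at h1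
    exact h1
  -- At each `x` the value is taken from the chart at `x` itself.
  let θ : ∀ x : M, TangentSpace 𝓘(ℝ, E) x →L[ℝ] ℝ := fun x =>
    ((η x (chartAt E x x)).comp (tderiv E (chartAt E x).symm (chartAt E x x)).inverse : E →L[ℝ] ℝ)
  have hθ : ∀ x, LeeAt g x (covAt θ x) := by
    intro x
    have h1 := hlee x (chartAt E x x) ((chartAt E x).map_source (mem_chart_source E x))
    rwa [(chartAt E x).left_inv (mem_chart_source E x)] at h1
  -- By uniqueness the pointwise choice coincides, throughout every chart, with the smooth closed
  -- form given there.
  have hpull : ∀ p : M, ∀ q ∈ (chartAt E p).target,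
      pullCov θ (chartAt E p).symm q = η p q := by
    intro p q hq
    have h1 := LeeAt.unique hd (hθ ((chartAt E p).symm q)) (hlee p q hq)
    refine ContinuousLinearMap.ext fun u => ?_
    rw [pullCov, h1]
    simp only [ContinuousLinearMap.comp_apply, (hp p).inverse_apply hq]
  have hform : ∀ p : M, ∀ q ∈ (chartAt E p).target,
      formInChart (oneForm θ) p q = altOne (η p q) := by
    intro p q hq
    rw [← hpull p q hq, ← pullForm_oneForm]
    rfl
  refine ⟨θ, ⟨?_, ?_, ?_⟩⟩
  · intro p q hq
    have hq' : q ∈ (chartAt E p).target := by simpa using hq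
    refine ContDiffAt.contDiffWithinAt ?_
    refine (contDiffAt_altOne_iff.mpr (hη p q hq').1).congr_of_eventuallyEq ?_
    filter_upwards [(chartAt E p).open_target.mem_nhds hq'] with y hy
    exact hform p y hy
  · funext p
    have hq : chartAt E p p ∈ (chartAt E p).target :=
      (chartAt E p).map_source (mem_chart_source E p)
    have h1 : extDeriv (formInChart (oneForm θ) p) (chartAt E p p) = 0 := by
      rw [← (hη p _ hq).2.1]
      refine Filter.EventuallyEq.extDeriv_eq ?_
      filter_upwards [(chartAt E p).open_target.mem_nhds hq] with y hy
      exact hform p y hy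
    have h2 : extDeriv (formInChart (oneForm θ) p) (extChartAt 𝓘(ℝ, E) p p) = 0 := h1
    rw [extDerivForm, h2]
    rfl
  · intro x u v w
    exact hθ x u v w

/-- In real dimension at most `2`, every Hermitian metric is locally conformal Kähler. -/
theorem isLCK_of_finrank_le_two (g : HermitianMetric J) (hd : Module.finrank ℝ E ≤ 2) :
    IsLCK g := by
  -- Three vectors in dimension at most 2 are dependent, so the zero form serves as a Lee form.
  have h3 : ∀ (α : E [⋀^Fin 3]→L[ℝ] ℝ) (v : Fin 3 → E), α v = 0 := by
    intro α v
    refine α.toAlternatingMap.map_linearDependent v fun hv => ?_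
    have := hv.fintype_card_le_finrank
    simp at this
    omega
  have h0 : ∀ x₀ : M, formInChart (oneForm (0 : ∀ x : M, TangentSpace 𝓘(ℝ, E) x →L[ℝ] ℝ)) x₀ =
      fun _ => 0 := by
    intro x₀
    funext q
    ext v
    rfl
  refine ⟨0, ⟨?_, ?_, ?_⟩⟩
  · intro x₀
    rw [h0]
    exact contDiffOn_const
  · funext p
    rw [extDerivForm, h0]
    have : extDeriv (fun _ : E => (0 : E [⋀^Fin 1]→L[ℝ] ℝ)) = 0 := by
      funext q
      ext v
      rw [extDeriv_apply (differentiableAt_const _)]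
      simp
    rw [this]
    rfl
  · intro x u v w
    rw [show extDerivForm (kahlerForm g) x ![u, v, w] = 0 from h3 _ _]
    simp

/-- The pullback of the Kähler form by an arbitrary map, multiplied by a positive function,
satisfies the equation of a locally conformal Kähler form. -/
theorem IsLeeForm.pullback_exp [FiniteDimensional ℝ V] {g : HermitianMetric J}
    {θ : ∀ x : M, TangentSpace 𝓘(ℝ, E) x →L[ℝ] ℝ} (hθ : IsLeeForm g θ) {φ : V → M} {U : Set V}
    (hU : IsOpen U) (hφ : ContMDiffOn 𝓘(ℝ, V) 𝓘(ℝ, E) ∞ φ U) {h : V → ℝ}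
    (hh : ContDiffOn ℝ ∞ h U) {Ω' : V → V [⋀^Fin 2]→L[ℝ] ℝ}
    (hΩ' : ∀ q ∈ U, Ω' q = Real.exp (h q) • pullForm (kahlerForm g) φ q) :
    ∃ η : V → V →L[ℝ] ℝ, ∀ q ∈ U, ContDiffAt ℝ ∞ η q ∧
      extDeriv (fun y => altOne (η y)) q = 0 ∧
      ∀ u v w, extDeriv Ω' q ![u, v, w] =
        η q u * Ω' q ![v, w] + η q v * Ω' q ![w, u] + η q w * Ω' q ![u, v] := by
  -- `d(e^h φ^*Ω) = (dh + φ^*θ) ∧ e^h φ^*Ω`, and `dh + φ^*θ` is closed.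
  refine ⟨fun q => pullCov θ φ q + fderiv ℝ h q, fun q hq => ?_⟩
  have hφq : ∀ y ∈ U, ContMDiffAt 𝓘(ℝ, V) 𝓘(ℝ, E) ∞ φ y := fun y hy =>
    hφ.contMDiffAt (hU.mem_nhds hy)
  have hφ' : ∀ᶠ y in 𝓝 q, MDifferentiableAt 𝓘(ℝ, V) 𝓘(ℝ, E) φ y := by
    filter_upwards [hU.mem_nhds hq] with y hy
    exact (hφq y hy).mdifferentiableAt (by simp)
  have hhq : ContDiffAt ℝ ∞ h q := hh.contDiffAt (hU.mem_nhds hq)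
  have h1 := contDiffAt_pullCov hθ.smooth (hφq q hq) hφ'
  have h2 : ContDiffAt ℝ ∞ (fderiv ℝ h) q := hhq.fderiv_right (m := ∞) (by simp)
  refine ⟨h1.add h2, ?_, ?_⟩
  · have e : (fun y => altOne (pullCov θ φ y + fderiv ℝ h y)) =
        fun y => altOne (pullCov θ φ y) + altOne (fderiv ℝ h y) := funext fun y => map_add _ _ _
    rw [e, extDeriv_fun_add ((contDiffAt_altOne_iff.mpr h1).differentiableAt (by simp))
      ((contDiffAt_altOne_iff.mpr h2).differentiableAt (by simp)), extDeriv_altOne_fderiv hhq,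
      add_zero]
    have e2 : (fun y => altOne (pullCov θ φ y)) = pullForm (oneForm θ) φ :=
      funext fun y => (pullForm_oneForm θ φ y).symm
    rw [e2, extDeriv_pullForm hθ.smooth (hφq q hq) hφ', hθ.closed]
    ext v
    rfl
  · intro u v w
    have e : Ω' =ᶠ[𝓝 q] fun y => Real.exp (h y) • pullForm (kahlerForm g) φ y := by
      filter_upwards [hU.mem_nhds hq] with y hy
      exact hΩ' y hy
    have hd : DifferentiableAt ℝ h q := hhq.differentiableAt (by simp)
    rw [e.extDeriv_eq, extDeriv_mul_apply hd.exp
      ((contDiffAt_pullForm_kahlerForm g (hφq q hq)).differentiableAt (by simp)),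
      extDeriv_pullForm_kahlerForm g hU hφ hq, hΩ' q hq, fderiv_exp hd]
    have h3 := hθ.d_kahlerForm (φ q) (tderiv E φ q u) (tderiv E φ q v) (tderiv E φ q w)
    have h4 : ∀ a b : V, kahlerForm g (φ q) ![tderiv E φ q a, tderiv E φ q b] =
        pullForm (kahlerForm g) φ q ![a, b] := fun a b =>
      (pullForm_two (kahlerForm g) φ q a b).symm
    rw [h4, h4, h4] at h3
    have h6 : formAt (extDerivForm (kahlerForm g)) (φ q)
      ![tderiv E φ q u, tderiv E φ q v, tderiv E φ q w] = _ := h3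
    rw [h6]
    have h5 : ∀ a, θ (φ q) (tderiv E φ q a) = pullCov θ φ q a := fun a => rfl
    simp only [smul_apply, add_apply, ContinuousAlternatingMap.smul_apply, smul_eq_mul, h5]
    ring

end LCK


/-! ### Derivatives between manifolds as maps of model spaces -/

section Mderiv

variable (E E' E'' : Type*) [NormedAddCommGroup E] [NormedSpace ℝ E]
  [NormedAddCommGroup E'] [NormedSpace ℝ E'] [NormedAddCommGroup E''] [NormedSpace ℝ E'']
  {M M' M'' : Type*} [TopologicalSpace M] [ChartedSpace E M] [TopologicalSpace M']
  [ChartedSpace E' M'] [TopologicalSpace M''] [ChartedSpace E'' M'']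

/-- The derivative of a map between manifolds, as a map between the model spaces. -/
def mderiv (f : M → M') (x : M) : E →L[ℝ] E' := mfderiv 𝓘(ℝ, E) 𝓘(ℝ, E') f x

/-- The chain rule with the intermediate point given up to an equation, which spares transports
between tangent spaces when the point is simplified. -/
theorem mderiv_comp_of_eq {f : M → M'} {g : M' → M''} {x : M} {y : M'} (e : f x = y)
    (hg : MDifferentiableAt 𝓘(ℝ, E') 𝓘(ℝ, E'') g y)
    (hf : MDifferentiableAt 𝓘(ℝ, E) 𝓘(ℝ, E') f x) :
    mderiv E E'' (fun z => g (f z)) x = (mderiv E' E'' g y).comp (mderiv E E' f x) := by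
  subst e
  exact mfderiv_comp x hg hf

theorem mderiv_id (x : M) : mderiv E E (fun z : M => z) x = ContinuousLinearMap.id ℝ E :=
  mfderiv_id

theorem mderiv_congr {f g : M → M'} {x : M} (h : f =ᶠ[𝓝 x] g) : mderiv E E' f x = mderiv E E' g x :=
  h.mfderiv_eq

end Mderiv

/-! ### A Lie group near the identity -/

section GroupParam

variable (F : Type*) [NormedAddCommGroup F]
  (G : Type*) [TopologicalSpace G] [ChartedSpace F G] [Group G]

/-- The parametrization of a Lie group near `1` given by the chart at `1`, centred at `0`. -/
def groupParam : OpenPartialHomeomorph F G :=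
  (Homeomorph.addRight (chartAt F (1 : G) 1)).toOpenPartialHomeomorph.trans (chartAt F (1 : G)).symm

variable {F G}

theorem groupParam_apply (a : F) :
    groupParam F G a = (chartAt F (1 : G)).symm (a + chartAt F (1 : G) 1) := rfl

theorem zero_mem_groupParam_source : (0 : F) ∈ (groupParam F G).source := by
  refine ⟨Set.mem_univ _, ?_⟩
  change (0 : F) + chartAt F (1 : G) 1 ∈ (chartAt F (1 : G)).target
  rw [zero_add]
  exact (chartAt F (1 : G)).map_source (mem_chart_source F 1)

@[simp] theorem groupParam_zero : groupParam F G 0 = 1 := by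
  rw [groupParam_apply, zero_add, (chartAt F (1 : G)).left_inv (mem_chart_source F 1)]

variable [NormedSpace ℝ F]

theorem isParam_groupParam [IsManifold 𝓘(ℝ, F) ∞ G] : IsParam F (groupParam F G) := by
  constructor
  · refine (contMDiffOn_chart_symm (n := ∞) (I := 𝓘(ℝ, F)) (x := (1 : G))).comp
      (f := fun a : F => a + chartAt F (1 : G) 1) ?_ fun a ha => ha.2
    exact (contDiff_id.add contDiff_const).contMDiff.contMDiffOn
  · have h : ContMDiff 𝓘(ℝ, F) 𝓘(ℝ, F) ∞ fun a : F => a + -chartAt F (1 : G) 1 :=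
      (contDiff_id.add contDiff_const).contMDiff
    exact h.comp_contMDiffOn ((contMDiffOn_chart (n := ∞) (I := 𝓘(ℝ, F)) (x := (1 : G))).mono
      fun a ha => ha.1)

variable [LieGroup 𝓘(ℝ, F) ∞ G]

/-- The right Maurer–Cartan form in the chart at `1`. -/
def mcForm (G : Type*) [TopologicalSpace G] [ChartedSpace F G] [Group G] (a : F) : F →L[ℝ] F :=
  tderiv F (fun b => groupParam F G b * (groupParam F G a)⁻¹) a

/-- By the chain rule it is the derivative of a right translation after that of the parametrization,
and both are invertible. -/
theorem mcForm_surjective {a : F} (ha : a ∈ (groupParam F G).source) :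
    Function.Surjective (mcForm G a) := by
  set h : G := groupParam F G a with hh
  have hp := isParam_groupParam (F := F) (G := G)
  have hR : ∀ k k' : G, MDifferentiableAt 𝓘(ℝ, F) 𝓘(ℝ, F) (fun l => l * k) k' := fun k k' =>
    (contMDiff_mul_right (I := 𝓘(ℝ, F)) (n := ∞) (a := k)).mdifferentiableAt (by simp)
  have h1 : mcForm G a = (mderiv F F (fun l : G => l * h⁻¹) h).comp
      (tderiv F (groupParam F G) a) :=
    mderiv_comp_of_eq F F F (g := fun l : G => l * h⁻¹) hh.symm (hR _ _)
      ((hp.contMDiffAt ha).mdifferentiableAt (by simp))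
  have h2 : (mderiv F F (fun l : G => l * h⁻¹) h).comp (mderiv F F (fun l : G => l * h) 1) =
      ContinuousLinearMap.id ℝ F := by
    rw [← mderiv_comp_of_eq F F F (f := fun l : G => l * h) (g := fun l : G => l * h⁻¹) (one_mul h)
      (hR _ h) (hR _ _)]
    simp only [mul_inv_cancel_right]
    exact mderiv_id F _
  intro X
  refine ⟨(tderiv F (groupParam F G) a).inverse (mderiv F F (fun l : G => l * h) 1 X), ?_⟩
  rw [h1, ContinuousLinearMap.comp_apply, hp.apply_inverse ha]
  exact DFunLike.congr_fun h2 X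

/-- It is a partial derivative, on the diagonal, of the smooth map sending `(a, b)` to `h_b h_a⁻¹`.
The diagonal goes to `1`, so near it the map can be read in the single chart at `1`. -/
theorem continuousAt_mcForm : ContinuousAt (mcForm G : F → F →L[ℝ] F) 0 := by
  let c := chartAt F (1 : G)
  have hp := isParam_groupParam (F := F) (G := G)
  have hc : IsParam F c.symm := isParam_chartAt_symm (1 : G)
  let m : F × F → G := fun p => groupParam F G p.2 * (groupParam F G p.1)⁻¹
  let S : Set (F × F) := (groupParam F G).source ×ˢ (groupParam F G).source
  have hS : IsOpen S := (groupParam F G).open_source.prod (groupParam F G).open_source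
  have hm : ContMDiffOn 𝓘(ℝ, F × F) 𝓘(ℝ, F) ∞ m S := by
    have h1 : ContMDiffOn 𝓘(ℝ, F × F) 𝓘(ℝ, F) ∞ (fun p : F × F => groupParam F G p.2) S :=
      hp.smooth.comp contDiff_snd.contMDiff.contMDiffOn fun p hp => hp.2
    have h2 : ContMDiffOn 𝓘(ℝ, F × F) 𝓘(ℝ, F) ∞ (fun p : F × F => groupParam F G p.1) S :=
      hp.smooth.comp contDiff_fst.contMDiff.contMDiffOn fun p hp => hp.1
    exact h1.mul h2.inv
  let S' : Set (F × F) := S ∩ m ⁻¹' c.source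
  have hS' : IsOpen S' := hm.continuousOn.isOpen_inter_preimage hS c.open_source
  have hH : ContDiffOn ℝ ∞ (fun p => c (m p)) S' := by
    rw [← contMDiffOn_iff_contDiffOn]
    exact (contMDiffOn_chart (n := ∞) (I := 𝓘(ℝ, F)) (x := (1 : G))).comp
      (hm.mono Set.inter_subset_left) fun y hy => hy.2
  have hmd : ∀ a : F, m (a, a) = 1 := fun a => mul_inv_cancel _
  have hd : ∀ a ∈ (groupParam F G).source, (a, a) ∈ S' := fun a ha =>
    ⟨⟨ha, ha⟩, by rw [Set.mem_preimage, hmd]; exact mem_chart_source F 1⟩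
  have key : ∀ a ∈ (groupParam F G).source, mcForm G a =
      (tderiv F c.symm (c 1)).comp ((fderiv ℝ (fun p => c (m p)) (a, a)).comp
        (ContinuousLinearMap.inr ℝ F F)) := by
    intro a ha
    have hHa : DifferentiableAt ℝ (fun p => c (m p)) (a, a) :=
      (hH.contDiffAt (hS'.mem_nhds (hd a ha))).differentiableAt (by simp)
    have hin : HasFDerivAt (fun b : F => (a, b)) (ContinuousLinearMap.inr ℝ F F) a :=
      hasFDerivAt_prodMk_right a a
    have h1 : HasFDerivAt (fun b => c (m (a, b))) ((fderiv ℝ (fun p => c (m p)) (a, a)).comp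
        (ContinuousLinearMap.inr ℝ F F)) a := hHa.hasFDerivAt.comp a hin
    have h2 : tderiv F (fun b => c.symm (c (m (a, b)))) a = _ := tderiv_comp
      (φ := c.symm) (f := fun b => c (m (a, b)))
      ((hc.contMDiffAt (by rw [hmd]; exact c.map_source (mem_chart_source F 1))).mdifferentiableAt
        (by simp)) h1.differentiableAt
    rw [h1.fderiv, hmd] at h2
    rw [← h2]
    refine tderiv_congr ?_
    have : ∀ᶠ b in 𝓝 a, (a, b) ∈ S' :=
      hin.continuousAt.eventually (hS'.mem_nhds (hd a ha))
    filter_upwards [this] with b hb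
    exact (c.left_inv hb.2).symm
  have h0 : ContinuousAt (fun a : F => (tderiv F c.symm (c 1)).comp
      ((fderiv ℝ (fun p => c (m p)) (a, a)).comp (ContinuousLinearMap.inr ℝ F F))) 0 := by
    have h1 : ContinuousAt (fderiv ℝ (fun p => c (m p))) ((0 : F), (0 : F)) :=
      ((hH.contDiffAt (hS'.mem_nhds (hd 0 zero_mem_groupParam_source))).fderiv_right
        (m := ∞) (by simp)).continuousAt
    have h2 : ContinuousAt (fun a : F => fderiv ℝ (fun p => c (m p)) (a, a)) 0 :=
      ContinuousAt.comp (f := fun a : F => (a, a)) h1 (by fun_prop)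
    exact continuousAt_const.clm_comp (h2.clm_comp continuousAt_const)
  refine h0.congr ?_
  filter_upwards [(groupParam F G).open_source.mem_nhds zero_mem_groupParam_source] with a ha
  exact (key a ha).symm

end GroupParam

/-! ### The infinitesimal action along orbits -/

section Action

variable {E : Type*} [NormedAddCommGroup E] [NormedSpace ℝ E]
  {M : Type*} [TopologicalSpace M] [ChartedSpace E M]
  {F : Type*} [NormedAddCommGroup F] [NormedSpace ℝ F]
  {G : Type*} [TopologicalSpace G] [ChartedSpace F G] [Group G] [MulAction G M]

variable (E F G) in
/-- The infinitesimal action at a point. -/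
def fundAt (x : M) : F →L[ℝ] E := mderiv F E (fun h : G => h • x) 1

section SMul

theorem mdifferentiableAt_const_smul {E : Type*} [NormedAddCommGroup E] [NormedSpace ℝ E]
    {M : Type*} [TopologicalSpace M] [ChartedSpace E M]
    (F : Type*) [NormedAddCommGroup F] [NormedSpace ℝ F]
    {G : Type*} [TopologicalSpace G] [ChartedSpace F G] [Group G] [MulAction G M]
    [ContMDiffSMul 𝓘(ℝ, F) 𝓘(ℝ, E) ∞ G M] (h : G) (x : M) :
    MDifferentiableAt 𝓘(ℝ, E) 𝓘(ℝ, E) (fun x : M => h • x) x :=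
  (ContMDiffSMul.contMDiff_const_smul (I := 𝓘(ℝ, F)) (n := ∞) h).mdifferentiableAt (by simp)

variable [ContMDiffSMul 𝓘(ℝ, F) 𝓘(ℝ, E) ∞ G M]

theorem contMDiff_orbit (x : M) : ContMDiff 𝓘(ℝ, F) 𝓘(ℝ, E) ∞ fun h : G => h • x :=
  contMDiff_id.smul contMDiff_const

theorem mdifferentiableAt_orbit (x : M) (h : G) :
    MDifferentiableAt 𝓘(ℝ, F) 𝓘(ℝ, E) (fun h : G => h • x) h :=
  (contMDiff_orbit x).mdifferentiableAt (by simp)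

variable [LieGroup 𝓘(ℝ, F) ∞ G]

/-- The derivative of the parametrization of an orbit. -/
theorem tderiv_orbit {a : F} (ha : a ∈ (groupParam F G).source) (x : M) :
    tderiv E (fun b => groupParam F G b • x) a =
      (fundAt E F G (groupParam F G a • x)).comp (mcForm G a) := by
  have hp := isParam_groupParam (F := F) (G := G)
  have h1 : (fun b => groupParam F G b • x) = fun b =>
      (groupParam F G b * (groupParam F G a)⁻¹) • (groupParam F G a • x) := by
    funext b
    rw [smul_smul, inv_mul_cancel_right]
  rw [h1]
  refine mderiv_comp_of_eq F F E (g := fun k : G => k • (groupParam F G a • x))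
    (mul_inv_cancel _) (mdifferentiableAt_orbit _ _) ?_
  exact (contMDiff_mul_right (I := 𝓘(ℝ, F)) (n := ∞)).mdifferentiableAt (by simp) |>.comp a
    ((hp.contMDiffAt ha).mdifferentiableAt (by simp))

/-- The infinitesimal action at a translated point. -/
theorem exists_fundAt_smul (h : G) (x : M) (X : F) :
    ∃ Y : F, fundAt E F G (h • x) X = mderiv E E (fun y : M => h • y) x (fundAt E F G x Y) := by
  -- From `k h x = h (h⁻¹ k h) x`, the vector `Y` is the image of `X` under the derivative of
  -- conjugation at `1`.
  have hc : ContMDiff 𝓘(ℝ, F) 𝓘(ℝ, F) ∞ fun k : G => h⁻¹ * k * h :=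
    (contMDiff_mul_right (I := 𝓘(ℝ, F)) (n := ∞)).comp contMDiff_mul_left
  have h1 : (fun k : G => k • (h • x)) = fun k => h • ((h⁻¹ * k * h) • x) := by
    funext k
    simp only [smul_smul]
    congr 1
    group
  have h2 : fundAt E F G (h • x) = (mderiv E E (fun y : M => h • y) x).comp
      (mderiv F E (fun k : G => (h⁻¹ * k * h) • x) 1) := by
    rw [fundAt, h1]
    refine mderiv_comp_of_eq F E E (by simp) (mdifferentiableAt_const_smul F h x) ?_
    exact (mdifferentiableAt_orbit x _).comp (1 : G) (hc.mdifferentiableAt (by simp))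
  have h3 : mderiv F E (fun k : G => (h⁻¹ * k * h) • x) 1 = (fundAt E F G x).comp
      (mderiv F F (fun k : G => h⁻¹ * k * h) 1) :=
    mderiv_comp_of_eq F F E (by simp) (mdifferentiableAt_orbit x 1)
      (hc.mdifferentiableAt (by simp))
  exact ⟨mderiv F F (fun k : G => h⁻¹ * k * h) 1 X, by rw [h2, h3]; rfl⟩

end SMul

end Action


/-! ### The momentum map and invariance of its zero level -/

section Momentum

variable {E : Type*} [NormedAddCommGroup E] [NormedSpace ℝ E]
  {M : Type*} [TopologicalSpace M] [ChartedSpace E M]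
  {F : Type*} [NormedAddCommGroup F] [NormedSpace ℝ F] [FiniteDimensional ℝ F]
  {G : Type*} [TopologicalSpace G] [ChartedSpace F G] [Group G]
  (μ : GroupLieAlgebra 𝓘(ℝ, F) G →ₗ[ℝ] C^∞⟮𝓘(ℝ, E), M; 𝓘(ℝ, ℝ), ℝ⟯)

theorem contMDiff_momentumMap [IsManifold 𝓘(ℝ, E) ∞ M] :
    ContMDiff 𝓘(ℝ, E) 𝓘(ℝ, F →L[ℝ] ℝ) ∞ (momentumMap μ) := by
  intro x
  have hx : chartAt E x x ∈ (chartAt E x).symm.source :=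
    (chartAt E x).map_source (mem_chart_source E x)
  have hgoal : ContMDiffAt 𝓘(ℝ, E) 𝓘(ℝ, F →L[ℝ] ℝ) ∞ (momentumMap μ)
      ((chartAt E x).symm (chartAt E x x)) := by
    refine (isParam_chartAt_symm x).contMDiffAt_of_comp hx (ContDiffAt.contMDiffAt ?_)
    refine contDiffAt_clm_of_apply fun X => ?_
    exact ((μ X).contMDiff.contMDiffAt.comp _
      ((isParam_chartAt_symm x).contMDiffAt hx)).contDiffAt
  rwa [(chartAt E x).left_inv (mem_chart_source E x)] at hgoal

theorem isClosed_zeroLevel [IsManifold 𝓘(ℝ, E) ∞ M] : IsClosed (zeroLevel μ) :=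
  isClosed_singleton.preimage (contMDiff_momentumMap μ).continuous

/-- The differential of the momentum map. -/
def dmu (x : M) : E →L[ℝ] (F →L[ℝ] ℝ) := mderiv E (F →L[ℝ] ℝ) (momentumMap μ) x

theorem dmu_apply [IsManifold 𝓘(ℝ, E) ∞ M] (x : M) (u : E) (X : F) :
    dmu μ x u X = mvfderiv 𝓘(ℝ, E) (μ (X : GroupLieAlgebra 𝓘(ℝ, F) G)) x u := by
  have h1 : mderiv E ℝ (fun y => ContinuousLinearMap.apply ℝ ℝ X (momentumMap μ y)) x =
      (mderiv (F →L[ℝ] ℝ) ℝ (ContinuousLinearMap.apply ℝ ℝ X) (momentumMap μ x)).comp (dmu μ x) :=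
    mderiv_comp_of_eq E (F →L[ℝ] ℝ) ℝ rfl
      (ContinuousLinearMap.differentiableAt _).mdifferentiableAt
      ((contMDiff_momentumMap μ).mdifferentiableAt (by simp))
  have h2 : mderiv (F →L[ℝ] ℝ) ℝ (ContinuousLinearMap.apply ℝ ℝ X) (momentumMap μ x) =
      ContinuousLinearMap.apply ℝ ℝ X := by
    refine Eq.trans mfderiv_eq_fderiv ?_
    exact ContinuousLinearMap.fderiv _
  rw [h2] at h1
  exact (DFunLike.congr_fun h1 u).symm

variable [MulAction G M] [IsManifold 𝓘(ℝ, E) ∞ M] {J : ComplexStructure E M} {g : HermitianMetric J}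
  {θ : ∀ x : M, TangentSpace 𝓘(ℝ, E) x →L[ℝ] ℝ} {μ}

/-- The Hamiltonian condition solved for the ordinary differential. The second term is the twist; it
vanishes on the zero level. -/
theorem IsMomentumMap.dmu_eq (hμ : IsMomentumMap μ g θ) (x : M) (u : E) (X : F) :
    dmu μ x u X = bilinAt g.inner x (endAt J.toFun x (fundAt E F G x X)) u
      + momentumMap μ x X * covAt θ x u := by
  have h1 := DFunLike.congr_fun (hμ.hamiltonian X x) u
  have h2 : bilinAt g.inner x (endAt J.toFun x (fundAt E F G x X)) u =
      dmu μ x u X - momentumMap μ x X * covAt θ x u := by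
    rw [dmu_apply]
    exact h1
  rw [h2]
  ring

theorem IsMomentumMap.dmu_eq_of_mem (hμ : IsMomentumMap μ g θ) {x : M} (hx : x ∈ zeroLevel μ)
    (u : E) (X : F) :
    dmu μ x u X = bilinAt g.inner x (endAt J.toFun x (fundAt E F G x X)) u := by
  have h0 : momentumMap μ x = 0 := hx
  rw [hμ.dmu_eq, h0]
  simp

/-- Nondegeneracy of `Ω` identifies `♯ d^θ μ^X` with the fundamental field of `X`, so the twisted
Poisson bracket is `Ω` on fundamental fields. -/
theorem IsMomentumMap.lie_eq (hμ : IsMomentumMap μ g θ) (x : M)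
    (X Y : GroupLieAlgebra 𝓘(ℝ, F) G) :
    momentumMap μ x (⁅X, Y⁆ : GroupLieAlgebra 𝓘(ℝ, F) G) =
      bilinAt g.inner x (endAt J.toFun x (fundAt E F G x X)) (fundAt E F G x Y) := by
  have hs : ∀ X : GroupLieAlgebra 𝓘(ℝ, F) G,
      sharp g x (twistedDiff θ (μ X) x) = fundamentalField X x := by
    intro X
    rw [← hμ.hamiltonian X x]
    exact Function.leftInverse_invFun (flat_injective g x) _
  have h := hμ.map_lie X Y x
  rw [twistedPoisson, hs, hs] at h
  exact h

variable (F G) in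
/-- The Lie bracket, as a bilinear map on the model space. -/
def bracketBilin [LieGroup 𝓘(ℝ, F) ∞ G] : F →L[ℝ] F →L[ℝ] F :=
  haveI : LieGroup 𝓘(ℝ, F) (minSmoothness ℝ 3) G :=
    LieGroup.of_le (n := ∞) (by simpa using ENat.LEInfty.out)
  LinearMap.toContinuousBilinearMap (𝕜 := ℝ) (E := F) (F := F) (G := F)
    (LinearMap.mk₂ ℝ (M := GroupLieAlgebra 𝓘(ℝ, F) G) (Nₗ := GroupLieAlgebra 𝓘(ℝ, F) G)
      (Pₗ := GroupLieAlgebra 𝓘(ℝ, F) G) (fun X Y => ⁅X, Y⁆)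
      add_lie smul_lie lie_add lie_smul)

variable [LieGroup 𝓘(ℝ, F) ∞ G] [ContMDiffSMul 𝓘(ℝ, F) 𝓘(ℝ, E) ∞ G M]

/-- The zero level of the momentum map is invariant under elements close to `1`. -/
theorem IsMomentumMap.eventually_smul_mem (hμ : IsMomentumMap μ g θ) (hθ : IsLeeForm g θ)
    {x : M} (hx : x ∈ zeroLevel μ) : ∀ᶠ a in 𝓝 (0 : F), groupParam F G a • x ∈ zeroLevel μ := by
  have hp := isParam_groupParam (F := F) (G := G)
  have h0 := (groupParam F G).open_source.mem_nhds zero_mem_groupParam_source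
  let φ : F → M := fun a => groupParam F G a • x
  have hφ : ∀ a ∈ (groupParam F G).source, ContMDiffAt 𝓘(ℝ, F) 𝓘(ℝ, E) ∞ φ a := fun a ha =>
    (contMDiff_orbit x).contMDiffAt.comp a (hp.contMDiffAt ha)
  have hφ' : ∀ᶠ y in 𝓝 (0 : F), MDifferentiableAt 𝓘(ℝ, F) 𝓘(ℝ, E) φ y := by
    filter_upwards [h0] with y hy
    exact (hφ y hy).mdifferentiableAt (by simp)
  have hcov : ContinuousAt (pullCov θ φ) 0 :=
    (contDiffAt_pullCov hθ.smooth (hφ 0 zero_mem_groupParam_source) hφ').continuousAt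
  let ψ : F → F →L[ℝ] ℝ := fun a => momentumMap μ (φ a)
  have hψ : ∀ a ∈ (groupParam F G).source, DifferentiableAt ℝ ψ a := fun a ha =>
    (((contMDiff_momentumMap μ).contMDiffAt.comp a (hφ a ha)).contDiffAt).differentiableAt (by simp)
  -- The derivative of `ψ` is linear in `ψ` itself: `Ω` of two fundamental fields is `μ` of a
  -- bracket, and the twist is a multiple of `μ`.
  have hder : ∀ a ∈ (groupParam F G).source, ∀ v Y : F, fderiv ℝ ψ a v Y =
      ψ a (bracketBilin F G Y (mcForm G a v)) + ψ a Y * pullCov θ φ a v := by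
    intro a ha v Y
    have h1 : fderiv ℝ ψ a = (dmu μ (φ a)).comp (tderiv E φ a) := by
      rw [← mfderiv_eq_fderiv]
      exact mderiv_comp_of_eq F E (F →L[ℝ] ℝ) rfl
        ((contMDiff_momentumMap μ).mdifferentiableAt (by simp))
        ((hφ a ha).mdifferentiableAt (by simp))
    have h2 : tderiv E φ a v = fundAt E F G (φ a) (mcForm G a v) :=
      DFunLike.congr_fun (tderiv_orbit ha x) v
    rw [h1, ContinuousLinearMap.comp_apply, hμ.dmu_eq]
    refine congrArg₂ (· + ·) ?_ rfl
    rw [h2]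
    exact (hμ.lie_eq (φ a) Y (mcForm G a v)).symm
  -- A bound for the coefficients of this linear equation, valid on a ball where `mcForm` and the
  -- pulled back Lee form exceed their norms at `0` by less than `1`.
  let K : ℝ := ‖bracketBilin F G‖ * (‖mcForm G (0 : F)‖ + 1) + (‖pullCov θ φ 0‖ + 1)
  have hbd : ∀ᶠ a in 𝓝 (0 : F), a ∈ (groupParam F G).source ∧
      ‖mcForm G a‖ < ‖mcForm G (0 : F)‖ + 1 ∧ ‖pullCov θ φ a‖ < ‖pullCov θ φ 0‖ + 1 :=
    (Filter.eventually_mem_set.mpr h0).and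
      (((continuousAt_mcForm.norm).eventually (gt_mem_nhds (lt_add_one _))).and
        ((hcov.norm).eventually (gt_mem_nhds (lt_add_one _))))
  obtain ⟨r, hr, hball⟩ := Metric.eventually_nhds_iff_ball.mp hbd
  refine Metric.eventually_nhds_iff_ball.mpr ⟨r, hr, fun a ha => ?_⟩
  have hseg : ∀ t ∈ Set.Icc (0 : ℝ) 1, t • a ∈ Metric.ball (0 : F) r := by
    intro t ht
    rw [mem_ball_zero_iff, norm_smul, Real.norm_eq_abs, abs_of_nonneg ht.1]
    rw [mem_ball_zero_iff] at ha
    exact (mul_le_of_le_one_left (norm_nonneg a) ht.2).trans_lt ha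
  have hd : ∀ t ∈ Set.Icc (0 : ℝ) 1,
      HasDerivAt (fun t : ℝ => ψ (t • a)) (fderiv ℝ ψ (t • a) a) t := by
    intro t ht
    have h1 : HasDerivAt (fun t : ℝ => t • a) a t := by
      simpa using (hasDerivAt_id t).smul_const a
    exact (hψ _ (hball _ (hseg t ht)).1).hasFDerivAt.comp_hasDerivAt t h1
  -- Gronwall along the segment from `0` to `a`, on which `ψ` starts at `μ(x) = 0`.
  have hzero := eq_zero_of_abs_deriv_le_mul_abs_self_of_eq_zero_right
    (f := fun t : ℝ => ψ (t • a)) (f' := fun t => fderiv ℝ ψ (t • a) a) (K := K * ‖a‖) (a := 0)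
    (b := 1) (fun t ht => (hd t ht).continuousAt.continuousWithinAt)
    (fun t ht => (hd t (Set.Ico_subset_Icc_self ht)).hasDerivWithinAt) (by
      change momentumMap μ (groupParam F G ((0 : ℝ) • a) • x) = 0
      rw [zero_smul, groupParam_zero, one_smul]
      exact hx) (by
      intro t ht
      obtain ⟨hs, h1, h2⟩ := hball _ (hseg t (Set.Ico_subset_Icc_self ht))
      have hK : 0 ≤ K * ‖a‖ * ‖ψ (t • a)‖ := by positivity
      refine ContinuousLinearMap.opNorm_le_bound _ hK fun Y => ?_
      rw [hder _ hs]
      have e1 : ‖ψ (t • a) (bracketBilin F G Y (mcForm G (t • a) a))‖ ≤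
          ‖ψ (t • a)‖ * (‖bracketBilin F G‖ * ‖Y‖ * ((‖mcForm G (0 : F)‖ + 1) * ‖a‖)) := by
        refine ((ψ (t • a)).le_opNorm _).trans ?_
        gcongr
        refine ((bracketBilin F G).le_opNorm₂ _ _).trans ?_
        gcongr
        refine ((mcForm G (t • a)).le_opNorm _).trans ?_
        gcongr
      have e2 : ‖ψ (t • a) Y * pullCov θ φ (t • a) a‖ ≤
          ‖ψ (t • a)‖ * ‖Y‖ * ((‖pullCov θ φ 0‖ + 1) * ‖a‖) := by
        rw [norm_mul]
        gcongr
        · exact (ψ (t • a)).le_opNorm Y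
        · refine ((pullCov θ φ (t • a)).le_opNorm _).trans ?_
          gcongr
      refine (norm_add_le _ _).trans ((add_le_add e1 e2).trans (le_of_eq ?_))
      simp only [K]
      ring)
  have h1 := hzero 1 (by simp)
  simp only [one_smul] at h1
  exact h1

/-- The zero level of the momentum map is invariant. -/
theorem IsMomentumMap.smul_mem [ConnectedSpace G] (hμ : IsMomentumMap μ g θ)
    (hθ : IsLeeForm g θ) (h : G) {x : M} (hx : x ∈ zeroLevel μ) : h • x ∈ zeroLevel μ := by
  have : IsTopologicalGroup G := topologicalGroup_of_lieGroup 𝓘(ℝ, F) ∞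
  let S : Set G := {k | k • x ∈ zeroLevel μ}
  have hcl : IsClosed S := (isClosed_zeroLevel μ).preimage (contMDiff_orbit (E := E) (F := F) x).continuous
  have hop : IsOpen S := by
    rw [isOpen_iff_mem_nhds]
    intro k hk
    have h1 := hμ.eventually_smul_mem hθ hk
    have h2 : ∀ᶠ l in 𝓝 (1 : G), l • k • x ∈ zeroLevel μ := by
      have h3 : ContinuousAt (groupParam F G).symm 1 := by
        refine (groupParam F G).continuousAt_symm ?_
        rw [← groupParam_zero (F := F)]
        exact (groupParam F G).map_source zero_mem_groupParam_source
      have h4 : (groupParam F G).symm 1 = 0 := by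
        rw [← groupParam_zero (F := F)]
        exact (groupParam F G).left_inv zero_mem_groupParam_source
      have h5 : (groupParam F G).target ∈ 𝓝 (1 : G) := by
        refine (groupParam F G).open_target.mem_nhds ?_
        rw [← groupParam_zero (F := F)]
        exact (groupParam F G).map_source zero_mem_groupParam_source
      rw [← h4] at h1
      filter_upwards [h3.eventually h1, h5] with l hl hl'
      rwa [(groupParam F G).right_inv hl'] at hl
    -- The local statement at the point `k • x` gives a neighbourhood of `1`, which right
    -- translation moves to `k`.
    have h3 : Filter.Tendsto (fun l : G => l * k⁻¹) (𝓝 k) (𝓝 1) := by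
      have : ContinuousAt (fun l : G => l * k⁻¹) k := by fun_prop
      simpa [ContinuousAt] using this
    filter_upwards [h3.eventually h2] with l hl
    rwa [smul_smul, inv_mul_cancel_right] at hl
  have huniv : S = Set.univ := IsClopen.eq_univ ⟨hcl, hop⟩ ⟨1, by simpa [S] using hx⟩
  have hS : h ∈ S := by rw [huniv]; exact Set.mem_univ h
  exact hS

end Momentum


/-! ### Splittings adapted to an isotropic subspace -/

section LinearAlgebra

variable {E F B C : Type*} [NormedAddCommGroup E] [NormedSpace ℝ E] [FiniteDimensional ℝ E]
  [NormedAddCommGroup F] [NormedSpace ℝ F] [FiniteDimensional ℝ F]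
  [NormedAddCommGroup B] [NormedSpace ℝ B] [FiniteDimensional ℝ B]
  [NormedAddCommGroup C] [NormedSpace ℝ C] [FiniteDimensional ℝ C]

/-- A splitting of `E` adapted to an injection `v : F → E` and a surjection `D : E → C` with
`D ∘ v = 0`. -/
theorem exists_splitting {v : F →L[ℝ] E} {D : E →L[ℝ] C} (hv : Function.Injective v)
    (hD : Function.Surjective D) (hDv : ∀ f, D (v f) = 0)
    (hFC : Module.finrank ℝ C = Module.finrank ℝ F)
    (hB : Module.finrank ℝ B = Module.finrank ℝ E - 2 * Module.finrank ℝ F) :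
    Module.finrank ℝ ((F × B) × C) = Module.finrank ℝ E ∧
    ∃ l : (F × B) × C →L[ℝ] E, Function.Injective l ∧ (∀ f, l ((f, 0), 0) = v f) ∧
      ∀ w, D (l w) = w.2 := by
  have hrk := LinearMap.finrank_range_add_finrank_ker (D : E →ₗ[ℝ] C)
  rw [LinearMap.range_eq_top.mpr hD, finrank_top] at hrk
  let K := LinearMap.ker (D : E →ₗ[ℝ] C)
  let v' : F →ₗ[ℝ] K := LinearMap.codRestrict K (v : F →ₗ[ℝ] E) hDv
  have hv' : Function.Injective v' := fun a b h => hv (congrArg Subtype.val h)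
  have hle := LinearMap.finrank_le_finrank_of_injective hv'
  have hrange : Module.finrank ℝ (LinearMap.range v') = Module.finrank ℝ F :=
    LinearMap.finrank_range_of_inj hv'
  -- The transversal directions are a complement, within the kernel of `D`, of the image of `v`. The
  -- injection of `F` into this kernel also shows that the subtraction in `hB` is not truncated.
  obtain ⟨Q, hQ⟩ := Submodule.exists_isCompl (LinearMap.range v')
  have hQd := Submodule.finrank_add_eq_of_isCompl hQ
  have hBQ : Module.finrank ℝ B = Module.finrank ℝ Q := by
    change Module.finrank ℝ C + Module.finrank ℝ K = _ at hrk
    omega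
  let e : B ≃ₗ[ℝ] Q := LinearEquiv.ofFinrankEq B Q hBQ
  obtain ⟨s, hs⟩ := LinearMap.exists_rightInverse_of_surjective (D : E →ₗ[ℝ] C)
    (LinearMap.range_eq_top.mpr hD)
  let ι : B →ₗ[ℝ] E := K.subtype ∘ₗ Q.subtype ∘ₗ e.toLinearMap
  have hDι : ∀ q, D (ι q) = 0 := fun q => (e q : K).2
  have hDs : ∀ c, D (s c) = c := fun c => DFunLike.congr_fun hs c
  let l : (F × B) × C →ₗ[ℝ] E := ((v : F →ₗ[ℝ] E).coprod ι).coprod s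
  have hl : ∀ w, l w = v w.1.1 + ι w.1.2 + s w.2 := fun w => rfl
  refine ⟨?_, LinearMap.toContinuousLinearMap l, ?_, ?_, ?_⟩
  · simp only [Module.finrank_prod]
    change Module.finrank ℝ C + Module.finrank ℝ K = _ at hrk
    omega
  · change Function.Injective l
    rw [injective_iff_map_eq_zero]
    rintro ⟨⟨f, q⟩, c⟩ h
    rw [hl] at h
    have hc : c = 0 := by
      have := congrArg D h
      simpa [hDv, hDι, hDs] using this
    subst hc
    rw [map_zero, add_zero] at h
    have h1 : v' f = -(e q : K) := by
      apply Subtype.ext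
      exact eq_neg_of_add_eq_zero_left h
    have h2 : v' f ∈ LinearMap.range v' ⊓ Q :=
      ⟨⟨f, rfl⟩, by rw [h1]; exact Q.neg_mem (e q).2⟩
    rw [hQ.inf_eq_bot, Submodule.mem_bot] at h2
    have hf : f = 0 := hv' (h2.trans (map_zero v').symm)
    have hq : e q = 0 := by
      apply Subtype.ext
      have h3 : (e q : K) = -v' f := by rw [h1, neg_neg]
      rw [h3, h2, neg_zero]
      rfl
    have hq' : q = 0 := e.injective (hq.trans (map_zero e).symm)
    rw [hf, hq']
    rfl
  · intro f
    change l ((f, 0), 0) = v f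
    simp [hl]
  · intro w
    change D (l w) = w.2
    rw [hl, map_add, map_add, hDv, hDι, hDs]
    simp

theorem isInvertible_of_injective {l : F →L[ℝ] E} (hl : Function.Injective l)
    (hd : Module.finrank ℝ F = Module.finrank ℝ E) : l.IsInvertible :=
  ⟨(LinearEquiv.ofInjectiveOfFinrankEq (l : F →ₗ[ℝ] E) hl hd).toContinuousLinearEquiv, by
    ext; rfl⟩

theorem isInvertible_of_surjective {l : F →L[ℝ] E} (hl : Function.Surjective l)
    (hd : Module.finrank ℝ F = Module.finrank ℝ E) : l.IsInvertible :=
  isInvertible_of_injective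
    ((LinearMap.injective_iff_surjective_of_finrank_eq_finrank (f := (l : F →ₗ[ℝ] E)) hd).mpr hl) hd

end LinearAlgebra

/-! ### Local sections of the momentum map -/

section Section

variable {E : Type*} [NormedAddCommGroup E] [NormedSpace ℝ E]
  {M : Type*} [TopologicalSpace M] [ChartedSpace E M]
  {F : Type*} [NormedAddCommGroup F] [NormedSpace ℝ F] [FiniteDimensional ℝ F]
  {G : Type*} [TopologicalSpace G] [ChartedSpace F G] [Group G]
  {μ : GroupLieAlgebra 𝓘(ℝ, F) G →ₗ[ℝ] C^∞⟮𝓘(ℝ, E), M; 𝓘(ℝ, ℝ), ℝ⟯}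
  [IsManifold 𝓘(ℝ, E) ∞ M]
  {B : Type*} [NormedAddCommGroup B] [NormedSpace ℝ B]

/-- A local section of the momentum map in prescribed directions. -/
theorem exists_section [FiniteDimensional ℝ B] [FiniteDimensional ℝ E] {x₀ : M}
    (hx₀ : x₀ ∈ zeroLevel μ) (l : (F × B) × (F →L[ℝ] ℝ) →L[ℝ] E)
    (hl : ∀ w, dmu μ x₀ (l w) = w.2) :
    ∃ (O : Set (B × (F →L[ℝ] ℝ))) (s : B × (F →L[ℝ] ℝ) → M), IsOpen O ∧ 0 ∈ O ∧
      ContMDiffOn 𝓘(ℝ, B × (F →L[ℝ] ℝ)) 𝓘(ℝ, E) ∞ s O ∧ s 0 = x₀ ∧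
      (∀ p ∈ O, momentumMap μ (s p) = p.2) ∧ ∀ p, tderiv E s 0 p = l ((0, p.1), p.2) := by
  let c := chartAt E x₀
  have hc : IsParam E c.symm := isParam_chartAt_symm x₀
  have hy₀ : c x₀ ∈ c.symm.source := c.map_source (mem_chart_source E x₀)
  have hc0 : c.symm (c x₀) = x₀ := c.left_inv (mem_chart_source E x₀)
  let L : (F × B) × (F →L[ℝ] ℝ) →L[ℝ] E := (tderiv E c.symm (c x₀)).inverse.comp l
  -- An affine map in the chart, chosen so that the resulting map to `M` has derivative `l` at `0`.
  let a : (F × B) × (F →L[ℝ] ℝ) → E := fun w => c x₀ + L w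
  have ha : ContDiff ℝ ∞ a := contDiff_const.add L.contDiff
  have ha0 : a 0 = c x₀ := by simp [a]
  have had : ∀ w, HasFDerivAt a L w := fun w => L.hasFDerivAt.const_add _
  let P : (F × B) × (F →L[ℝ] ℝ) → M := fun w => c.symm (a w)
  let O₀ : Set ((F × B) × (F →L[ℝ] ℝ)) := a ⁻¹' c.target
  have hO₀ : IsOpen O₀ := c.open_target.preimage ha.continuous
  have h0O₀ : 0 ∈ O₀ := by
    change a 0 ∈ c.target
    rw [ha0]; exact hy₀
  have hP : ContMDiffOn 𝓘(ℝ, (F × B) × (F →L[ℝ] ℝ)) 𝓘(ℝ, E) ∞ P O₀ :=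
    hc.smooth.comp ha.contMDiff.contMDiffOn fun w hw => hw
  have hP0 : P 0 = x₀ := by simp only [P, ha0, hc0]
  have hPd : tderiv E P 0 = l := by
    have h1 : tderiv E P 0 = (tderiv E c.symm (a 0)).comp (fderiv ℝ a 0) := tderiv_comp
      ((hc.contMDiffAt (by rw [ha0]; exact hy₀)).mdifferentiableAt (by simp))
      (had 0).differentiableAt
    rw [h1, (had 0).fderiv, ha0]
    exact ContinuousLinearMap.ext fun w => hc.apply_inverse hy₀ (l w)
  let m : (F × B) × (F →L[ℝ] ℝ) → (F →L[ℝ] ℝ) := fun w => momentumMap μ (P w)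
  have hm : ContDiffOn ℝ ∞ m O₀ := by
    rw [← contMDiffOn_iff_contDiffOn]
    exact (contMDiff_momentumMap μ).comp_contMDiffOn hP
  have hmd : HasFDerivAt m (ContinuousLinearMap.snd ℝ (F × B) (F →L[ℝ] ℝ)) 0 := by
    have h1 : fderiv ℝ m 0 = (dmu μ x₀).comp (tderiv E P 0) := by
      rw [← mfderiv_eq_fderiv]
      exact mderiv_comp_of_eq _ E (F →L[ℝ] ℝ) hP0
        ((contMDiff_momentumMap μ).mdifferentiableAt (by simp))
        ((hP.contMDiffAt (hO₀.mem_nhds h0O₀)).mdifferentiableAt (by simp))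
    have h2 : fderiv ℝ m 0 = ContinuousLinearMap.snd ℝ (F × B) (F →L[ℝ] ℝ) := by
      rw [h1, hPd]
      exact ContinuousLinearMap.ext fun w => hl w
    rw [← h2]
    exact ((hm.contDiffAt (hO₀.mem_nhds h0O₀)).differentiableAt (by simp)).hasFDerivAt
  -- The last coordinate is replaced by the momentum map. As `dμ (l w) = w.2`, the derivative at `0`
  -- is the identity, and inverting `Ψ` straightens `μ`.
  let Ψ : (F × B) × (F →L[ℝ] ℝ) → (F × B) × (F →L[ℝ] ℝ) := fun w => (w.1, m w)
  have hΨ : ContDiffOn ℝ ∞ Ψ O₀ := contDiff_fst.contDiffOn.prodMk hm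
  have hΨd : HasFDerivAt Ψ (ContinuousLinearMap.id ℝ ((F × B) × (F →L[ℝ] ℝ))) 0 :=
    (ContinuousLinearMap.hasFDerivAt (ContinuousLinearMap.fst ℝ (F × B) (F →L[ℝ] ℝ))).prodMk hmd
  have hΨt : tderiv ((F × B) × (F →L[ℝ] ℝ)) Ψ 0 = ContinuousLinearMap.id ℝ _ :=
    mfderiv_eq_fderiv.trans hΨd.fderiv
  have hΨ0 : Ψ 0 = 0 := by
    have : m 0 = 0 := by
      change momentumMap μ (P 0) = 0
      rw [hP0]; exact hx₀
    simp only [Ψ, this]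
    rfl
  obtain ⟨Q, hQ, hQΨ, h0Q, hQO⟩ := exists_isParam (E := (F × B) × (F →L[ℝ] ℝ)) hO₀ h0O₀
    hΨ.contMDiffOn (by
      rw [hΨt]
      exact ⟨ContinuousLinearEquiv.refl ℝ _, rfl⟩)
  have h0t : (0 : (F × B) × (F →L[ℝ] ℝ)) ∈ Q.target := by
    have := Q.map_source h0Q
    rwa [hQΨ, hΨ0] at this
  have hQs0 : Q.symm 0 = 0 := by
    have := Q.left_inv h0Q
    rwa [hQΨ, hΨ0] at this
  -- The section is the slice where the orbit coordinate is zero.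
  let ι : B × (F →L[ℝ] ℝ) →L[ℝ] (F × B) × (F →L[ℝ] ℝ) :=
    ((0 : B × (F →L[ℝ] ℝ) →L[ℝ] F).prod (ContinuousLinearMap.fst ℝ B (F →L[ℝ] ℝ))).prod
      (ContinuousLinearMap.snd ℝ B (F →L[ℝ] ℝ))
  have hι : ∀ p, ι p = ((0, p.1), p.2) := fun p => rfl
  have hQsm : ContDiffOn ℝ ∞ Q.symm Q.target := contMDiffOn_iff_contDiffOn.mp hQ.smooth_symm
  let O : Set (B × (F →L[ℝ] ℝ)) := ι ⁻¹' Q.target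
  have hO : IsOpen O := Q.open_target.preimage ι.continuous
  have h0O : (0 : B × (F →L[ℝ] ℝ)) ∈ O := by
    change ι 0 ∈ Q.target
    rw [map_zero]; exact h0t
  have hQι : ContDiffOn ℝ ∞ (fun p => Q.symm (ι p)) O :=
    hQsm.comp ι.contDiff.contDiffOn fun p hp => hp
  refine ⟨O, fun p => P (Q.symm (ι p)), hO, h0O, ?_, ?_, ?_, ?_⟩
  · exact hP.comp hQι.contMDiffOn fun p hp => hQO (Q.map_target hp)
  · simp only [map_zero, hQs0, hP0]
  · intro p hp
    have h1 : Ψ (Q.symm (ι p)) = ι p := by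
      rw [← hQΨ]
      exact Q.right_inv hp
    exact congrArg Prod.snd h1
  · intro p
    have h1 : tderiv E (fun p => P (Q.symm (ι p))) 0 =
        (tderiv E P (Q.symm (ι 0))).comp (fderiv ℝ (fun p => Q.symm (ι p)) 0) := tderiv_comp
      (by
        rw [map_zero, hQs0]
        exact (hP.contMDiffAt (hO₀.mem_nhds h0O₀)).mdifferentiableAt (by simp))
      ((hQι.contDiffAt (hO.mem_nhds h0O)).differentiableAt (by simp))
    have h2 : fderiv ℝ Q.symm 0 = ContinuousLinearMap.id ℝ _ := by
      have h3 := hQ.symmDeriv_comp h0Q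
      rw [hQΨ, hΨt, ContinuousLinearMap.comp_id] at h3
      have h4 : symmDeriv ((F × B) × (F →L[ℝ] ℝ)) Q 0 = fderiv ℝ Q.symm (Q 0) := mfderiv_eq_fderiv
      rw [h4, hQΨ, hΨ0] at h3
      exact h3
    have h5 : fderiv ℝ (fun p => Q.symm (ι p)) 0 = ι := by
      have h6 : DifferentiableAt ℝ Q.symm (ι 0) := by
        rw [map_zero]
        exact (hQsm.contDiffAt (Q.open_target.mem_nhds h0t)).differentiableAt (by simp)
      have h7 := (h6.hasFDerivAt.comp (0 : B × (F →L[ℝ] ℝ)) ι.hasFDerivAt).fderiv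
      rw [map_zero, h2, ContinuousLinearMap.id_comp] at h7
      exact h7
    rw [h1, h5, map_zero, hQs0, hPd]
    rfl

end Section

/-! ### Slices: charts adapted to the zero level and its orbits -/

section Slice

variable {E : Type*} [NormedAddCommGroup E] [NormedSpace ℝ E]
  {M : Type*} [TopologicalSpace M] [ChartedSpace E M]
  {F : Type*} [NormedAddCommGroup F] [NormedSpace ℝ F] [FiniteDimensional ℝ F]
  {G : Type*} [TopologicalSpace G] [ChartedSpace F G] [Group G] [MulAction G M]

/-- A chart of `M` around a point of the zero level, adapted to the zero level and to the orbits
in it. -/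
structure Slice (μ : GroupLieAlgebra 𝓘(ℝ, F) G →ₗ[ℝ] C^∞⟮𝓘(ℝ, E), M; 𝓘(ℝ, ℝ), ℝ⟯)
    (B : Type*) [NormedAddCommGroup B] [NormedSpace ℝ B] (x₀ : M) where
  /-- The parametrization. -/
  Φ : OpenPartialHomeomorph ((F × B) × (F →L[ℝ] ℝ)) M
  isParam : IsParam E Φ
  /-- The domain of the coordinates along the orbits. -/
  A : Set F
  /-- The domain of the coordinates transversal to the orbits in the zero level. -/
  U : Set B
  /-- The domain of the coordinates transversal to the zero level. -/
  W : Set (F →L[ℝ] ℝ)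
  source_eq : Φ.source = (A ×ˢ U) ×ˢ W
  zero_mem : 0 ∈ Φ.source
  apply_zero : Φ 0 = x₀
  mem_iff : ∀ w ∈ Φ.source, Φ w ∈ zeroLevel μ ↔ w.2 = 0
  orbit_iff : ∀ w ∈ Φ.source, ∀ w' ∈ Φ.source, w.2 = 0 → w'.2 = 0 →
    ((∃ h : G, h • Φ w = Φ w') ↔ w.1.2 = w'.1.2)
  vert : ∀ w ∈ Φ.source, ∀ v, (∃ X : F, fundAt E F G (Φ w) X = tderiv E Φ w v) ↔
    v.1.2 = 0 ∧ v.2 = 0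

/-- Elements of the group moving points close to `x₀` to points close to `x₀` are close to `1`. -/
theorem eventually_mem_of_smul_eq
    {μ : GroupLieAlgebra 𝓘(ℝ, F) G →ₗ[ℝ] C^∞⟮𝓘(ℝ, E), M; 𝓘(ℝ, ℝ), ℝ⟯}
    (hfree : FreeOnZeroLevel μ) (hproper : ProperOnZeroLevel μ) {x₀ : M}
    {N : Set G} (hN : N ∈ 𝓝 1) :
    ∀ᶠ p : M × M in 𝓝 (x₀, x₀), p.2 ∈ zeroLevel μ → ∀ h : G, h • p.2 = p.1 → h ∈ N := by
  -- By properness the pairs related by an element outside the interior of `N` form a closed set. By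
  -- freeness it misses `(x₀, x₀)`, hence a neighbourhood of that point.
  let T : Set (G × zeroLevel μ) := (interior N)ᶜ ×ˢ Set.univ
  have hT : IsClosed T := isOpen_interior.isClosed_compl.prod isClosed_univ
  have hK := hproper.isClosedMap T hT
  have hmem : (x₀, x₀) ∉ (fun p : G × zeroLevel μ => ((p.1 • (p.2 : M), (p.2 : M)) : M × M)) '' T := by
    rintro ⟨⟨h, z⟩, hz, heq⟩
    have h2 : (z : M) = x₀ := congrArg Prod.snd heq
    have h1 : h • (z : M) = x₀ := congrArg Prod.fst heq
    have h3 : h = 1 := hfree z z.2 h (h1.trans h2.symm)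
    exact hz.1 (h3 ▸ mem_interior_iff_mem_nhds.mpr hN)
  filter_upwards [hK.isOpen_compl.mem_nhds hmem] with p hp hp2 h hh
  by_contra hhN
  exact hp ⟨(h, ⟨p.2, hp2⟩), ⟨fun h' => hhN (interior_subset h'), Set.mem_univ _⟩,
    Prod.ext hh rfl⟩

variable {μ : GroupLieAlgebra 𝓘(ℝ, F) G →ₗ[ℝ] C^∞⟮𝓘(ℝ, E), M; 𝓘(ℝ, ℝ), ℝ⟯}
  [IsManifold 𝓘(ℝ, E) ∞ M] {J : ComplexStructure E M} {g : HermitianMetric J}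
  {θ : ∀ x : M, TangentSpace 𝓘(ℝ, E) x →L[ℝ] ℝ}
  {B : Type*} [NormedAddCommGroup B] [NormedSpace ℝ B]

/-- On the level the infinitesimal action is, through `Ω`, the transpose of `dμ`, which is onto. If
`X` acts trivially, every covector of the Lie algebra vanishes on `X`. -/
theorem IsMomentumMap.fundAt_injective (hμ : IsMomentumMap μ g θ) (hreg : ZeroIsRegularValue μ)
    {x : M} (hx : x ∈ zeroLevel μ) : Function.Injective (fundAt E F G x) := by
  rw [injective_iff_map_eq_zero]
  intro X hX
  have h1 : ∀ c : F →L[ℝ] ℝ, c X = 0 := by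
    intro c
    have hsurj : Function.Surjective (dmu μ x) := hreg x hx
    obtain ⟨u, hu⟩ := hsurj c
    rw [← hu, hμ.dmu_eq_of_mem hx, hX]
    simp
  by_contra hne
  obtain ⟨c, hc⟩ := SeparatingDual.exists_ne_zero (R := ℝ) hne
  exact hc (h1 c)

/-- The orbit directions are isotropic: `Ω(Y, X) = μ^{[Y,X]}` vanishes on the zero level. -/
theorem IsMomentumMap.dmu_fundAt (hμ : IsMomentumMap μ g θ)
    {x : M} (hx : x ∈ zeroLevel μ) (X : F) : dmu μ x (fundAt E F G x X) = 0 := by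
  have h0 : momentumMap μ x = 0 := hx
  refine ContinuousLinearMap.ext fun Y => ?_
  rw [hμ.dmu_eq_of_mem hx]
  have := hμ.lie_eq x Y X
  rw [h0] at this
  exact this.symm

variable [LieGroup 𝓘(ℝ, F) ∞ G] [ContMDiffSMul 𝓘(ℝ, F) 𝓘(ℝ, E) ∞ G M]

/-- A parametrization around a point of the zero level which is equivariant for the local group
and adapted to the zero level. -/
theorem exists_equivariant_param [ConnectedSpace G] [FiniteDimensional ℝ B] [FiniteDimensional ℝ E]
    (hμ : IsMomentumMap μ g θ) (hθ : IsLeeForm g θ) (hreg : ZeroIsRegularValue μ)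
    (hB : Module.finrank ℝ B = Module.finrank ℝ E - 2 * Module.finrank ℝ F)
    {x₀ : M} (hx₀ : x₀ ∈ zeroLevel μ) :
    ∃ Q : OpenPartialHomeomorph ((F × B) × (F →L[ℝ] ℝ)) M, IsParam E Q ∧
      (∀ w, Q w = groupParam F G w.1.1 • Q ((0, w.1.2), w.2)) ∧ 0 ∈ Q.source ∧ Q 0 = x₀ ∧
      (∀ w ∈ Q.source, w.1.1 ∈ (groupParam F G).source) ∧
      (∀ w ∈ Q.source, Q w ∈ zeroLevel μ ↔ w.2 = 0) ∧
      ∀ w ∈ Q.source, ∀ f : F, tderiv E Q w ((f, 0), 0) =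
        fundAt E F G (Q w) (mcForm G w.1.1 f) := by
  have hFC : Module.finrank ℝ (F →L[ℝ] ℝ) = Module.finrank ℝ F := by
    rw [← (LinearMap.toContinuousLinearMap (𝕜 := ℝ) (E := F) (F' := ℝ)).finrank_eq]
    exact Subspace.dual_finrank_eq (K := ℝ) (V := F)
  have hD : Function.Surjective (dmu μ x₀) := hreg x₀ hx₀
  obtain ⟨hdim, l, hlinj, hlF, hlD⟩ := exists_splitting (B := B) (hμ.fundAt_injective hreg hx₀)
    hD (hμ.dmu_fundAt hx₀) hFC hB
  obtain ⟨O, s, hO, h0O, hs, hs0, hsμ, hsd⟩ := exists_section hx₀ l hlD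
  have hp := isParam_groupParam (F := F) (G := G)
  let φ : (F × B) × (F →L[ℝ] ℝ) → M := fun w => groupParam F G w.1.1 • s (w.1.2, w.2)
  have hpF : ContDiff ℝ ∞ fun w : (F × B) × (F →L[ℝ] ℝ) => w.1.1 := contDiff_fst.fst
  have hpB : ContDiff ℝ ∞ fun w : (F × B) × (F →L[ℝ] ℝ) => (w.1.2, w.2) :=
    contDiff_fst.snd.prodMk contDiff_snd
  let O₁ : Set ((F × B) × (F →L[ℝ] ℝ)) :=
    {w | w.1.1 ∈ (groupParam F G).source ∧ (w.1.2, w.2) ∈ O}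
  have hO₁ : IsOpen O₁ := ((groupParam F G).open_source.preimage hpF.continuous).inter
    (hO.preimage hpB.continuous)
  have h0O₁ : 0 ∈ O₁ := ⟨zero_mem_groupParam_source, h0O⟩
  have hφ : ContMDiffOn 𝓘(ℝ, (F × B) × (F →L[ℝ] ℝ)) 𝓘(ℝ, E) ∞ φ O₁ := by
    have h1 : ContMDiffOn 𝓘(ℝ, (F × B) × (F →L[ℝ] ℝ)) 𝓘(ℝ, F) ∞
        (fun w => groupParam F G w.1.1) O₁ :=
      hp.smooth.comp hpF.contMDiff.contMDiffOn fun w hw => hw.1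
    have h2 : ContMDiffOn 𝓘(ℝ, (F × B) × (F →L[ℝ] ℝ)) 𝓘(ℝ, E) ∞ (fun w => s (w.1.2, w.2)) O₁ :=
      hs.comp hpB.contMDiff.contMDiffOn fun w hw => hw.2
    exact h1.smul h2
  have hφd : ∀ w ∈ O₁, MDifferentiableAt 𝓘(ℝ, (F × B) × (F →L[ℝ] ℝ)) 𝓘(ℝ, E) φ w := fun w hw =>
    (hφ.contMDiffAt (hO₁.mem_nhds hw)).mdifferentiableAt (by simp)
  have hvert : ∀ w ∈ O₁, ∀ f : F, tderiv E φ w ((f, 0), 0) =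
      fundAt E F G (φ w) (mcForm G w.1.1 f) := by
    intro w hw f
    have h1 := tderiv_orbit (E := E) hw.1 (s (w.1.2, w.2))
    have h2 : HasFDerivAt (fun b : F => (((b, w.1.2), w.2) : (F × B) × (F →L[ℝ] ℝ)))
        (vertIncl F B (F →L[ℝ] ℝ)) w.1.1 := by
      have h3 := (vertIncl F B (F →L[ℝ] ℝ)).hasFDerivAt (x := w.1.1) |>.add_const
        (((0, w.1.2), w.2) : (F × B) × (F →L[ℝ] ℝ))
      refine h3.congr_of_eventuallyEq (Filter.Eventually.of_forall fun b => ?_)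
      simp
    have h4 : tderiv E (fun b : F => φ ((b, w.1.2), w.2)) w.1.1 =
        (tderiv E φ w).comp (fderiv ℝ _ w.1.1) :=
      tderiv_comp (f := fun b : F => (((b, w.1.2), w.2) : (F × B) × (F →L[ℝ] ℝ))) (y := w.1.1)
        (hφd w hw) h2.differentiableAt
    rw [h2.fderiv] at h4
    exact (DFunLike.congr_fun (h4.symm.trans h1) f)
  have hφ0 : φ 0 = x₀ := by
    change groupParam F G 0 • s 0 = x₀
    rw [groupParam_zero, one_smul, hs0]
  -- The derivative at `0` is `l` preceded by the Maurer–Cartan form on `F`. Both are onto, so the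
  -- inverse function theorem applies.
  have hder : ∀ v, tderiv E φ 0 v = l ((mcForm G 0 v.1.1, v.1.2), v.2) := by
    rintro ⟨⟨f, q⟩, b⟩
    have h1 := hvert 0 h0O₁ f
    rw [hφ0, ← hlF] at h1
    let ι : B × (F →L[ℝ] ℝ) →L[ℝ] (F × B) × (F →L[ℝ] ℝ) :=
      ((0 : B × (F →L[ℝ] ℝ) →L[ℝ] F).prod (ContinuousLinearMap.fst ℝ B (F →L[ℝ] ℝ))).prod
        (ContinuousLinearMap.snd ℝ B (F →L[ℝ] ℝ))
    have h2 : tderiv E (fun p => φ (ι p)) 0 = (tderiv E φ (ι 0)).comp (fderiv ℝ ι 0) :=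
      tderiv_comp (by rw [map_zero]; exact hφd 0 h0O₁) ι.differentiableAt
    have h3 : (fun p => φ (ι p)) = s := by
      funext p
      change groupParam F G 0 • s p = s p
      rw [groupParam_zero, one_smul]
    rw [h3, map_zero, ContinuousLinearMap.fderiv] at h2
    have h4 : tderiv E φ 0 ((0, q), b) = l ((0, q), b) :=
      (DFunLike.congr_fun h2 (q, b)).symm.trans (hsd (q, b))
    have h5 : (((f, q), b) : (F × B) × (F →L[ℝ] ℝ)) = ((f, 0), 0) + ((0, q), b) := by simp
    rw [h5, map_add, h1, h4, ← map_add]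
    simp
  have hinv : (tderiv E φ 0).IsInvertible := by
    refine isInvertible_of_surjective (fun e => ?_) hdim
    obtain ⟨l', hl'⟩ := isInvertible_of_injective hlinj hdim
    obtain ⟨f, hf⟩ := mcForm_surjective (zero_mem_groupParam_source (F := F) (G := G))
      (l'.symm e).1.1
    refine ⟨((f, (l'.symm e).1.2), (l'.symm e).2), ?_⟩
    rw [hder, hf, ← hl']
    exact l'.apply_symm_apply e
  obtain ⟨Q, hQ, hQφ, h0Q, hQO⟩ := exists_isParam hO₁ h0O₁ hφ hinv
  have hmem : ∀ w ∈ Q.source, φ w ∈ zeroLevel μ ↔ w.2 = 0 := by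
    intro w hw
    -- The level is invariant, so membership may be tested on the section, where `μ` is the last
    -- coordinate.
    have h1 : φ w ∈ zeroLevel μ ↔ s (w.1.2, w.2) ∈ zeroLevel μ := by
      refine ⟨fun h => ?_, fun h => hμ.smul_mem hθ _ h⟩
      have := hμ.smul_mem hθ (groupParam F G w.1.1)⁻¹ h
      rwa [inv_smul_smul] at this
    rw [h1]
    change momentumMap μ _ = 0 ↔ _
    rw [hsμ _ (hQO hw).2]
  have hQ' : ∀ w, Q w = φ w := fun w => congrFun hQφ w
  refine ⟨Q, hQ, fun w => ?_, h0Q, (hQ' 0).trans hφ0, fun w hw => (hQO hw).1, fun w hw => ?_,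
    fun w hw f => ?_⟩
  · rw [hQ', hQ']
    change _ = groupParam F G w.1.1 • groupParam F G 0 • s (w.1.2, w.2)
    rw [groupParam_zero, one_smul]
  · rw [hQ']
    exact hmem w hw
  · rw [hQφ]
    exact hvert w (hQO hw) f

/-- Adapted charts exist around every point of the zero level. -/
theorem exists_slice [ConnectedSpace G] [FiniteDimensional ℝ B] [FiniteDimensional ℝ E]
    (hμ : IsMomentumMap μ g θ) (hθ : IsLeeForm g θ) (hreg : ZeroIsRegularValue μ)
    (hfree : FreeOnZeroLevel μ) (hproper : ProperOnZeroLevel μ)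
    (hB : Module.finrank ℝ B = Module.finrank ℝ E - 2 * Module.finrank ℝ F)
    {x₀ : M} (hx₀ : x₀ ∈ zeroLevel μ) : Nonempty (Slice μ B x₀) := by
  obtain ⟨Q, hQ, hQeq, h0Q, hQ0, hQsrc, hmem, hvert⟩ :=
    exists_equivariant_param (B := B) hμ hθ hreg hB hx₀
  obtain ⟨AU, W, hAU, hW, h0AU, h0W, hAUW⟩ :
      ∃ (AU : Set (F × B)) (W : Set (F →L[ℝ] ℝ)), IsOpen AU ∧ IsOpen W ∧ 0 ∈ AU ∧ 0 ∈ W ∧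
        AU ×ˢ W ⊆ Q.source := by
    obtain ⟨AU, hAU, W, hW, h⟩ := mem_nhds_prod_iff.mp (Q.open_source.mem_nhds h0Q)
    exact ⟨interior AU, interior W, isOpen_interior, isOpen_interior,
      mem_interior_iff_mem_nhds.mpr hAU, mem_interior_iff_mem_nhds.mpr hW,
      (Set.prod_mono interior_subset interior_subset).trans h⟩
  obtain ⟨A, U, hA, hU, h0A, h0U, hAU'⟩ :
      ∃ (A : Set F) (U : Set B), IsOpen A ∧ IsOpen U ∧ 0 ∈ A ∧ 0 ∈ U ∧ A ×ˢ U ⊆ AU := by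
    obtain ⟨A, hA, U, hU, h⟩ := mem_nhds_prod_iff.mp (hAU.mem_nhds h0AU)
    exact ⟨interior A, interior U, isOpen_interior, isOpen_interior,
      mem_interior_iff_mem_nhds.mpr hA, mem_interior_iff_mem_nhds.mpr hU,
      (Set.prod_mono interior_subset interior_subset).trans h⟩
  have hbox : (A ×ˢ U) ×ˢ W ⊆ Q.source := (Set.prod_mono hAU' subset_rfl).trans hAUW
  have hAsrc : A ⊆ (groupParam F G).source := fun a ha =>
    hQsrc _ (hbox (show ((a, (0 : B)), (0 : F →L[ℝ] ℝ)) ∈ (A ×ˢ U) ×ˢ W from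
      ⟨⟨ha, h0U⟩, h0W⟩))
  have hN : groupParam F G '' A ∈ 𝓝 (1 : G) := by
    have h1 := (groupParam F G).image_mem_nhds zero_mem_groupParam_source (hA.mem_nhds h0A)
    rwa [groupParam_zero] at h1
  let s : B → M := fun q => Q ((0, q), 0)
  have hs0 : s 0 = x₀ := hQ0
  have hcont : ContinuousAt s 0 := by
    have h1 : ContinuousAt Q (((0 : F), (0 : B)), (0 : F →L[ℝ] ℝ)) := Q.continuousAt h0Q
    exact ContinuousAt.comp (f := fun q : B => (((0 : F), q), (0 : F →L[ℝ] ℝ))) h1 (by fun_prop)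
  -- A group element joining two transversal points near `x₀` has its coordinates in `A`, so that
  -- the chart can see it.
  have hnear : ∀ᶠ q : B × B in 𝓝 ((0 : B), (0 : B)), s q.1 ∈ zeroLevel μ →
      ∀ h : G, h • s q.1 = s q.2 → h ∈ groupParam F G '' A := by
    have h1 : Filter.Tendsto (fun q : B × B => (s q.2, s q.1)) (𝓝 ((0 : B), (0 : B)))
        (𝓝 (x₀, x₀)) := by
      have h2 : Filter.Tendsto s (𝓝 0) (𝓝 x₀) := by
        have := hcont.tendsto
        rwa [hs0] at this
      rw [nhds_prod_eq, nhds_prod_eq]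
      exact (h2.comp Filter.tendsto_snd).prodMk (h2.comp Filter.tendsto_fst)
    exact h1.eventually (eventually_mem_of_smul_eq hfree hproper hN)
  obtain ⟨U₁, hU₁, U₂, hU₂, hUU⟩ := mem_nhds_prod_iff.mp hnear
  -- Lying in both `U₁` and `U₂` lets the same set serve for the source and the target of the
  -- joining element.
  let U' : Set B := U ∩ interior (U₁ ∩ U₂)
  have hU' : IsOpen U' := hU.inter isOpen_interior
  have h0U' : 0 ∈ U' :=
    ⟨h0U, mem_interior_iff_mem_nhds.mpr (Filter.inter_mem hU₁ hU₂)⟩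
  have hbox' : (A ×ˢ U') ×ˢ W ⊆ Q.source :=
    (Set.prod_mono (Set.prod_mono subset_rfl Set.inter_subset_left) subset_rfl).trans hbox
  refine ⟨{
    Φ := Q.restrOpen ((A ×ˢ U') ×ˢ W) ((hA.prod hU').prod hW)
    isParam := ⟨hQ.smooth.mono fun w hw => hw.1, hQ.smooth_symm.mono fun x hx => hx.1⟩
    A := A
    U := U'
    W := W
    source_eq := Set.inter_eq_right.mpr hbox'
    zero_mem := ⟨h0Q, ⟨⟨h0A, h0U'⟩, h0W⟩⟩
    apply_zero := hQ0
    mem_iff := fun w hw => hmem w hw.1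
    orbit_iff := ?_
    vert := ?_ }⟩
  · rintro ⟨⟨a, q⟩, b⟩ hw ⟨⟨a', q'⟩, b'⟩ hw' hb hb'
    change b = 0 at hb
    change b' = 0 at hb'
    subst hb hb'
    change (∃ h : G, h • Q ((a, q), 0) = Q ((a', q'), 0)) ↔ q = q'
    rw [hQeq ((a, q), 0), hQeq ((a', q'), 0)]
    change (∃ h : G, h • groupParam F G a • s q = groupParam F G a' • s q') ↔ q = q'
    constructor
    · rintro ⟨h, hh⟩
      -- After both points are moved to the transversal, the joining element is `groupParam F G a₁`
      -- with `a₁ ∈ A`; injectivity of `Q` then gives `q = q'`.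
      have h1 : ((groupParam F G a')⁻¹ * h * groupParam F G a) • s q = s q' := by
        rw [mul_smul, mul_smul, hh, inv_smul_smul]
      have hqz : s q ∈ zeroLevel μ :=
        (hmem ((0, q), 0) (hbox' ⟨⟨h0A, hw.2.1.2⟩, h0W⟩)).mpr rfl
      obtain ⟨a₁, ha₁, h2⟩ := hUU (show (q, q') ∈ U₁ ×ˢ U₂ from
        ⟨(interior_subset hw.2.1.2.2).1, (interior_subset hw'.2.1.2.2).2⟩) hqz _ h1
      rw [← h2] at h1
      have h3 : Q ((a₁, q), 0) = Q ((0, q'), 0) := by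
        rw [hQeq]
        exact h1
      have h5 : (((a₁, q), 0) : (F × B) × (F →L[ℝ] ℝ)) ∈ Q.source :=
        hbox' ⟨⟨ha₁, hw.2.1.2⟩, h0W⟩
      have h6 : (((0, q'), 0) : (F × B) × (F →L[ℝ] ℝ)) ∈ Q.source :=
        hbox' ⟨⟨h0A, hw'.2.1.2⟩, h0W⟩
      have h4 := Q.injOn h5 h6 h3
      exact congrArg (fun w => w.1.2) h4
    · rintro rfl
      refine ⟨groupParam F G a' * (groupParam F G a)⁻¹, ?_⟩
      rw [smul_smul, inv_mul_cancel_right]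
  · intro w hw v
    change (∃ X, fundAt E F G (Q w) X = tderiv E Q w v) ↔ _
    constructor
    · rintro ⟨X, hX⟩
      obtain ⟨f, rfl⟩ := mcForm_surjective (hQsrc w hw.1) X
      rw [← hvert w hw.1] at hX
      rw [← hQ.injective hw.1 hX]
      exact ⟨rfl, rfl⟩
    · rintro ⟨h1, h2⟩
      obtain ⟨⟨f, q⟩, b⟩ := v
      change q = 0 at h1
      change b = 0 at h2
      subst h1 h2
      exact ⟨_, (hvert w hw.1 f).symm⟩

end Slice


/-! ### Manifold structures from families of parametrizations -/

section Atlas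

variable {ι : Type*} {A V X : Type*} [NormedAddCommGroup A] [NormedSpace ℝ A]
  [NormedAddCommGroup V] [NormedSpace ℝ V] [TopologicalSpace X]

/-- The charted space whose charts are the inverses of a family of parametrizations. -/
abbrev chartedSpaceOfParams (κ : A ≃L[ℝ] V) (φ : ι → OpenPartialHomeomorph V X) (sel : X → ι)
    (hsel : ∀ p, p ∈ (φ (sel p)).target) : ChartedSpace A X where
  atlas := Set.range fun i => (κ.toHomeomorph.toOpenPartialHomeomorph.trans (φ i)).symm
  chartAt p := (κ.toHomeomorph.toOpenPartialHomeomorph.trans (φ (sel p))).symm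
  mem_chart_source p := by simpa using hsel p
  chart_mem_atlas p := ⟨_, rfl⟩

theorem isManifold_chartedSpaceOfParams (κ : A ≃L[ℝ] V) (φ : ι → OpenPartialHomeomorph V X)
    (sel : X → ι) (hsel : ∀ p, p ∈ (φ (sel p)).target)
    (hφ : ∀ i j, ∀ q ∈ (φ i).source, φ i q ∈ (φ j).target →
      ContDiffAt ℝ ∞ (fun q => (φ j).symm (φ i q)) q) :
    @IsManifold ℝ _ A _ _ A _ 𝓘(ℝ, A) ∞ X _ (chartedSpaceOfParams κ φ sel hsel) := by
  let _ := chartedSpaceOfParams κ φ sel hsel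
  refine isManifold_of_contDiffOn _ _ _ ?_
  rintro _ _ ⟨i, rfl⟩ ⟨j, rfl⟩ a ha
  have ha' : κ a ∈ (φ i).source ∧ φ i (κ a) ∈ (φ j).target := by simpa using ha
  exact (κ.symm.contDiff.contDiffAt.comp a
    ((hφ i j _ ha'.1 ha'.2).comp a κ.contDiff.contDiffAt)).contDiffWithinAt

theorem isParam_of_mem_maximalAtlas [ChartedSpace A X] [IsManifold 𝓘(ℝ, A) ∞ X] (κ : A ≃L[ℝ] V)
    {φ : OpenPartialHomeomorph V X}
    (h : (κ.toHomeomorph.toOpenPartialHomeomorph.trans φ).symm ∈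
      IsManifold.maximalAtlas 𝓘(ℝ, A) ∞ X) : IsParam A φ := by
  have h1 := contMDiffOn_of_mem_maximalAtlas h
  have h2 := contMDiffOn_symm_of_mem_maximalAtlas h
  constructor
  · intro v hv
    have hv' : κ.symm v ∈ (κ.toHomeomorph.toOpenPartialHomeomorph.trans φ).symm.target := by
      simpa using hv
    have h3 := (h2.contMDiffAt ((OpenPartialHomeomorph.open_target _).mem_nhds hv')).comp v
      κ.symm.contDiff.contMDiff.contMDiffAt
    refine (h3.congr_of_eventuallyEq (Filter.Eventually.of_forall fun z => ?_)).contMDiffWithinAt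
    change φ z = φ (κ (κ.symm z))
    rw [κ.apply_symm_apply]
  · intro x hx
    have hx' : x ∈ (κ.toHomeomorph.toOpenPartialHomeomorph.trans φ).symm.source := by
      simpa using hx
    have h3 := κ.contDiff.contMDiff.contMDiffAt.comp x
      (h1.contMDiffAt ((OpenPartialHomeomorph.open_source _).mem_nhds hx'))
    refine (h3.congr_of_eventuallyEq (Filter.Eventually.of_forall fun z => ?_)).contMDiffWithinAt
    change φ.symm z = κ (κ.symm (φ.symm z))
    rw [κ.apply_symm_apply]

theorem IsParam.mem_maximalAtlas [ChartedSpace A X] [IsManifold 𝓘(ℝ, A) ∞ X] (κ : A ≃L[ℝ] V)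
    {φ : OpenPartialHomeomorph V X} (h : IsParam A φ) :
    (κ.toHomeomorph.toOpenPartialHomeomorph.trans φ).symm ∈
      IsManifold.maximalAtlas 𝓘(ℝ, A) ∞ X := by
  rw [IsManifold.mem_maximalAtlas_iff_contMDiffOn]
  constructor
  · intro x hx
    have hx' : x ∈ φ.target := by simpa using hx
    exact (κ.symm.contDiff.contMDiff.contMDiffAt.comp x (h.contMDiffAt_symm hx')).contMDiffWithinAt
  · intro a ha
    have ha' : κ a ∈ φ.source := by simpa using ha
    exact ((h.contMDiffAt ha').comp a κ.contDiff.contMDiff.contMDiffAt).contMDiffWithinAt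

theorem isParam_of_chartedSpaceOfParams (κ : A ≃L[ℝ] V) (φ : ι → OpenPartialHomeomorph V X)
    (sel : X → ι) (hsel : ∀ p, p ∈ (φ (sel p)).target)
    (h : @IsManifold ℝ _ A _ _ A _ 𝓘(ℝ, A) ∞ X _ (chartedSpaceOfParams κ φ sel hsel)) (i : ι) :
    letI := chartedSpaceOfParams κ φ sel hsel
    IsParam A (φ i) := by
  let _ := chartedSpaceOfParams κ φ sel hsel
  exact isParam_of_mem_maximalAtlas κ (IsManifold.subset_maximalAtlas ⟨i, rfl⟩)

end Atlas

/-! ### Charts of the zero level and of the orbit space from a slice -/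

section Charts

variable {E : Type*} [NormedAddCommGroup E] [NormedSpace ℝ E]
  {M : Type*} [TopologicalSpace M] [ChartedSpace E M]
  {F : Type*} [NormedAddCommGroup F] [NormedSpace ℝ F] [FiniteDimensional ℝ F]
  {G : Type*} [TopologicalSpace G] [ChartedSpace F G] [Group G] [MulAction G M]
  {B : Type*} [NormedAddCommGroup B] [NormedSpace ℝ B]
  {μ : GroupLieAlgebra 𝓘(ℝ, F) G →ₗ[ℝ] C^∞⟮𝓘(ℝ, E), M; 𝓘(ℝ, ℝ), ℝ⟯}

theorem proj_eq_iff {x y : zeroLevel μ} :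
    proj μ x = proj μ y ↔ ∃ h : G, h • (x : M) = (y : M) := by
  refine Quotient.eq.trans ?_
  constructor
  · rintro ⟨h, hh⟩
    exact ⟨h⁻¹, by rw [← hh]; exact inv_smul_smul _ _⟩
  · rintro ⟨h, hh⟩
    exact ⟨h⁻¹, by rw [← hh]; exact inv_smul_smul _ _⟩

theorem continuous_proj : Continuous (proj μ) := continuous_quot_mk

theorem proj_surjective : Function.Surjective (proj μ) := Quotient.mk_surjective

/-- The action on the zero level. -/
def smulLevel (hinv : ∀ (h : G), ∀ x ∈ zeroLevel μ, h • x ∈ zeroLevel μ) (h : G)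
    (x : zeroLevel μ) : zeroLevel μ := ⟨h • (x : M), hinv h x x.2⟩

theorem proj_smulLevel (hinv : ∀ (h : G), ∀ x ∈ zeroLevel μ, h • x ∈ zeroLevel μ) (h : G)
    (x : zeroLevel μ) : proj μ (smulLevel hinv h x) = proj μ x :=
  (proj_eq_iff.mpr ⟨h, rfl⟩).symm

/-- The saturation of an open set is the union of its translates. -/
theorem isOpenMap_proj [ContinuousConstSMul G M]
    (hinv : ∀ (h : G), ∀ x ∈ zeroLevel μ, h • x ∈ zeroLevel μ) : IsOpenMap (proj μ) := by
  intro O hO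
  have h1 : proj μ ⁻¹' (proj μ '' O) = ⋃ h : G, smulLevel hinv h ⁻¹' O := by
    ext x
    simp only [Set.mem_preimage, Set.mem_image, Set.mem_iUnion]
    constructor
    · rintro ⟨y, hy, hxy⟩
      obtain ⟨h, hh⟩ := proj_eq_iff.mp hxy.symm
      have h2 : smulLevel hinv h x = y := Subtype.ext hh
      exact ⟨h, h2 ▸ hy⟩
    · rintro ⟨h, hh⟩
      exact ⟨_, hh, proj_smulLevel hinv h x⟩
  refine isOpen_coinduced.mpr ?_
  change IsOpen (proj μ ⁻¹' (proj μ '' O))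
  rw [h1]
  refine isOpen_iUnion fun h => hO.preimage ?_
  exact ((continuous_const_smul h).comp continuous_subtype_val).subtype_mk _

variable {x₀ : zeroLevel μ}

theorem Slice.mem_level (S : Slice μ B (x₀ : M)) {p : F × B} (hp : (p, 0) ∈ S.Φ.source) :
    S.Φ (p, 0) ∈ zeroLevel μ := (S.mem_iff _ hp).mpr rfl

theorem Slice.symm_snd (S : Slice μ B (x₀ : M)) {z : M} (hz : z ∈ zeroLevel μ)
    (hz' : z ∈ S.Φ.target) : (S.Φ.symm z).2 = 0 := by
  refine (S.mem_iff _ (S.Φ.map_target hz')).mp ?_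
  rwa [S.Φ.right_inv hz']

theorem Slice.symm_eq (S : Slice μ B (x₀ : M)) {z : M} (hz : z ∈ zeroLevel μ)
    (hz' : z ∈ S.Φ.target) : ((S.Φ.symm z).1, (0 : F →L[ℝ] ℝ)) = S.Φ.symm z :=
  Prod.ext rfl (S.symm_snd hz hz').symm

open Classical in
/-- The value of the adapted parametrization of the zero level. -/
def Slice.levelFun (S : Slice μ B (x₀ : M)) (p : F × B) : zeroLevel μ :=
  if h : S.Φ (p, 0) ∈ zeroLevel μ then ⟨_, h⟩ else x₀

theorem Slice.coe_levelFun (S : Slice μ B (x₀ : M)) {p : F × B} (hp : (p, 0) ∈ S.Φ.source) :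
    (S.levelFun p : M) = S.Φ (p, 0) := by
  rw [Slice.levelFun, dif_pos (S.mem_level hp)]

/-- The parametrization of the zero level given by an adapted chart. -/
def Slice.level (S : Slice μ B (x₀ : M)) : OpenPartialHomeomorph (F × B) (zeroLevel μ) where
  toFun := S.levelFun
  invFun z := (S.Φ.symm z).1
  source := {p | (p, 0) ∈ S.Φ.source}
  target := {z | (z : M) ∈ S.Φ.target}
  map_source' p hp := by
    change (S.levelFun p : M) ∈ S.Φ.target
    rw [S.coe_levelFun hp]
    exact S.Φ.map_source hp
  map_target' z hz := by
    change ((S.Φ.symm z).1, (0 : F →L[ℝ] ℝ)) ∈ S.Φ.source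
    rw [S.symm_eq z.2 hz]
    exact S.Φ.map_target hz
  left_inv' p hp := by
    change (S.Φ.symm (S.levelFun p : M)).1 = p
    rw [S.coe_levelFun hp, S.Φ.left_inv hp]
  right_inv' z hz := by
    have hz' : ((S.Φ.symm z).1, (0 : F →L[ℝ] ℝ)) ∈ S.Φ.source := by
      rw [S.symm_eq z.2 hz]
      exact S.Φ.map_target hz
    refine Subtype.ext ?_
    rw [S.coe_levelFun hz', S.symm_eq z.2 hz, S.Φ.right_inv hz]
  open_source := S.Φ.open_source.preimage (by fun_prop)
  open_target := S.Φ.open_target.preimage continuous_subtype_val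
  continuousOn_toFun := by
    refine Topology.IsInducing.subtypeVal.continuousOn_iff.mpr ?_
    have h1 : ContinuousOn (fun p : F × B => S.Φ (p, 0)) {p | (p, 0) ∈ S.Φ.source} :=
      S.Φ.continuousOn.comp (by fun_prop) fun p hp => hp
    exact h1.congr fun p hp => S.coe_levelFun hp
  continuousOn_invFun := by
    have h1 : ContinuousOn (fun z : zeroLevel μ => S.Φ.symm z) {z | (z : M) ∈ S.Φ.target} :=
      S.Φ.symm.continuousOn.comp continuous_subtype_val.continuousOn fun z hz => hz
    exact continuous_fst.comp_continuousOn h1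

theorem Slice.coe_level (S : Slice μ B (x₀ : M)) {p : F × B} (hp : p ∈ S.level.source) :
    (S.level p : M) = S.Φ (p, 0) := S.coe_levelFun hp

theorem Slice.zero_mem_level (S : Slice μ B (x₀ : M)) : 0 ∈ S.level.source := S.zero_mem

theorem Slice.level_zero (S : Slice μ B (x₀ : M)) : S.level 0 = x₀ :=
  Subtype.ext ((S.coe_level S.zero_mem_level).trans S.apply_zero)

/-- The domain of a slice is a box, so the orbit coordinate can be changed freely within `A`. In
particular it can be set to `0`, which is how the orbit space is parametrized. -/
theorem Slice.mem_level_of_mem (S : Slice μ B (x₀ : M)) {p : F × B} (hp : p ∈ S.level.source)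
    {f : F} (hf : f ∈ S.A) : (f, p.2) ∈ S.level.source := by
  have h1 : (p, (0 : F →L[ℝ] ℝ)) ∈ (S.A ×ˢ S.U) ×ˢ S.W := S.source_eq ▸ hp
  change ((f, p.2), (0 : F →L[ℝ] ℝ)) ∈ S.Φ.source
  rw [S.source_eq]
  exact ⟨⟨hf, h1.1.2⟩, h1.2⟩

theorem Slice.zero_mem_A (S : Slice μ B (x₀ : M)) : 0 ∈ S.A := by
  have h := S.zero_mem
  rw [S.source_eq] at h
  exact h.1.1

theorem Slice.mem_level_zero (S : Slice μ B (x₀ : M)) {p : F × B} (hp : p ∈ S.level.source) :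
    (0, p.2) ∈ S.level.source := S.mem_level_of_mem hp S.zero_mem_A

theorem Slice.proj_level_eq_iff (S : Slice μ B (x₀ : M)) {p p' : F × B} (hp : p ∈ S.level.source)
    (hp' : p' ∈ S.level.source) : proj μ (S.level p) = proj μ (S.level p') ↔ p.2 = p'.2 := by
  rw [proj_eq_iff, S.coe_level hp, S.coe_level hp']
  exact S.orbit_iff (p, 0) hp (p', 0) hp' rfl rfl

/-- The value of the parametrization of the orbit space given by an adapted chart. -/
def Slice.quotFun (S : Slice μ B (x₀ : M)) (q : B) : ReducedSpace μ := proj μ (S.level (0, q))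

theorem Slice.proj_level_eq_quotFun (S : Slice μ B (x₀ : M)) {p : F × B}
    (hp : p ∈ S.level.source) : proj μ (S.level p) = S.quotFun p.2 :=
  (S.proj_level_eq_iff hp (S.mem_level_zero hp)).mpr rfl

theorem Slice.injOn_quotFun (S : Slice μ B (x₀ : M)) :
    Set.InjOn S.quotFun {q | (0, q) ∈ S.level.source} := fun _ hq _ hq' h =>
  (S.proj_level_eq_iff hq hq').mp h

theorem Slice.continuousOn_quotFun (S : Slice μ B (x₀ : M)) :
    ContinuousOn S.quotFun {q | (0, q) ∈ S.level.source} := by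
  refine continuous_proj.comp_continuousOn (S.level.continuousOn.comp ?_ fun q hq => hq)
  fun_prop

/-- The transversal itself need not be open in the level, but sweeping it along the orbit coordinate
gives an open set with the same image in the orbit space. -/
theorem Slice.isOpen_image_quotFun (S : Slice μ B (x₀ : M)) (ho : IsOpenMap (proj μ)) {O : Set B}
    (hO : IsOpen O) (hO' : O ⊆ {q | (0, q) ∈ S.level.source}) : IsOpen (S.quotFun '' O) := by
  have h1 : S.quotFun '' O = proj μ '' (S.level '' (S.level.source ∩ Prod.snd ⁻¹' O)) := by
    ext p
    constructor
    · rintro ⟨q, hq, rfl⟩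
      exact ⟨_, ⟨(0, q), ⟨hO' hq, hq⟩, rfl⟩, rfl⟩
    · rintro ⟨_, ⟨q, ⟨hq, hq'⟩, rfl⟩, rfl⟩
      exact ⟨q.2, hq', (S.proj_level_eq_quotFun hq).symm⟩
  rw [h1]
  exact ho _ (S.level.isOpen_image_source_inter (hO.preimage continuous_snd))

theorem Slice.isOpen_quot_source (S : Slice μ B (x₀ : M)) :
    IsOpen {q : B | ((0 : F), q) ∈ S.level.source} :=
  S.level.open_source.preimage (by fun_prop)

/-- The parametrization of the orbit space given by an adapted chart. -/
def Slice.quot (S : Slice μ B (x₀ : M)) (ho : IsOpenMap (proj μ)) :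
    OpenPartialHomeomorph B (ReducedSpace μ) :=
  OpenPartialHomeomorph.ofContinuousOpenRestrict (S.injOn_quotFun.toPartialEquiv _ _)
    S.continuousOn_quotFun (by
      intro O hO
      have h1 : Set.domRestrict {q | ((0 : F), q) ∈ S.level.source} S.quotFun '' O =
          S.quotFun '' (Subtype.val '' O) := by
        rw [Set.image_image]
        rfl
      change IsOpen (Set.domRestrict {q | ((0 : F), q) ∈ S.level.source} S.quotFun '' O)
      rw [h1]
      refine S.isOpen_image_quotFun ho (S.isOpen_quot_source.isOpenMap_subtype_val O hO) ?_
      rintro _ ⟨q, -, rfl⟩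
      exact q.2) S.isOpen_quot_source

theorem Slice.quot_apply (S : Slice μ B (x₀ : M)) (ho : IsOpenMap (proj μ)) (q : B) :
    S.quot ho q = proj μ (S.level (0, q)) := rfl

theorem Slice.proj_level (S : Slice μ B (x₀ : M)) (ho : IsOpenMap (proj μ)) {p : F × B}
    (hp : p ∈ S.level.source) : proj μ (S.level p) = S.quot ho p.2 := S.proj_level_eq_quotFun hp

theorem Slice.zero_mem_quot (S : Slice μ B (x₀ : M)) (ho : IsOpenMap (proj μ)) :
    0 ∈ (S.quot ho).source := S.zero_mem_level

theorem Slice.quot_zero (S : Slice μ B (x₀ : M)) (ho : IsOpenMap (proj μ)) :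
    S.quot ho 0 = proj μ x₀ := congrArg (proj μ) S.level_zero

theorem Slice.mem_quot_target (S : Slice μ B (x₀ : M)) (ho : IsOpenMap (proj μ)) :
    proj μ x₀ ∈ (S.quot ho).target := by
  rw [← S.quot_zero ho]
  exact (S.quot ho).map_source (S.zero_mem_quot ho)

theorem Slice.quot_symm_proj (S : Slice μ B (x₀ : M)) (ho : IsOpenMap (proj μ)) {z : zeroLevel μ}
    (hz : (z : M) ∈ S.Φ.target) : (S.quot ho).symm (proj μ z) = (S.Φ.symm z).1.2 := by
  have h1 := S.level.map_target (x := z) hz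
  have h2 : proj μ z = S.quot ho (S.level.symm z).2 := by
    rw [← S.proj_level ho h1, S.level.right_inv hz]
  rw [h2, (S.quot ho).left_inv (S.mem_level_zero h1)]
  rfl

end Charts


/-! ### Topology and smooth structure of the orbit space -/

section Reduction

variable {E : Type*} [NormedAddCommGroup E] [NormedSpace ℝ E]
  {M : Type*} [TopologicalSpace M] [ChartedSpace E M]
  {F : Type*} [NormedAddCommGroup F] [NormedSpace ℝ F] [FiniteDimensional ℝ F]
  {G : Type*} [TopologicalSpace G] [ChartedSpace F G] [Group G] [MulAction G M]
  {B : Type*} [NormedAddCommGroup B] [NormedSpace ℝ B]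
  {μ : GroupLieAlgebra 𝓘(ℝ, F) G →ₗ[ℝ] C^∞⟮𝓘(ℝ, E), M; 𝓘(ℝ, ℝ), ℝ⟯}

/-- The orbit relation is, up to a swap, the range of the proper map `(h, x) ↦ (h • x, x)`, hence
closed; a quotient by an open map with closed relation is Hausdorff. -/
theorem t2Space_reducedSpace (ho : IsOpenMap (proj μ)) (hproper : ProperOnZeroLevel μ) :
    T2Space (ReducedSpace μ) := by
  have hq : IsOpenQuotientMap (proj μ) := ⟨proj_surjective, continuous_proj, ho⟩
  rw [t2Space_iff_of_isOpenQuotientMap hq]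
  have h1 : {q : zeroLevel μ × zeroLevel μ | proj μ q.1 = proj μ q.2} =
      (fun q : zeroLevel μ × zeroLevel μ => ((q.2 : M), (q.1 : M))) ⁻¹'
        Set.range (fun p : G × zeroLevel μ => ((p.1 • (p.2 : M), (p.2 : M)) : M × M)) := by
    ext ⟨x, y⟩
    simp only [Set.mem_ofPred_eq, Set.mem_preimage, Set.mem_range]
    rw [proj_eq_iff]
    constructor
    · rintro ⟨h, hh⟩
      exact ⟨(h, x), Prod.ext hh rfl⟩
    · rintro ⟨⟨h, z⟩, hz⟩
      have h2 : (z : M) = x := congrArg Prod.snd hz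
      have h3 : h • (z : M) = y := congrArg Prod.fst hz
      exact ⟨h, h2 ▸ h3⟩
  rw [h1]
  exact hproper.isClosedMap.isClosed_range.preimage (by fun_prop)

theorem secondCountable_reducedSpace [SecondCountableTopology M] (ho : IsOpenMap (proj μ)) :
    SecondCountableTopology (ReducedSpace μ) :=
  TopologicalSpace.Quotient.secondCountableTopology ho

theorem contMDiffAt_incl_level {x₀ : zeroLevel μ} (S : Slice μ B (x₀ : M)) {p : F × B}
    (hp : p ∈ S.level.source) :
    ContMDiffAt 𝓘(ℝ, F × B) 𝓘(ℝ, E) ∞ (fun p => (S.level p : M)) p := by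
  have h1 : ContMDiffAt 𝓘(ℝ, F × B) 𝓘(ℝ, (F × B) × (F →L[ℝ] ℝ)) ∞
      (fun p : F × B => (p, (0 : F →L[ℝ] ℝ))) p :=
    (contDiff_id.prodMk contDiff_const).contMDiff.contMDiffAt
  refine ((S.isParam.contMDiffAt hp).comp p h1).congr_of_eventuallyEq ?_
  filter_upwards [S.level.open_source.mem_nhds hp] with p' hp'
  exact S.coe_level hp'

theorem contDiffAt_symm_fst {x₀ : zeroLevel μ} (S : Slice μ B (x₀ : M)) {V : Type*}
    [NormedAddCommGroup V] [NormedSpace ℝ V] {φ : V → M} {v : V}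
    (hφ : ContMDiffAt 𝓘(ℝ, V) 𝓘(ℝ, E) ∞ φ v) (hv : φ v ∈ S.Φ.target) :
    ContDiffAt ℝ ∞ (fun v => (S.Φ.symm (φ v)).1) v :=
  contDiff_fst.contDiffAt.comp v
    (ContMDiffAt.comp v (S.isParam.contMDiffAt_symm hv) hφ).contDiffAt

theorem contDiffAt_level_transition {x₀ x₁ : zeroLevel μ} (S : Slice μ B (x₀ : M))
    (S' : Slice μ B (x₁ : M)) {p : F × B} (hp : p ∈ S.level.source)
    (hp' : S.level p ∈ S'.level.target) :
    ContDiffAt ℝ ∞ (fun p => S'.level.symm (S.level p)) p :=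
  contDiffAt_symm_fst S' (contMDiffAt_incl_level S hp) hp'

/-- Near a point of the source, the transition maps of the orbit space come from a translation
by an element of the group. -/
theorem quot_transition [ContinuousConstSMul G M]
    (hinv : ∀ (h : G), ∀ x ∈ zeroLevel μ, h • x ∈ zeroLevel μ) (ho : IsOpenMap (proj μ))
    {x₀ x₁ : zeroLevel μ} (S : Slice μ B (x₀ : M)) (S' : Slice μ B (x₁ : M)) {q : B}
    (hq : q ∈ (S.quot ho).source) (hq' : S.quot ho q ∈ (S'.quot ho).target) :
    ∃ h : G, h • (S.level (0, q) : M) ∈ S'.Φ.target ∧ ∀ᶠ q' in 𝓝 q,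
      (S'.quot ho).symm (S.quot ho q') = (S'.Φ.symm (h • (S.level (0, q') : M))).1.2 := by
  have h1 := (S'.quot ho).map_target hq'
  have h2 := (S'.quot ho).right_inv hq'
  obtain ⟨h, hh⟩ := proj_eq_iff.mp h2.symm
  have h3 : h • (S.level (0, q) : M) ∈ S'.Φ.target := hh ▸ S'.level.map_source h1
  refine ⟨h, h3, ?_⟩
  have hc : ContinuousAt (fun q' : B => h • (S.level (0, q') : M)) q := by
    have hc1 : ContinuousAt (fun q' : B => S.level ((0 : F), q')) q :=
      (S.level.continuousAt (x := ((0 : F), q)) hq).comp (f := fun q' : B => ((0 : F), q'))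
        (by fun_prop)
    exact (continuous_subtype_val.continuousAt.comp hc1).const_smul h
  filter_upwards [hc.preimage_mem_nhds (S'.Φ.open_target.mem_nhds h3)] with q' hq'
  have h4 : S.quot ho q' = proj μ (smulLevel hinv h (S.level (0, q'))) :=
    (proj_smulLevel hinv h _).symm
  rw [h4]
  exact S'.quot_symm_proj ho hq'

theorem contDiffAt_quot_transition [ContMDiffSMul 𝓘(ℝ, F) 𝓘(ℝ, E) ∞ G M]
    (hinv : ∀ (h : G), ∀ x ∈ zeroLevel μ, h • x ∈ zeroLevel μ) (ho : IsOpenMap (proj μ))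
    {x₀ x₁ : zeroLevel μ} (S : Slice μ B (x₀ : M)) (S' : Slice μ B (x₁ : M)) {q : B}
    (hq : q ∈ (S.quot ho).source) (hq' : S.quot ho q ∈ (S'.quot ho).target) :
    ContDiffAt ℝ ∞ (fun q => (S'.quot ho).symm (S.quot ho q)) q := by
  have : ContinuousSMul G M := ContMDiffSMul.continuousSMul (I := 𝓘(ℝ, F)) (I' := 𝓘(ℝ, E)) ∞
  obtain ⟨h, h1, h2⟩ := quot_transition hinv ho S S' hq hq'
  refine ContDiffAt.congr_of_eventuallyEq ?_ h2
  have h3 : ContMDiffAt 𝓘(ℝ, B) 𝓘(ℝ, F × B) ∞ (fun q : B => ((0 : F), q)) q :=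
    (contDiff_const.prodMk contDiff_id).contMDiff.contMDiffAt
  have h4 : ContMDiffAt 𝓘(ℝ, B) 𝓘(ℝ, E) ∞ (fun q : B => h • (S.level (0, q) : M)) q :=
    ContMDiffAt.comp (I' := 𝓘(ℝ, E)) q
      (ContMDiffSMul.contMDiff_const_smul (I := 𝓘(ℝ, F)) (n := ∞) h).contMDiffAt
      (ContMDiffAt.comp (I' := 𝓘(ℝ, F × B)) (f := fun q : B => ((0 : F), q)) q
        (contMDiffAt_incl_level S hq) h3)
  exact contDiff_snd.contDiffAt.comp q (contDiffAt_symm_fst S' h4 h1)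

/-- The smooth structures of the zero level and of the orbit space are the ones given by the
adapted charts `S`. -/
structure IsReduction (A : Type*) [NormedAddCommGroup A] [NormedSpace ℝ A]
    [ChartedSpace A (zeroLevel μ)] [ChartedSpace B (ReducedSpace μ)]
    (S : ∀ x : zeroLevel μ, Slice μ B (x : M)) (ho : IsOpenMap (proj μ)) : Prop where
  level : ∀ x, IsParam A (S x).level
  quot : ∀ x, IsParam B ((S x).quot ho)
  chart : ∀ p, ∃ x, proj μ x = p ∧ ⇑(chartAt B p).symm = (S x).quot ho ∧
    (chartAt B p).target = ((S x).quot ho).source ∧ chartAt B p p = 0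

theorem exists_isReduction [ContMDiffSMul 𝓘(ℝ, F) 𝓘(ℝ, E) ∞ G M]
    (hinv : ∀ (h : G), ∀ x ∈ zeroLevel μ, h • x ∈ zeroLevel μ) (ho : IsOpenMap (proj μ))
    (S : ∀ x : zeroLevel μ, Slice μ B (x : M))
    {A : Type*} [NormedAddCommGroup A] [NormedSpace ℝ A] (κ : A ≃L[ℝ] F × B) :
    ∃ (_ : ChartedSpace A (zeroLevel μ)) (_ : ChartedSpace B (ReducedSpace μ))
      (_ : IsManifold 𝓘(ℝ, A) ∞ (zeroLevel μ)) (_ : IsManifold 𝓘(ℝ, B) ∞ (ReducedSpace μ)),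
      IsReduction A S ho := by
  -- On the level the chart at a point is its own slice; on the orbit space it is the slice at a
  -- chosen representative of the orbit.
  have hZ : ∀ z : zeroLevel μ, z ∈ ((S z).level).target := fun z => by
    have h := (S z).level.map_source (S z).zero_mem_level
    rwa [(S z).level_zero] at h
  let sel : ReducedSpace μ → zeroLevel μ := Quotient.out
  have hsel : ∀ p, proj μ (sel p) = p := Quotient.out_eq
  have hN : ∀ p, p ∈ ((S (sel p)).quot ho).target := fun p => by
    have h := (S (sel p)).mem_quot_target ho
    rwa [hsel] at h
  have hMZ := isManifold_chartedSpaceOfParams κ (fun x => (S x).level) id hZ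
    fun i j q hq hq' => contDiffAt_level_transition (S i) (S j) hq hq'
  have hMN := isManifold_chartedSpaceOfParams (ContinuousLinearEquiv.refl ℝ B)
    (fun x => (S x).quot ho) sel hN
    fun i j q hq hq' => contDiffAt_quot_transition hinv ho (S i) (S j) hq hq'
  let cZ := chartedSpaceOfParams κ (fun x => (S x).level) id hZ
  let cN := chartedSpaceOfParams (ContinuousLinearEquiv.refl ℝ B) (fun x => (S x).quot ho) sel hN
  refine ⟨cZ, cN, hMZ, hMN, ?_, ?_, ?_⟩
  · exact fun x => isParam_of_chartedSpaceOfParams κ (fun x => (S x).level) id hZ hMZ x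
  · exact fun x => isParam_of_chartedSpaceOfParams _ (fun x => (S x).quot ho) sel hN hMN x
  · intro p
    refine ⟨sel p, hsel p, rfl, ?_, ?_⟩
    · change Set.univ ∩ ((S (sel p)).quot ho).source = _
      exact Set.univ_inter _
    · change ((S (sel p)).quot ho).symm p = 0
      have h := ((S (sel p)).quot ho).left_inv ((S (sel p)).zero_mem_quot ho)
      rwa [(S (sel p)).quot_zero ho, hsel] at h

variable {A : Type*} [NormedAddCommGroup A] [NormedSpace ℝ A]
  [ChartedSpace A (zeroLevel μ)] [IsManifold 𝓘(ℝ, A) ∞ (zeroLevel μ)]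
  [ChartedSpace B (ReducedSpace μ)] {S : ∀ x : zeroLevel μ, Slice μ B (x : M)} {ho : IsOpenMap (proj μ)}

/-- In slice charts the inclusion is `p ↦ (p, 0)`. The auxiliary equivalence `e` only identifies the
slice model with `E`. -/
theorem IsReduction.isSmoothEmbedding [IsManifold 𝓘(ℝ, E) ∞ M] (h : IsReduction A S ho)
    (κ : A ≃L[ℝ] F × B) : IsSmoothEmbedding 𝓘(ℝ, A) 𝓘(ℝ, E) ∞ (incl μ) := by
  refine ⟨IsImmersionOfComplement.isImmersion (F := F →L[ℝ] ℝ) fun x => ?_,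
    Topology.IsEmbedding.subtypeVal⟩
  obtain ⟨e, -⟩ := (S x).isParam.isInvertible (S x).zero_mem
  have hx : x ∈ (S x).level.target := by
    have h := (S x).level.map_source (S x).zero_mem_level
    rwa [(S x).level_zero] at h
  refine IsImmersionAtOfComplement.mk_of_charts
    ((κ.prodCongr (ContinuousLinearEquiv.refl ℝ (F →L[ℝ] ℝ))).trans e)
    _ _ ?_ ?_ ((h.level x).mem_maximalAtlas κ) ((S x).isParam.mem_maximalAtlas e.symm) ?_ ?_
  · simpa using hx
  · have hx' : incl μ x ∈ (S x).Φ.target := hx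
    simpa using hx'
  · intro z hz
    have hz' : z ∈ (S x).level.target := by simpa using hz
    have hz'' : incl μ z ∈ (S x).Φ.target := hz'
    simpa using hz''
  · intro a ha
    have ha' : κ a ∈ (S x).level.source := by simpa using ha
    change e ((S x).Φ.symm ((S x).level (κ a) : M)) = e (κ a, 0)
    rw [(S x).coe_level ha', (S x).Φ.left_inv ha']

/-- In slice charts the projection is `(f, q) ↦ q`. -/
theorem IsReduction.isSubmersion [IsManifold 𝓘(ℝ, B) ∞ (ReducedSpace μ)] (h : IsReduction A S ho) (κ : A ≃L[ℝ] F × B) :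
    IsSubmersion 𝓘(ℝ, A) 𝓘(ℝ, B) ∞ (proj μ) := by
  refine IsSubmersionOfComplement.isSubmersion (F := F) fun x => ?_
  have hx : x ∈ (S x).level.target := by
    have h := (S x).level.map_source (S x).zero_mem_level
    rwa [(S x).level_zero] at h
  refine IsSubmersionAtOfComplement.mk_of_charts
    (κ.trans (ContinuousLinearEquiv.prodComm ℝ F B))
    _ _ ?_ ?_ ((h.level x).mem_maximalAtlas κ)
    ((h.quot x).mem_maximalAtlas (ContinuousLinearEquiv.refl ℝ B)) ?_ ?_
  · simpa using hx
  · simpa using (S x).mem_quot_target ho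
  · intro z hz
    have hz' : z ∈ (S x).level.target := by simpa using hz
    have h1 := (S x).level.map_target hz'
    have h2 : proj μ z ∈ ((S x).quot ho).target := by
      rw [← (S x).level.right_inv hz', (S x).proj_level ho h1]
      exact ((S x).quot ho).map_source ((S x).mem_level_zero h1)
    simpa using h2
  · intro a ha
    have ha' : κ a ∈ (S x).level.source := by simpa using ha
    change ((S x).quot ho).symm (proj μ ((S x).level (κ a))) = (κ a).2
    rw [(S x).proj_level ho ha', ((S x).quot ho).left_inv ((S x).mem_level_zero ha')]

end Reduction


set_option linter.unusedSectionVars false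

/-! ### The Hermitian structure in a parametrization -/

section PullbackStructure

variable {E : Type*} [NormedAddCommGroup E] [NormedSpace ℝ E]
  {M : Type*} [TopologicalSpace M] [ChartedSpace E M] [IsManifold 𝓘(ℝ, E) ∞ M]
  {V : Type*} [NormedAddCommGroup V] [NormedSpace ℝ V]
  {J : ComplexStructure E M} (g : HermitianMetric J)

theorem bilinAt_symm (x : M) (u v : E) : bilinAt g.inner x u v = bilinAt g.inner x v u :=
  g.symm x u v

theorem bilinAt_pos (x : M) {u : E} (hu : u ≠ 0) : 0 < bilinAt g.inner x u u := g.pos x u hu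

theorem endAt_sq (x : M) (u : E) : endAt J.toFun x (endAt J.toFun x u) = -u := J.sq x u

theorem bilinAt_endAt (x : M) (u v : E) :
    bilinAt g.inner x (endAt J.toFun x u) (endAt J.toFun x v) = bilinAt g.inner x u v :=
  g.hermitian x u v

variable {g} {Φ : OpenPartialHomeomorph V M} {w : V}

theorem IsParam.pullBilin_symm (u v : V) :
    pullBilin g.inner Φ w u v = pullBilin g.inner Φ w v u := bilinAt_symm g _ _ _

theorem IsParam.pullBilin_pos (h : IsParam E Φ) (hw : w ∈ Φ.source) (u : V) (hu : u ≠ 0) :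
    0 < pullBilin g.inner Φ w u u :=
  bilinAt_pos g _ fun h0 => hu (h.injective hw (h0.trans (map_zero _).symm))

theorem IsParam.pullEnd_sq (h : IsParam E Φ) (hw : w ∈ Φ.source) (u : V) :
    pullEnd J.toFun Φ w (pullEnd J.toFun Φ w u) = -u := by
  refine h.injective hw ?_
  rw [tderiv_pullEnd (h.isInvertible hw), tderiv_pullEnd (h.isInvertible hw), endAt_sq, map_neg]

theorem IsParam.pullBilin_pullEnd (h : IsParam E Φ) (hw : w ∈ Φ.source) (u v : V) :
    pullBilin g.inner Φ w (pullEnd J.toFun Φ w u) (pullEnd J.toFun Φ w v) =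
      pullBilin g.inner Φ w u v := by
  rw [pullBilin_apply, pullBilin_apply, tderiv_pullEnd (h.isInvertible hw),
    tderiv_pullEnd (h.isInvertible hw), bilinAt_endAt]

end PullbackStructure

/-! ### Horizontal lifts and the reduced tensors in a slice -/

section SliceGeometry

variable {E : Type*} [NormedAddCommGroup E] [NormedSpace ℝ E]
  {M : Type*} [TopologicalSpace M] [ChartedSpace E M] [IsManifold 𝓘(ℝ, E) ∞ M]
  {F : Type*} [NormedAddCommGroup F] [NormedSpace ℝ F] [FiniteDimensional ℝ F]
  {G : Type*} [TopologicalSpace G] [ChartedSpace F G] [Group G] [MulAction G M]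
  {B : Type*} [NormedAddCommGroup B] [NormedSpace ℝ B]
  {μ : GroupLieAlgebra 𝓘(ℝ, F) G →ₗ[ℝ] C^∞⟮𝓘(ℝ, E), M; 𝓘(ℝ, ℝ), ℝ⟯}
  {J : ComplexStructure E M} {g : HermitianMetric J}
  {θ : ∀ x : M, TangentSpace 𝓘(ℝ, E) x →L[ℝ] ℝ} {x₀ : zeroLevel μ}

/-- The horizontal lift in an adapted chart. -/
def Slice.hor (S : Slice μ B (x₀ : M)) (g : HermitianMetric J) (p : F × B) :
    B →L[ℝ] (F × B) × (F →L[ℝ] ℝ) :=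
  horLift (pullBilin g.inner S.Φ (p, 0))

/-- The complex structure induced on the transversal directions, in an adapted chart. -/
def Slice.redJ (S : Slice μ B (x₀ : M)) (g : HermitianMetric J) (p : F × B) : B →L[ℝ] B :=
  (ContinuousLinearMap.snd ℝ F B).comp ((ContinuousLinearMap.fst ℝ (F × B) (F →L[ℝ] ℝ)).comp
    ((pullEnd J.toFun S.Φ (p, 0)).comp (S.hor g p)))

/-- The metric induced on the transversal directions, in an adapted chart. -/
def Slice.redG (S : Slice μ B (x₀ : M)) (g : HermitianMetric J) (p : F × B) :
    B →L[ℝ] B →L[ℝ] ℝ :=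
  (pullBilin g.inner S.Φ (p, 0)).bilinearComp (S.hor g p) (S.hor g p)

variable (S : Slice μ B (x₀ : M)) {p : F × B}

theorem Slice.hor_fst_snd (u : B) : (S.hor g p u).1.2 = u := horLift_fst_snd _ u

theorem Slice.hor_snd (u : B) : (S.hor g p u).2 = 0 := horLift_snd _ u

theorem Slice.hor_eq (u : B) : ((S.hor g p u).1, (0 : F →L[ℝ] ℝ)) = S.hor g p u :=
  Prod.ext rfl (S.hor_snd u).symm

theorem Slice.hor_orthogonal (hp : p ∈ S.level.source) (u : B) (f : F) :
    pullBilin g.inner S.Φ (p, 0) (S.hor g p u) ((f, 0), 0) = 0 :=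
  horLift_orthogonal (S.isParam.pullBilin_pos hp) u f

theorem Slice.contDiffAt_pullBilin (hp : p ∈ S.level.source) [FiniteDimensional ℝ B] :
    ContDiffAt ℝ ∞ (fun p => pullBilin g.inner S.Φ (p, 0)) p :=
  ContDiffAt.comp (g := pullBilin g.inner S.Φ) p
    (LCK.contDiffAt_pullBilin g.contMDiff (S.isParam.contMDiffAt hp))
    (contDiff_id.prodMk contDiff_const).contDiffAt

theorem Slice.contDiffAt_hor (hp : p ∈ S.level.source) [FiniteDimensional ℝ B] :
    ContDiffAt ℝ ∞ (S.hor g) p :=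
  contDiffAt_horLift (S.contDiffAt_pullBilin hp) (S.isParam.pullBilin_pos hp)

theorem Slice.contDiffAt_redJ (hp : p ∈ S.level.source) [FiniteDimensional ℝ B] :
    ContDiffAt ℝ ∞ (S.redJ g) p := by
  have h1 : ContDiffAt ℝ ∞ (fun p => pullEnd J.toFun S.Φ (p, 0)) p :=
    ContDiffAt.comp (g := pullEnd J.toFun S.Φ) p (S.isParam.contDiffAt_pullEnd hp J.smooth)
      (contDiff_id.prodMk contDiff_const).contDiffAt
  exact contDiffAt_const.clm_comp (contDiffAt_const.clm_comp (h1.clm_comp (S.contDiffAt_hor hp)))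

theorem Slice.contDiffAt_redG (hp : p ∈ S.level.source) [FiniteDimensional ℝ B] :
    ContDiffAt ℝ ∞ (S.redG g) p := by
  refine contDiffAt_clm_of_apply fun u => contDiffAt_clm_of_apply fun v => ?_
  have h1 := fun u : B => (S.contDiffAt_hor (g := g) hp).clm_apply (contDiffAt_const (c := u))
  exact ((S.contDiffAt_pullBilin (g := g) hp).clm_apply (h1 u)).clm_apply (h1 v)

theorem Slice.tderiv_level (hp : p ∈ S.level.source) (v : F × B) :
    tderiv E (fun p => (S.level p : M)) p v = tderiv E S.Φ (p, 0) (v, 0) := by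
  have h1 : tderiv E (fun p => (S.level p : M)) p = tderiv E (fun p : F × B => S.Φ (p, 0)) p := by
    refine tderiv_congr ?_
    filter_upwards [S.level.open_source.mem_nhds hp] with p' hp'
    exact S.coe_level hp'
  have h2 : HasFDerivAt (fun p : F × B => (p, (0 : F →L[ℝ] ℝ)))
      (ContinuousLinearMap.inl ℝ (F × B) (F →L[ℝ] ℝ)) p :=
    (ContinuousLinearMap.inl ℝ (F × B) (F →L[ℝ] ℝ)).hasFDerivAt
  rw [h1, tderiv_comp (φ := S.Φ) (f := fun p : F × B => (p, (0 : F →L[ℝ] ℝ)))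
    ((S.isParam.contMDiffAt hp).mdifferentiableAt (by simp))
    h2.differentiableAt, h2.fderiv]
  rfl

theorem Slice.dmu_level (hp : p ∈ S.level.source) (v : F × B) :
    dmu μ (S.Φ (p, 0)) (tderiv E S.Φ (p, 0) (v, 0)) = 0 := by
  have h1 : mderiv (F × B) (F →L[ℝ] ℝ) (fun p => momentumMap μ (S.level p : M)) p =
      (dmu μ (S.Φ (p, 0))).comp (tderiv E (fun p => (S.level p : M)) p) :=
    mderiv_comp_of_eq (F × B) E (F →L[ℝ] ℝ) (S.coe_level hp)
      ((contMDiff_momentumMap μ).mdifferentiableAt (by simp))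
      ((contMDiffAt_incl_level S hp).mdifferentiableAt (by simp))
  have h2 : (fun p => momentumMap μ (S.level p : M)) = fun _ => 0 := funext fun p => (S.level p).2
  have h3 : mderiv (F × B) (F →L[ℝ] ℝ) (fun _ : F × B => (0 : F →L[ℝ] ℝ)) p = 0 := mfderiv_const
  rw [h2, h3] at h1
  rw [← S.tderiv_level hp]
  exact (DFunLike.congr_fun h1 v).symm

theorem Slice.exists_fundAt_eq (hp : p ∈ S.level.source) (f : F) :
    ∃ X : F, fundAt E F G (S.Φ (p, 0)) X = tderiv E S.Φ (p, 0) ((f, 0), 0) :=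
  (S.vert _ hp ((f, 0), 0)).mpr ⟨rfl, rfl⟩

theorem Slice.exists_eq_fundAt (hp : p ∈ S.level.source)
    (X : F) : ∃ f : F, fundAt E F G (S.Φ (p, 0)) X = tderiv E S.Φ (p, 0) ((f, 0), 0) := by
  have h1 := S.isParam.apply_inverse hp (fundAt E F G (S.Φ (p, 0)) X)
  obtain ⟨h2, h3⟩ := (S.vert _ hp _).mp ⟨X, h1.symm⟩
  refine ⟨((tderiv E S.Φ (p, 0)).inverse (fundAt E F G (S.Φ (p, 0)) X)).1.1, h1.symm.trans ?_⟩
  exact congrArg _ (Prod.ext (Prod.ext rfl h2) h3)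

/-- On the level `Ω` of an orbit direction is a component of `dμ`, which kills the vectors tangent
to the level. -/
theorem Slice.kahler_vert (hμ : IsMomentumMap μ g θ) (hp : p ∈ S.level.source) (f : F)
    (t : F × B) :
    pullBilin g.inner S.Φ (p, 0) (pullEnd J.toFun S.Φ (p, 0) ((f, 0), 0)) (t, 0) = 0 := by
  obtain ⟨X, hX⟩ := S.exists_fundAt_eq hp f
  rw [pullBilin_apply, tderiv_pullEnd (S.isParam.isInvertible hp), ← hX,
    ← hμ.dmu_eq_of_mem (S.mem_level hp), S.dmu_level hp]
  rfl

/-- The general linear algebra applies because the normal directions are modelled on the dual of the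
Lie algebra, which has the dimension of the orbits. -/
theorem Slice.J_hor (hμ : IsMomentumMap μ g θ) (hp : p ∈ S.level.source) (u : B) :
    pullEnd J.toFun S.Φ (p, 0) (S.hor g p u) = S.hor g p (S.redJ g p u) := by
  have hdim : Module.finrank ℝ F = Module.finrank ℝ (F →L[ℝ] ℝ) := by
    rw [← (LinearMap.toContinuousLinearMap (𝕜 := ℝ) (E := F) (F' := ℝ)).finrank_eq]
    exact (Subspace.dual_finrank_eq (K := ℝ) (V := F)).symm
  exact J_horLift hdim (S.isParam.pullBilin_pos hp) (fun u v => IsParam.pullBilin_symm u v)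
    (S.isParam.pullEnd_sq hp) (S.isParam.pullBilin_pullEnd hp) (S.kahler_vert hμ hp) u

theorem Slice.redJ_sq (hμ : IsMomentumMap μ g θ) (hp : p ∈ S.level.source) (u : B) :
    S.redJ g p (S.redJ g p u) = -u := by
  have h1 : S.redJ g p (S.redJ g p u) =
      (pullEnd J.toFun S.Φ (p, 0) (S.hor g p (S.redJ g p u))).1.2 := rfl
  rw [h1, ← S.J_hor hμ hp, S.isParam.pullEnd_sq hp, Prod.fst_neg, Prod.snd_neg, S.hor_fst_snd]

end SliceGeometry

/-! ### Horizontal vectors on the zero level -/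

section HorizontalVectors

variable {E : Type*} [NormedAddCommGroup E] [NormedSpace ℝ E]
  {M : Type*} [TopologicalSpace M] [ChartedSpace E M] [IsManifold 𝓘(ℝ, E) ∞ M]
  {F : Type*} [NormedAddCommGroup F] [NormedSpace ℝ F] [FiniteDimensional ℝ F]
  {G : Type*} [TopologicalSpace G] [ChartedSpace F G] [Group G] [MulAction G M]
  {B : Type*} [NormedAddCommGroup B] [NormedSpace ℝ B]
  {μ : GroupLieAlgebra 𝓘(ℝ, F) G →ₗ[ℝ] C^∞⟮𝓘(ℝ, E), M; 𝓘(ℝ, ℝ), ℝ⟯}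
  {J : ComplexStructure E M} {g : HermitianMetric J}
  {θ : ∀ x : M, TangentSpace 𝓘(ℝ, E) x →L[ℝ] ℝ}
  {A : Type*} [NormedAddCommGroup A] [NormedSpace ℝ A] [ChartedSpace A (zeroLevel μ)]
  [ChartedSpace B (ReducedSpace μ)]

/-- Horizontality, for vectors of the model space. -/
def Hor (g : HermitianMetric J) (x : zeroLevel μ) (u : A) : Prop :=
  ∀ X : F, bilinAt g.inner (x : M) (mderiv A E (incl μ) x u) (fundAt E F G (x : M) X) = 0

variable {S : ∀ x : zeroLevel μ, Slice μ B (x : M)} {ho : IsOpenMap (proj μ)}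
  {x₀ : zeroLevel μ} {p : F × B}

namespace IsReduction

theorem mdifferentiableAt_incl (h : IsReduction A S ho) (x : zeroLevel μ) :
    MDifferentiableAt 𝓘(ℝ, A) 𝓘(ℝ, E) (incl μ) x := by
  have h1 : ContMDiffAt 𝓘(ℝ, A) 𝓘(ℝ, E) ∞ (incl μ) ((S x).level 0) :=
    (h.level x).contMDiffAt_of_comp (S x).zero_mem_level
      (contMDiffAt_incl_level (S x) (S x).zero_mem_level)
  rw [(S x).level_zero] at h1
  exact h1.mdifferentiableAt (by simp)

theorem contMDiffAt_proj_level (h : IsReduction A S ho) (hp : p ∈ (S x₀).level.source) :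
    ContMDiffAt 𝓘(ℝ, F × B) 𝓘(ℝ, B) ∞ (fun p => proj μ ((S x₀).level p)) p := by
  have h1 : ContMDiffAt 𝓘(ℝ, F × B) 𝓘(ℝ, B) ∞ (fun p : F × B => p.2) p :=
    contDiff_snd.contMDiff.contMDiffAt
  have h2 : p.2 ∈ ((S x₀).quot ho).source := (S x₀).mem_level_zero hp
  refine (ContMDiffAt.comp (f := fun p : F × B => p.2) p
    ((h.quot x₀).contMDiffAt h2) h1).congr_of_eventuallyEq ?_
  filter_upwards [(S x₀).level.open_source.mem_nhds hp] with p' hp'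
  exact (S x₀).proj_level ho hp'

theorem mdifferentiableAt_proj (h : IsReduction A S ho) (x : zeroLevel μ) :
    MDifferentiableAt 𝓘(ℝ, A) 𝓘(ℝ, B) (proj μ) x := by
  have h1 : ContMDiffAt 𝓘(ℝ, A) 𝓘(ℝ, B) ∞ (proj μ) ((S x).level 0) :=
    (h.level x).contMDiffAt_of_comp (S x).zero_mem_level
      (h.contMDiffAt_proj_level (S x).zero_mem_level)
  rw [(S x).level_zero] at h1
  exact h1.mdifferentiableAt (by simp)

theorem mderiv_incl (h : IsReduction A S ho) (hp : p ∈ (S x₀).level.source) (v : F × B) :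
    mderiv A E (incl μ) ((S x₀).level p) (tderiv A (S x₀).level p v) =
      tderiv E (S x₀).Φ (p, 0) (v, 0) := by
  have h1 : mderiv (F × B) E (fun p => incl μ ((S x₀).level p)) p =
      (mderiv A E (incl μ) ((S x₀).level p)).comp (tderiv A (S x₀).level p) :=
    mderiv_comp_of_eq (F × B) A E rfl (h.mdifferentiableAt_incl _)
      (((h.level x₀).contMDiffAt hp).mdifferentiableAt (by simp))
  exact (DFunLike.congr_fun h1 v).symm.trans ((S x₀).tderiv_level hp v)

theorem mderiv_proj (h : IsReduction A S ho) (hp : p ∈ (S x₀).level.source) (v : F × B) :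
    mderiv A B (proj μ) ((S x₀).level p) (tderiv A (S x₀).level p v) =
      tderiv B ((S x₀).quot ho) p.2 v.2 := by
  have h1 : mderiv (F × B) B (fun p => proj μ ((S x₀).level p)) p =
      (mderiv A B (proj μ) ((S x₀).level p)).comp (tderiv A (S x₀).level p) :=
    mderiv_comp_of_eq (F × B) A B rfl (h.mdifferentiableAt_proj _)
      (((h.level x₀).contMDiffAt hp).mdifferentiableAt (by simp))
  have h2 : mderiv (F × B) B (fun p => proj μ ((S x₀).level p)) p =
      tderiv B (fun p : F × B => (S x₀).quot ho p.2) p := by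
    refine mderiv_congr (F × B) B ?_
    filter_upwards [(S x₀).level.open_source.mem_nhds hp] with p' hp'
    exact (S x₀).proj_level ho hp'
  have h3 : HasFDerivAt (fun p : F × B => p.2) (ContinuousLinearMap.snd ℝ F B) p := hasFDerivAt_snd
  have h4 : p.2 ∈ ((S x₀).quot ho).source := (S x₀).mem_level_zero hp
  rw [tderiv_comp (((h.quot x₀).contMDiffAt h4).mdifferentiableAt (by simp))
    h3.differentiableAt, h3.fderiv] at h2
  exact (DFunLike.congr_fun h1 v).symm.trans (DFunLike.congr_fun h2 v)

theorem mderiv_incl_injective (h : IsReduction A S ho) (x : zeroLevel μ) :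
    Function.Injective (mderiv A E (incl μ) x) := by
  rw [injective_iff_map_eq_zero]
  intro u hu
  have h0 := (S x).zero_mem_level
  rw [← (S x).level_zero] at hu
  rw [← (h.level x).apply_inverse h0 u, h.mderiv_incl h0] at hu
  have h1 := (S x).isParam.injective (w := ((0 : F × B), (0 : F →L[ℝ] ℝ))) h0
    (hu.trans (map_zero _).symm)
  have h2 : (tderiv A (S x).level 0).inverse u = 0 := congrArg Prod.fst h1
  rw [← (h.level x).apply_inverse h0 u, h2, map_zero]

theorem hor_iff (h : IsReduction A S ho) (hp : p ∈ (S x₀).level.source) (v : F × B) :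
    Hor g ((S x₀).level p) (tderiv A (S x₀).level p v) ↔ (v, 0) = (S x₀).hor g p v.2 := by
  have hc : ((S x₀).level p : M) = (S x₀).Φ (p, 0) := (S x₀).coe_level hp
  rw [Hor, h.mderiv_incl hp, hc]
  constructor
  · intro h1
    refine eq_horLift ((S x₀).isParam.pullBilin_pos hp) (z := (v, 0)) rfl fun f => ?_
    obtain ⟨X, hX⟩ := (S x₀).exists_fundAt_eq hp f
    rw [pullBilin_apply, ← hX]
    exact h1 X
  · intro h1 X
    obtain ⟨f, hf⟩ := (S x₀).exists_eq_fundAt hp X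
    rw [hf, h1]
    exact (S x₀).hor_orthogonal hp v.2 f

/-- The horizontal lift of a tangent vector of the orbit space given in an adapted chart. -/
theorem hor_lift (h : IsReduction A S ho) (hp : p ∈ (S x₀).level.source) (u : B) :
    Hor g ((S x₀).level p) (tderiv A (S x₀).level p ((S x₀).hor g p u).1) := by
  rw [h.hor_iff hp, (S x₀).hor_eq, (S x₀).hor_fst_snd]

theorem mderiv_incl_lift (h : IsReduction A S ho) (hp : p ∈ (S x₀).level.source) (u : B) :
    mderiv A E (incl μ) ((S x₀).level p) (tderiv A (S x₀).level p ((S x₀).hor g p u).1) =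
      tderiv E (S x₀).Φ (p, 0) ((S x₀).hor g p u) := by
  rw [h.mderiv_incl hp, (S x₀).hor_eq]

theorem mderiv_proj_lift (h : IsReduction A S ho) (hp : p ∈ (S x₀).level.source) (u : B) :
    mderiv A B (proj μ) ((S x₀).level p) (tderiv A (S x₀).level p ((S x₀).hor g p u).1) =
      tderiv B ((S x₀).quot ho) p.2 u := by
  rw [h.mderiv_proj hp, (S x₀).hor_fst_snd]

theorem exists_hor_eq (h : IsReduction A S ho) (hp : p ∈ (S x₀).level.source) {u : A}
    (hu : Hor g ((S x₀).level p) u) :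
    ∃ b : B, u = tderiv A (S x₀).level p ((S x₀).hor g p b).1 := by
  rw [← (h.level x₀).apply_inverse hp u] at hu ⊢
  exact ⟨_, congrArg (tderiv A (S x₀).level p)
    (congrArg Prod.fst ((h.hor_iff hp _).mp hu))⟩

theorem exists_hor_lift (h : IsReduction A S ho) (g : HermitianMetric J) (x : zeroLevel μ)
    (b : B) : ∃ u : A, Hor g x u ∧ mderiv A B (proj μ) x u = b := by
  have h0 := (S x).zero_mem_level
  have h1 := (h.quot x).apply_inverse ((S x).zero_mem_quot ho) b
  have h2 := h.hor_lift (g := g) h0 ((tderiv B ((S x).quot ho) 0).inverse b)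
  have h3 := h.mderiv_proj_lift (g := g) h0 ((tderiv B ((S x).quot ho) 0).inverse b)
  rw [(S x).level_zero] at h2 h3
  exact ⟨_, h2, h3.trans h1⟩

end IsReduction

end HorizontalVectors


/-! ### Independence of the point in an orbit -/

section Translation

variable {E : Type*} [NormedAddCommGroup E] [NormedSpace ℝ E]
  {M : Type*} [TopologicalSpace M] [ChartedSpace E M] [IsManifold 𝓘(ℝ, E) ∞ M]
  {F : Type*} [NormedAddCommGroup F] [NormedSpace ℝ F] [FiniteDimensional ℝ F]
  {G : Type*} [TopologicalSpace G] [ChartedSpace F G] [Group G] [MulAction G M]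
  {B : Type*} [NormedAddCommGroup B] [NormedSpace ℝ B]
  {μ : GroupLieAlgebra 𝓘(ℝ, F) G →ₗ[ℝ] C^∞⟮𝓘(ℝ, E), M; 𝓘(ℝ, ℝ), ℝ⟯}
  {J : ComplexStructure E M} {g : HermitianMetric J}
  {θ : ∀ x : M, TangentSpace 𝓘(ℝ, E) x →L[ℝ] ℝ}
  {A : Type*} [NormedAddCommGroup A] [NormedSpace ℝ A] [ChartedSpace A (zeroLevel μ)]
  [ChartedSpace B (ReducedSpace μ)]
  {S : ∀ x : zeroLevel μ, Slice μ B (x : M)} {ho : IsOpenMap (proj μ)}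
  [LieGroup 𝓘(ℝ, F) ∞ G] [ContMDiffSMul 𝓘(ℝ, F) 𝓘(ℝ, E) ∞ G M]

namespace IsReduction

theorem mdifferentiableAt_smulLevel (h : IsReduction A S ho)
    (hinv : ∀ (h : G), ∀ x ∈ zeroLevel μ, h • x ∈ zeroLevel μ) (k : G) (x : zeroLevel μ) :
    MDifferentiableAt 𝓘(ℝ, A) 𝓘(ℝ, A) (smulLevel hinv k) x := by
  set y := smulLevel hinv k x with hy
  have hx0 := (S x).zero_mem_level
  have hy0 := (S y).zero_mem_level
  have hsm : ContMDiffAt 𝓘(ℝ, F × B) 𝓘(ℝ, E) ∞ (fun p => k • ((S x).level p : M)) 0 :=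
    ContMDiffAt.comp (I' := 𝓘(ℝ, E)) (0 : F × B)
      (ContMDiffSMul.contMDiff_const_smul (I := 𝓘(ℝ, F)) (n := ∞) k).contMDiffAt
      (contMDiffAt_incl_level (S x) hx0)
  have hval : k • ((S x).level 0 : M) = (S y).Φ 0 := by
    rw [(S x).level_zero, (S y).apply_zero]
    rfl
  have hmem : k • ((S x).level 0 : M) ∈ (S y).Φ.target := by
    rw [hval]
    exact (S y).Φ.map_source (S y).zero_mem
  have h1 : ContMDiffAt 𝓘(ℝ, F × B) 𝓘(ℝ, A) ∞
      (fun p => (S y).level ((S y).Φ.symm (k • ((S x).level p : M))).1) 0 := by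
    refine ContMDiffAt.comp (I' := 𝓘(ℝ, F × B))
      (f := fun p => ((S y).Φ.symm (k • ((S x).level p : M))).1) (0 : F × B) ?_
      (contDiffAt_symm_fst (S y) hsm hmem).contMDiffAt
    refine (h.level y).contMDiffAt ?_
    rw [hval, (S y).Φ.left_inv (S y).zero_mem]
    exact hy0
  have h2 : ContMDiffAt 𝓘(ℝ, F × B) 𝓘(ℝ, A) ∞ (fun p => smulLevel hinv k ((S x).level p)) 0 := by
    refine h1.congr_of_eventuallyEq ?_
    filter_upwards [hsm.continuousAt.preimage_mem_nhds ((S y).Φ.open_target.mem_nhds hmem)]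
      with p hp
    exact ((S y).level.right_inv (x := smulLevel hinv k ((S x).level p)) hp).symm
  have h3 : ContMDiffAt 𝓘(ℝ, A) 𝓘(ℝ, A) ∞ (smulLevel hinv k) ((S x).level 0) :=
    (h.level x).contMDiffAt_of_comp hx0 h2
  rw [(S x).level_zero] at h3
  exact h3.mdifferentiableAt (by simp)

theorem mderiv_incl_smulLevel (h : IsReduction A S ho)
    (hinv : ∀ (h : G), ∀ x ∈ zeroLevel μ, h • x ∈ zeroLevel μ) (k : G) (x : zeroLevel μ) (u : A) :
    mderiv A E (incl μ) (smulLevel hinv k x) (mderiv A A (smulLevel hinv k) x u) =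
      mderiv E E (fun y : M => k • y) (x : M) (mderiv A E (incl μ) x u) := by
  have h1 := mderiv_comp_of_eq A A E (y := smulLevel hinv k x) rfl (h.mdifferentiableAt_incl _)
    (h.mdifferentiableAt_smulLevel hinv k x)
  have h2 : mderiv A E (fun z : zeroLevel μ => k • incl μ z) x =
      (mderiv E E (fun y : M => k • y) (x : M)).comp (mderiv A E (incl μ) x) :=
    mderiv_comp_of_eq A E E rfl (mdifferentiableAt_const_smul F k (x : M))
      (h.mdifferentiableAt_incl x)
  exact (DFunLike.congr_fun h1 u).symm.trans (DFunLike.congr_fun h2 u)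

theorem mderiv_proj_smulLevel (h : IsReduction A S ho)
    (hinv : ∀ (h : G), ∀ x ∈ zeroLevel μ, h • x ∈ zeroLevel μ) (k : G) (x : zeroLevel μ) (u : A) :
    mderiv A B (proj μ) (smulLevel hinv k x) (mderiv A A (smulLevel hinv k) x u) =
      mderiv A B (proj μ) x u := by
  have h1 := mderiv_comp_of_eq A A B (y := smulLevel hinv k x) rfl (h.mdifferentiableAt_proj _)
    (h.mdifferentiableAt_smulLevel hinv k x)
  have h2 : (fun z : zeroLevel μ => proj μ (smulLevel hinv k z)) = proj μ :=
    funext fun z => proj_smulLevel hinv k z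
  rw [h2] at h1
  exact (DFunLike.congr_fun h1 u).symm

/-- Translations permute the orbit directions and preserve angles, being conformal, so orthogonality
to the orbit is preserved. -/
theorem hor_smulLevel (h : IsReduction A S ho) (haut : ActsByAutomorphisms G g)
    (hinv : ∀ (h : G), ∀ x ∈ zeroLevel μ, h • x ∈ zeroLevel μ) (k : G) (x : zeroLevel μ) {u : A}
    (hu : Hor g x u) : Hor g (smulLevel hinv k x) (mderiv A A (smulLevel hinv k) x u) := by
  intro X
  rw [h.mderiv_incl_smulLevel hinv]
  obtain ⟨Y, hY⟩ := exists_fundAt_smul (E := E) k (x : M) X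
  obtain ⟨f, hf⟩ := haut.conformal k
  have h1 : bilinAt g.inner (k • (x : M))
      (mderiv E E (fun y : M => k • y) (x : M) (mderiv A E (incl μ) x u))
      (mderiv E E (fun y : M => k • y) (x : M) (fundAt E F G (x : M) Y)) =
      Real.exp (f (x : M)) * bilinAt g.inner (x : M) (mderiv A E (incl μ) x u)
        (fundAt E F G (x : M) Y) := hf (x : M) _ _
  have h2 := hu Y
  rw [h2, mul_zero] at h1
  change bilinAt g.inner (k • (x : M)) _ (fundAt E F G (k • (x : M)) X) = 0
  rw [hY]
  exact h1

/-- Horizontal vectors at two points of the same orbit correspond to each other under a conformal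
complex linear map. -/
theorem exists_translation (h : IsReduction A S ho) (haut : ActsByAutomorphisms G g)
    (hinv : ∀ (h : G), ∀ x ∈ zeroLevel μ, h • x ∈ zeroLevel μ) {x y : zeroLevel μ}
    (hxy : proj μ x = proj μ y) :
    ∃ (D : E →L[ℝ] E) (c : ℝ), 0 < c ∧
      (∀ e, D (endAt J.toFun (x : M) e) = endAt J.toFun (y : M) (D e)) ∧
      (∀ e e', bilinAt g.inner (y : M) (D e) (D e') = c * bilinAt g.inner (x : M) e e') ∧
      (∀ u : A, Hor g x u → ∃ v : A, Hor g y v ∧ mderiv A B (proj μ) y v = mderiv A B (proj μ) x u ∧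
        mderiv A E (incl μ) y v = D (mderiv A E (incl μ) x u)) ∧
      (∀ v : A, Hor g y v → ∃ u : A, Hor g x u ∧ mderiv A B (proj μ) y v = mderiv A B (proj μ) x u ∧
        mderiv A E (incl μ) y v = D (mderiv A E (incl μ) x u)) := by
  obtain ⟨k, hk⟩ := proj_eq_iff.mp hxy
  obtain rfl : smulLevel hinv k x = y := Subtype.ext hk
  set y := smulLevel hinv k x with hy
  obtain ⟨f, hf⟩ := haut.conformal k
  have hback : smulLevel hinv k⁻¹ y = x := Subtype.ext (inv_smul_smul k (x : M))
  refine ⟨mderiv E E (fun z : M => k • z) (x : M), Real.exp (f (x : M)), Real.exp_pos _,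
    fun e => haut.holomorphic k (x : M) e, fun e e' => hf (x : M) e e', fun u hu => ?_,
    fun v hv => ?_⟩
  · exact ⟨_, h.hor_smulLevel haut hinv k x hu, h.mderiv_proj_smulLevel hinv k x u,
      h.mderiv_incl_smulLevel hinv k x u⟩
  · have h1 := h.hor_smulLevel haut hinv k⁻¹ y hv
    have h2 := h.mderiv_proj_smulLevel hinv k⁻¹ y v
    have h3 := h.mderiv_incl_smulLevel hinv k⁻¹ y v
    rw [hback] at h1 h2 h3
    refine ⟨_, h1, h2.symm, ?_⟩
    have h4 : mderiv E E (fun z : M => k • (k⁻¹ • z)) (y : M) =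
        (mderiv E E (fun z : M => k • z) (x : M)).comp
          (mderiv E E (fun z : M => k⁻¹ • z) (y : M)) :=
      mderiv_comp_of_eq E E E (congrArg Subtype.val hback)
        (mdifferentiableAt_const_smul F k (x : M)) (mdifferentiableAt_const_smul F k⁻¹ (y : M))
    have h5 : (fun z : M => k • (k⁻¹ • z)) = fun z => z := funext fun z => smul_inv_smul k z
    rw [h5, mderiv_id] at h4
    rw [h3]
    exact DFunLike.congr_fun h4 (mderiv A E (incl μ) y v)

end IsReduction

variable (A) in
/-- The endomorphism `T` of the tangent space of the orbit space at the image of `x` is induced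
by `J`. -/
def InducedEnd (g : HermitianMetric J) (x : zeroLevel μ) (T : B →L[ℝ] B) : Prop :=
  ∀ u : A, Hor g x u → ∃ w : A, Hor g x w ∧
    mderiv A E (incl μ) x w = endAt J.toFun (x : M) (mderiv A E (incl μ) x u) ∧
    mderiv A B (proj μ) x w = T (mderiv A B (proj μ) x u)

variable (A) in
/-- The bilinear form `b` on the tangent space of the orbit space at the image of `x` is induced
by `g`, up to the factor `r`. -/
def InducedBilin (g : HermitianMetric J) (x : zeroLevel μ) (r : ℝ) (b : B →L[ℝ] B →L[ℝ] ℝ) :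
    Prop :=
  ∀ u v : A, Hor g x u → Hor g x v → b (mderiv A B (proj μ) x u) (mderiv A B (proj μ) x v) =
    r * bilinAt g.inner (x : M) (mderiv A E (incl μ) x u) (mderiv A E (incl μ) x v)

namespace IsReduction

theorem inducedEnd_of_proj_eq (h : IsReduction A S ho) (haut : ActsByAutomorphisms G g)
    (hinv : ∀ (h : G), ∀ x ∈ zeroLevel μ, h • x ∈ zeroLevel μ) {x y : zeroLevel μ}
    (hxy : proj μ x = proj μ y) {T : B →L[ℝ] B} (hT : InducedEnd A g x T) :
    InducedEnd A g y T := by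
  obtain ⟨D, c, -, hDJ, -, hD, hD'⟩ := h.exists_translation haut hinv hxy
  intro v hv
  obtain ⟨u, hu, hu1, hu2⟩ := hD' v hv
  obtain ⟨w, hw, hw1, hw2⟩ := hT u hu
  obtain ⟨w', hw', hw1', hw2'⟩ := hD w hw
  refine ⟨w', hw', ?_, ?_⟩
  · rw [hw2', hw1, hDJ, ← hu2]
  · rw [hw1', hw2, hu1]

/-- The translation is conformal, not isometric, so the factor changes from `r` to `r / c`. This is
why only a conformal class descends. -/
theorem inducedBilin_of_proj_eq (h : IsReduction A S ho) (haut : ActsByAutomorphisms G g)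
    (hinv : ∀ (h : G), ∀ x ∈ zeroLevel μ, h • x ∈ zeroLevel μ) {x y : zeroLevel μ}
    (hxy : proj μ x = proj μ y) {r : ℝ} (hr : 0 < r) {b : B →L[ℝ] B →L[ℝ] ℝ}
    (hb : InducedBilin A g x r b) : ∃ r' : ℝ, 0 < r' ∧ InducedBilin A g y r' b := by
  obtain ⟨D, c, hc, -, hDg, -, hD'⟩ := h.exists_translation haut hinv hxy
  refine ⟨r / c, div_pos hr hc, fun u v hu hv => ?_⟩
  obtain ⟨u₀, hu₀, hu1, hu2⟩ := hD' u hu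
  obtain ⟨v₀, hv₀, hv1, hv2⟩ := hD' v hv
  rw [hu1, hv1, hu2, hv2, hDg, hb u₀ v₀ hu₀ hv₀]
  field_simp

/-- Horizontal vectors map onto the tangent space of the orbit space, and `J` of a horizontal vector
has a unique preimage under the injective derivative of the inclusion. -/
theorem inducedEnd_unique (h : IsReduction A S ho) {x : zeroLevel μ} {T T' : B →L[ℝ] B}
    (hT : InducedEnd A g x T) (hT' : InducedEnd A g x T') : T = T' := by
  refine ContinuousLinearMap.ext fun b => ?_
  obtain ⟨u, hu, rfl⟩ := h.exists_hor_lift g x b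
  obtain ⟨w, hw, hw1, hw2⟩ := hT u hu
  obtain ⟨w', hw', hw1', hw2'⟩ := hT' u hu
  rw [← hw2, ← hw2', h.mderiv_incl_injective x (hw1.trans hw1'.symm)]

variable {x₀ : zeroLevel μ} {p : F × B}

theorem inducedEnd_redJ (h : IsReduction A S ho) (hμ : IsMomentumMap μ g θ)
    (hp : p ∈ (S x₀).level.source) :
    InducedEnd A g ((S x₀).level p) ((tderiv B ((S x₀).quot ho) p.2).comp
      (((S x₀).redJ g p).comp (tderiv B ((S x₀).quot ho) p.2).inverse)) := by
  intro u hu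
  obtain ⟨b, rfl⟩ := h.exists_hor_eq hp hu
  have hq : p.2 ∈ ((S x₀).quot ho).source := (S x₀).mem_level_zero hp
  refine ⟨_, h.hor_lift hp ((S x₀).redJ g p b), ?_, ?_⟩
  · rw [h.mderiv_incl_lift hp, h.mderiv_incl_lift hp, ← (S x₀).J_hor hμ hp,
      tderiv_pullEnd ((S x₀).isParam.isInvertible hp), (S x₀).coe_level hp]
  · rw [h.mderiv_proj_lift hp, h.mderiv_proj_lift hp]
    simp only [ContinuousLinearMap.comp_apply]
    rw [(h.quot x₀).inverse_apply hq]

theorem inducedBilin_redG (h : IsReduction A S ho) (hp : p ∈ (S x₀).level.source) :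
    InducedBilin A g ((S x₀).level p) 1 (((S x₀).redG g p).bilinearComp
      (tderiv B ((S x₀).quot ho) p.2).inverse (tderiv B ((S x₀).quot ho) p.2).inverse) := by
  intro u v hu hv
  obtain ⟨b, rfl⟩ := h.exists_hor_eq hp hu
  obtain ⟨c, rfl⟩ := h.exists_hor_eq hp hv
  have hq : p.2 ∈ ((S x₀).quot ho).source := (S x₀).mem_level_zero hp
  rw [h.mderiv_proj_lift hp, h.mderiv_proj_lift hp, h.mderiv_incl_lift hp, h.mderiv_incl_lift hp,
    (S x₀).coe_level hp, one_mul]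
  simp only [ContinuousLinearMap.bilinearComp_apply]
  rw [(h.quot x₀).inverse_apply hq, (h.quot x₀).inverse_apply hq]
  rfl

/-- The equation of an induced bilinear form in an adapted chart. -/
theorem redG_of_inducedBilin (h : IsReduction A S ho) (hp : p ∈ (S x₀).level.source) {r : ℝ}
    {b : B →L[ℝ] B →L[ℝ] ℝ} (hb : InducedBilin A g ((S x₀).level p) r b) (u v : B) :
    b (tderiv B ((S x₀).quot ho) p.2 u) (tderiv B ((S x₀).quot ho) p.2 v) =
      r * (S x₀).redG g p u v := by
  have h1 := hb _ _ (h.hor_lift hp u) (h.hor_lift hp v)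
  rw [h.mderiv_proj_lift hp, h.mderiv_proj_lift hp, h.mderiv_incl_lift hp, h.mderiv_incl_lift hp,
    (S x₀).coe_level hp] at h1
  exact h1

end IsReduction

end Translation


/-! ### Bounds for positive definite forms -/

section PositiveForms

variable {B : Type*} [NormedAddCommGroup B] [NormedSpace ℝ B] [FiniteDimensional ℝ B]

/-- A positive definite form on a finite-dimensional space is bounded below on the unit sphere. -/
theorem exists_pos_mul_sq_le {b : B →L[ℝ] B →L[ℝ] ℝ} (hb : ∀ v, v ≠ 0 → 0 < b v v) :
    ∃ m : ℝ, 0 < m ∧ ∀ v, m * ‖v‖ ^ 2 ≤ b v v := by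
  have hcont : Continuous fun v => b v v := b.continuous.clm_apply continuous_id
  rcases subsingleton_or_nontrivial B with hB | hB
  · refine ⟨1, one_pos, fun v => ?_⟩
    rw [Subsingleton.elim v 0]
    simp
  obtain ⟨v₀, hv₀, hmin⟩ := (isCompact_sphere (0 : B) 1).exists_isMinOn
    (NormedSpace.sphere_nonempty.mpr zero_le_one) hcont.continuousOn
  have hv₀' : ‖v₀‖ = 1 := by simpa using hv₀
  refine ⟨b v₀ v₀, hb v₀ fun h => by simp [h] at hv₀', fun v => ?_⟩
  rcases eq_or_ne v 0 with rfl | hv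
  · simp
  have hn : ‖v‖ ≠ 0 := norm_ne_zero_iff.mpr hv
  have h1 : ‖v‖⁻¹ • v ∈ Metric.sphere (0 : B) 1 := by
    simp [norm_smul, hn]
  have h2 : b v₀ v₀ ≤ b (‖v‖⁻¹ • v) (‖v‖⁻¹ • v) := hmin h1
  have h3 : b (‖v‖⁻¹ • v) (‖v‖⁻¹ • v) = b v v / ‖v‖ ^ 2 := by
    simp only [map_smul, smul_apply, smul_eq_mul]
    field_simp
  rw [h3, le_div_iff₀ (by positivity)] at h2
  exact h2

theorem isVonNBounded_of_pos {b : B →L[ℝ] B →L[ℝ] ℝ} (hb : ∀ v, v ≠ 0 → 0 < b v v) :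
    Bornology.IsVonNBounded ℝ {v : B | b v v < 1} := by
  obtain ⟨m, hm, hmb⟩ := exists_pos_mul_sq_le hb
  rw [NormedSpace.isVonNBounded_iff']
  -- The bound comes from `‖v‖ ^ 2 < 1 / m` and `2 * ‖v‖ ≤ 1 + ‖v‖ ^ 2`.
  refine ⟨1 + 1 / m, fun v hv => ?_⟩
  have h1 : m * ‖v‖ ^ 2 < 1 := (hmb v).trans_lt hv
  have h2 : ‖v‖ ^ 2 < 1 / m := by
    rw [lt_div_iff₀ hm, mul_comm]
    exact h1
  nlinarith [norm_nonneg v, sq_nonneg (‖v‖ - 1)]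

end PositiveForms

/-! ### The reduced complex structure -/

section ReducedStructure

variable {E : Type*} [NormedAddCommGroup E] [NormedSpace ℝ E]
  {M : Type*} [TopologicalSpace M] [ChartedSpace E M] [IsManifold 𝓘(ℝ, E) ∞ M]
  {F : Type*} [NormedAddCommGroup F] [NormedSpace ℝ F] [FiniteDimensional ℝ F]
  {G : Type*} [TopologicalSpace G] [ChartedSpace F G] [Group G] [MulAction G M]
  {B : Type*} [NormedAddCommGroup B] [NormedSpace ℝ B]
  {μ : GroupLieAlgebra 𝓘(ℝ, F) G →ₗ[ℝ] C^∞⟮𝓘(ℝ, E), M; 𝓘(ℝ, ℝ), ℝ⟯}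
  {J : ComplexStructure E M} {g : HermitianMetric J}
  {θ : ∀ x : M, TangentSpace 𝓘(ℝ, E) x →L[ℝ] ℝ}
  {A : Type*} [NormedAddCommGroup A] [NormedSpace ℝ A] [ChartedSpace A (zeroLevel μ)]
  [ChartedSpace B (ReducedSpace μ)]
  {S : ∀ x : zeroLevel μ, Slice μ B (x : M)} {ho : IsOpenMap (proj μ)}

/-- The field of endomorphisms of the tangent spaces of the orbit space which is induced by `J`. -/
def redEnd (S : ∀ x : zeroLevel μ, Slice μ B (x : M)) (ho : IsOpenMap (proj μ))
    (g : HermitianMetric J) (p : ReducedSpace μ) :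
    TangentSpace 𝓘(ℝ, B) p →L[ℝ] TangentSpace 𝓘(ℝ, B) p :=
  (tderiv B ((S p.out).quot ho) 0).comp
    (((S p.out).redJ g 0).comp (tderiv B ((S p.out).quot ho) 0).inverse)

namespace IsReduction

variable [LieGroup 𝓘(ℝ, F) ∞ G] [ContMDiffSMul 𝓘(ℝ, F) 𝓘(ℝ, E) ∞ G M]

theorem inducedEnd_redEnd (h : IsReduction A S ho) (hμ : IsMomentumMap μ g θ)
    (haut : ActsByAutomorphisms G g)
    (hinv : ∀ (h : G), ∀ x ∈ zeroLevel μ, h • x ∈ zeroLevel μ) (x : zeroLevel μ) :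
    InducedEnd A g x (endAt (redEnd S ho g) (proj μ x)) := by
  set y := (proj μ x).out with hy
  have hyx : proj μ y = proj μ x := Quotient.out_eq (proj μ x)
  have h1 := h.inducedEnd_redJ hμ (S y).zero_mem_level
  rw [(S y).level_zero] at h1
  exact h.inducedEnd_of_proj_eq haut hinv hyx h1

/-- Pointwise, the global endomorphism was read off at one representative of each orbit. Uniqueness
of the induced endomorphism shows that any slice computes the same one, at any point of the orbit;
in particular `redJ` depends on the orbit coordinate `q` alone. -/
theorem pullEnd_redEnd (h : IsReduction A S ho) (hμ : IsMomentumMap μ g θ)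
    (haut : ActsByAutomorphisms G g)
    (hinv : ∀ (h : G), ∀ x ∈ zeroLevel μ, h • x ∈ zeroLevel μ) {x₀ : zeroLevel μ} {p : F × B}
    (hp : p ∈ (S x₀).level.source) :
    pullEnd (redEnd S ho g) ((S x₀).quot ho) p.2 = (S x₀).redJ g p := by
  have hq : p.2 ∈ ((S x₀).quot ho).source := (S x₀).mem_level_zero hp
  have h1 := h.inducedEnd_unique (h.inducedEnd_redEnd hμ haut hinv ((S x₀).level p))
    (h.inducedEnd_redJ hμ hp)
  rw [(S x₀).proj_level ho hp] at h1
  refine ContinuousLinearMap.ext fun b => ?_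
  rw [pullEnd, h1]
  simp only [ContinuousLinearMap.comp_apply]
  rw [(h.quot x₀).inverse_apply hq, (h.quot x₀).inverse_apply hq]

theorem redEnd_sq (h : IsReduction A S ho) (hμ : IsMomentumMap μ g θ) (p : ReducedSpace μ)
    (b : TangentSpace 𝓘(ℝ, B) p) : redEnd S ho g p (redEnd S ho g p b) = -b := by
  have h0 := (S p.out).zero_mem_level
  have hq := (S p.out).zero_mem_quot ho
  have key : ∀ b : B, (tderiv B ((S p.out).quot ho) 0) ((S p.out).redJ g 0
      ((tderiv B ((S p.out).quot ho) 0).inverse ((tderiv B ((S p.out).quot ho) 0)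
        ((S p.out).redJ g 0 ((tderiv B ((S p.out).quot ho) 0).inverse b))))) = -b := fun b => by
    rw [(h.quot p.out).inverse_apply hq, (S p.out).redJ_sq hμ h0, map_neg,
      (h.quot p.out).apply_inverse hq]
  exact key b

variable [IsManifold 𝓘(ℝ, B) ∞ (ReducedSpace μ)] [FiniteDimensional ℝ B]

theorem contDiffAt_pullEnd_redEnd (h : IsReduction A S ho) (hμ : IsMomentumMap μ g θ)
    (haut : ActsByAutomorphisms G g)
    (hinv : ∀ (h : G), ∀ x ∈ zeroLevel μ, h • x ∈ zeroLevel μ) (x : zeroLevel μ) :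
    ContDiffAt ℝ ∞ (pullEnd (redEnd S ho g) ((S x).quot ho)) 0 := by
  have h1 : ContDiffAt ℝ ∞ (fun q : B => (S x).redJ g (0, q)) 0 :=
    ContDiffAt.comp (f := fun q : B => ((0 : F), q)) (0 : B)
      ((S x).contDiffAt_redJ (g := g) (S x).zero_mem_level)
      (contDiff_const.prodMk contDiff_id).contDiffAt
  refine h1.congr_of_eventuallyEq ?_
  filter_upwards [((S x).quot ho).open_source.mem_nhds ((S x).zero_mem_quot ho)] with q hq
  exact h.pullEnd_redEnd hμ haut hinv (p := (0, q)) hq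

theorem contMDiff_redEnd (h : IsReduction A S ho) (hμ : IsMomentumMap μ g θ)
    (haut : ActsByAutomorphisms G g)
    (hinv : ∀ (h : G), ∀ x ∈ zeroLevel μ, h • x ∈ zeroLevel μ) :
    ContMDiff 𝓘(ℝ, B) (𝓘(ℝ, B).prod 𝓘(ℝ, B →L[ℝ] B)) ∞
      (fun p : ReducedSpace μ => TotalSpace.mk' (B →L[ℝ] B)
        (E := fun p : ReducedSpace μ => TangentSpace 𝓘(ℝ, B) p →L[ℝ] TangentSpace 𝓘(ℝ, B) p) p
        (redEnd S ho g p)) := by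
  intro p
  obtain ⟨x, -, hx1, -, hx2⟩ := h.chart p
  refine contMDiffAt_end_of_chart ?_
  rw [hx1, hx2]
  exact h.contDiffAt_pullEnd_redEnd hμ haut hinv x

variable [FiniteDimensional ℝ E] [T2Space M] [SecondCountableTopology M]

/-- The slice at `x` is exactly the flat situation of `nijenhuis_reduction`. Every point of the
orbit space is the centre of such a slice, so the origin suffices. -/
theorem nijenhuis_redEnd (h : IsReduction A S ho) (hμ : IsMomentumMap μ g θ)
    (haut : ActsByAutomorphisms G g)
    (hinv : ∀ (h : G), ∀ x ∈ zeroLevel μ, h • x ∈ zeroLevel μ) (x : zeroLevel μ) (u v : B) :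
    nijenhuis (pullEnd (redEnd S ho g) ((S x).quot ho)) 0 u v = 0 := by
  have h0 := (S x).zero_mem_level
  have h0' : ((0 : F × B), (0 : F →L[ℝ] ℝ)) ∈ (S x).Φ.source := h0
  refine nijenhuis_reduction (s₀ := (0 : F × B)) (J := pullEnd J.toFun (S x).Φ)
    (L := fun w => horLift (pullBilin g.inner (S x).Φ w))
    (b := pullBilin g.inner (S x).Φ (0, 0)) ?_ ?_ ?_ ((S x).isParam.pullEnd_sq h0')
    ((S x).isParam.nijenhuis_eq_zero h0' J) (fun w u => horLift_fst_snd _ u)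
    (fun w u => horLift_snd _ u) ?_ ((S x).isParam.pullBilin_pos h0') ((S x).kahler_vert hμ h0) u v
  · exact ((S x).isParam.contDiffAt_pullEnd h0' J.smooth).differentiableAt (by simp)
  · exact (contDiffAt_horLift (contDiffAt_pullBilin g.contMDiff ((S x).isParam.contMDiffAt h0'))
      ((S x).isParam.pullBilin_pos h0')).differentiableAt (by simp)
  · exact (h.contDiffAt_pullEnd_redEnd hμ haut hinv x).differentiableAt (by simp)
  · filter_upwards [(S x).level.open_source.mem_nhds h0] with s hs u
    rw [h.pullEnd_redEnd hμ haut hinv hs]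
    exact (S x).J_hor hμ hs u

/-- The complex structure of the orbit space. -/
def complexStructure (h : IsReduction A S ho) (hμ : IsMomentumMap μ g θ)
    (haut : ActsByAutomorphisms G g)
    (hinv : ∀ (h : G), ∀ x ∈ zeroLevel μ, h • x ∈ zeroLevel μ) :
    ComplexStructure B (ReducedSpace μ) where
  toFun := redEnd S ho g
  smooth := h.contMDiff_redEnd hμ haut hinv
  sq := h.redEnd_sq hμ
  integrable X Y hX hY p := by
    obtain ⟨x, rfl⟩ := proj_surjective p
    have h1 := (h.quot x).integrable_of_nijenhuis ((S x).zero_mem_quot ho)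
      (h.contMDiff_redEnd hμ haut hinv) (h.redEnd_sq hμ) hX hY
      (h.nijenhuis_redEnd hμ haut hinv x)
    rw [(S x).quot_zero ho] at h1
    exact h1

end IsReduction

end ReducedStructure


/-! ### The reduced conformal class -/

section ReducedMetric

variable {E : Type*} [NormedAddCommGroup E] [NormedSpace ℝ E]
  {M : Type*} [TopologicalSpace M] [ChartedSpace E M] [IsManifold 𝓘(ℝ, E) ∞ M]
  {F : Type*} [NormedAddCommGroup F] [NormedSpace ℝ F] [FiniteDimensional ℝ F]
  {G : Type*} [TopologicalSpace G] [ChartedSpace F G] [Group G] [MulAction G M]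
  {B : Type*} [NormedAddCommGroup B] [NormedSpace ℝ B]
  {μ : GroupLieAlgebra 𝓘(ℝ, F) G →ₗ[ℝ] C^∞⟮𝓘(ℝ, E), M; 𝓘(ℝ, ℝ), ℝ⟯}
  {J : ComplexStructure E M} {g : HermitianMetric J}
  {A : Type*} [NormedAddCommGroup A] [NormedSpace ℝ A] [ChartedSpace A (zeroLevel μ)]
  [ChartedSpace B (ReducedSpace μ)]
  {S : ∀ x : zeroLevel μ, Slice μ B (x : M)} {ho : IsOpenMap (proj μ)}

namespace IsReduction

theorem inducedBilin_symm (h : IsReduction A S ho) {x : zeroLevel μ} {r : ℝ}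
    {b : B →L[ℝ] B →L[ℝ] ℝ} (hb : InducedBilin A g x r b) (u v : B) : b u v = b v u := by
  obtain ⟨u, hu, rfl⟩ := h.exists_hor_lift g x u
  obtain ⟨v, hv, rfl⟩ := h.exists_hor_lift g x v
  rw [hb u v hu hv, hb v u hv hu, bilinAt_symm]

theorem inducedBilin_pos (h : IsReduction A S ho) {x : zeroLevel μ} {r : ℝ} (hr : 0 < r)
    {b : B →L[ℝ] B →L[ℝ] ℝ} (hb : InducedBilin A g x r b) (u : B) (hu0 : u ≠ 0) : 0 < b u u := by
  obtain ⟨u, hu, rfl⟩ := h.exists_hor_lift g x u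
  rw [hb u u hu hu]
  refine mul_pos hr (bilinAt_pos g _ fun h0 => hu0 ?_)
  rw [h.mderiv_incl_injective x (h0.trans (map_zero _).symm), map_zero]

theorem inducedBilin_inducedEnd (h : IsReduction A S ho) {x : zeroLevel μ} {r : ℝ}
    {b : B →L[ℝ] B →L[ℝ] ℝ} (hb : InducedBilin A g x r b) {T : B →L[ℝ] B}
    (hT : InducedEnd A g x T) (u v : B) : b (T u) (T v) = b u v := by
  obtain ⟨u, hu, rfl⟩ := h.exists_hor_lift g x u
  obtain ⟨v, hv, rfl⟩ := h.exists_hor_lift g x v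
  obtain ⟨u', hu', hu1, hu2⟩ := hT u hu
  obtain ⟨v', hv', hv1, hv2⟩ := hT v hv
  rw [← hu2, ← hv2, hb u' v' hu' hv', hb u v hu hv, hu1, hv1, bilinAt_endAt]

variable [LieGroup 𝓘(ℝ, F) ∞ G] [ContMDiffSMul 𝓘(ℝ, F) 𝓘(ℝ, E) ∞ G M]
  [IsManifold 𝓘(ℝ, B) ∞ (ReducedSpace μ)] [FiniteDimensional ℝ B]

/-- Induced bilinear forms can be chosen smoothly in a neighbourhood of every point. -/
theorem exists_local_bilin (h : IsReduction A S ho) (haut : ActsByAutomorphisms G g)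
    (hinv : ∀ (h : G), ∀ x ∈ zeroLevel μ, h • x ∈ zeroLevel μ) (p₀ : ReducedSpace μ) :
    ∃ s : ∀ p : ReducedSpace μ, TangentSpace 𝓘(ℝ, B) p →L[ℝ] TangentSpace 𝓘(ℝ, B) p →L[ℝ] ℝ,
      (∀ p ∈ (chartAt B p₀).source,
        ContMDiffAt 𝓘(ℝ, B) (𝓘(ℝ, B).prod 𝓘(ℝ, B →L[ℝ] B →L[ℝ] ℝ)) ∞
          (fun p => TotalSpace.mk' (B →L[ℝ] B →L[ℝ] ℝ) (E := fun p : ReducedSpace μ =>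
            TangentSpace 𝓘(ℝ, B) p →L[ℝ] TangentSpace 𝓘(ℝ, B) p →L[ℝ] ℝ) p (s p)) p) ∧
      ∀ p ∈ (chartAt B p₀).source, ∀ x : zeroLevel μ, proj μ x = p →
        ∃ r : ℝ, 0 < r ∧ InducedBilin A g x r (bilinAt s p) := by
  obtain ⟨x, -, hx1, hx2, -⟩ := h.chart p₀
  -- The local metric restricts `g` to horizontal lifts along the transversal; at other points of
  -- the orbit it is induced up to a factor.
  let b : B → B →L[ℝ] B →L[ℝ] ℝ := fun q => ((S x).redG g (0, q)).bilinearComp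
    (tderiv B ((S x).quot ho) q).inverse (tderiv B ((S x).quot ho) q).inverse
  let s : ∀ p : ReducedSpace μ, TangentSpace 𝓘(ℝ, B) p →L[ℝ] TangentSpace 𝓘(ℝ, B) p →L[ℝ] ℝ :=
    fun p => b (chartAt B p₀ p)
  have hs : ∀ p, bilinAt s p = b (chartAt B p₀ p) := fun p => rfl
  refine ⟨s, fun p hp => contMDiffAt_bilin_of_chart hp ?_, fun p hp y hy => ?_⟩
  · have hq : chartAt B p₀ p ∈ ((S x).quot ho).source := by
      rw [← hx2]
      exact (chartAt B p₀).map_source hp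
    have h1 : ContDiffAt ℝ ∞ (fun q : B => (S x).redG g (0, q)) (chartAt B p₀ p) :=
      ContDiffAt.comp (f := fun q : B => ((0 : F), q)) (chartAt B p₀ p)
        ((S x).contDiffAt_redG (g := g) hq) (contDiff_const.prodMk contDiff_id).contDiffAt
    refine h1.congr_of_eventuallyEq ?_
    filter_upwards [(chartAt B p₀).open_target.mem_nhds ((chartAt B p₀).map_source hp)] with q hq
    have hq' : q ∈ ((S x).quot ho).source := by rwa [← hx2]
    refine ContinuousLinearMap.ext fun u => ContinuousLinearMap.ext fun v => ?_
    rw [pullBilin_apply, hs, (chartAt B p₀).right_inv hq, hx1]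
    simp only [b, ContinuousLinearMap.bilinearComp_apply]
    rw [(h.quot x).inverse_apply hq', (h.quot x).inverse_apply hq']
  · have hq : chartAt B p₀ p ∈ ((S x).quot ho).source := by
      rw [← hx2]
      exact (chartAt B p₀).map_source hp
    have h1 : proj μ ((S x).level (0, chartAt B p₀ p)) = proj μ y := by
      rw [hy, ← (S x).quot_apply ho, ← hx1, (chartAt B p₀).left_inv hp]
    exact h.inducedBilin_of_proj_eq haut hinv h1 one_pos
      (h.inducedBilin_redG (g := g) (p := (0, chartAt B p₀ p)) hq)

-- Induced forms with unspecified positive factor are closed under convex combinations, so the local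
-- ones are averaged by a partition of unity without leaving the conformal class.
set_option synthInstance.maxHeartbeats 400000 in
set_option maxHeartbeats 1000000 in
theorem exists_metric [T2Space (ReducedSpace μ)] [SecondCountableTopology (ReducedSpace μ)]
    (h : IsReduction A S ho) (haut : ActsByAutomorphisms G g)
    (hinv : ∀ (h : G), ∀ x ∈ zeroLevel μ, h • x ∈ zeroLevel μ) :
    ∃ g' : RiemMetric B (ReducedSpace μ), ∀ x : zeroLevel μ,
      ∃ r : ℝ, 0 < r ∧ InducedBilin A g x r (bilinAt g'.inner (proj μ x)) := by
  have : LocallyCompactSpace (ReducedSpace μ) :=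
    ChartedSpace.locallyCompactSpace B (ReducedSpace μ)
  let t : ∀ p : ReducedSpace μ,
      Set (TangentSpace 𝓘(ℝ, B) p →L[ℝ] TangentSpace 𝓘(ℝ, B) p →L[ℝ] ℝ) := fun p =>
    {b | ∀ x : zeroLevel μ, proj μ x = p →
      ∃ r : ℝ, 0 < r ∧ InducedBilin A g x r (show B →L[ℝ] B →L[ℝ] ℝ from b)}
  obtain ⟨s, hs⟩ := exists_contMDiffSection_forall_mem_convex_of_local (n := (⊤ : ℕ∞)) 𝓘(ℝ, B)
    (F_fiber := B →L[ℝ] B →L[ℝ] ℝ) (fun p : ReducedSpace μ =>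
      TangentSpace 𝓘(ℝ, B) p →L[ℝ] TangentSpace 𝓘(ℝ, B) p →L[ℝ] ℝ) t (by
      intro p b hb b' hb' c c' hc hc' hcc x hx
      obtain ⟨r, hr, hbr⟩ := hb x hx
      obtain ⟨r', hr', hbr'⟩ := hb' x hx
      refine ⟨c * r + c' * r', ?_, fun u v hu hv => ?_⟩
      -- One coefficient may vanish, and then the other is `1`.
      · rcases hc.eq_or_lt with rfl | hc0
        · have : c' = 1 := by linarith
          subst this
          linarith
        · exact add_pos_of_pos_of_nonneg (mul_pos hc0 hr) (mul_nonneg hc' hr'.le)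
      · refine (congrArg₂ (fun y z : ℝ => c * y + c' * z) (hbr u v hu hv)
          (hbr' u v hu hv)).trans ?_
        ring) (by
      intro p₀
      obtain ⟨s, hs, hs'⟩ := h.exists_local_bilin haut hinv p₀
      refine ⟨(chartAt B p₀).source, (chartAt B p₀).open_source.mem_nhds (mem_chart_source B p₀),
        s, fun p hp => (hs p hp).contMDiffWithinAt, fun p hp x hx => hs' p hp x hx⟩)
  have hpos : ∀ (p : ReducedSpace μ) (v : B), v ≠ 0 → 0 < bilinAt s p v v := fun p v hv => by
    obtain ⟨x, hx⟩ := proj_surjective p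
    obtain ⟨r, hr, hb⟩ := hs p x hx
    exact h.inducedBilin_pos hr hb v hv
  have hsymm : ∀ (p : ReducedSpace μ) (u v : B), bilinAt s p u v = bilinAt s p v u :=
    fun p u v => by
      obtain ⟨x, hx⟩ := proj_surjective p
      obtain ⟨r, hr, hb⟩ := hs p x hx
      exact h.inducedBilin_symm hb u v
  have hbdd : ∀ p : ReducedSpace μ, Bornology.IsVonNBounded ℝ {v : B | bilinAt s p v v < 1} :=
    fun p => isVonNBounded_of_pos (hpos p)
  exact ⟨⟨s, hsymm, hpos, hbdd, s.contMDiff⟩,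
    fun x => hs (proj μ x) x rfl⟩

theorem hor_ne_zero (x : zeroLevel μ) (p : F × B) {e : B} (he : e ≠ 0) :
    (S x).hor g p e ≠ 0 := fun h0 => he (by
  rw [← (S x).hor_fst_snd (g := g) (p := p) e, h0]
  rfl)

theorem contDiffAt_log_factor (h : IsReduction A S ho) (g' : RiemMetric B (ReducedSpace μ))
    {e : B} (he : e ≠ 0) (x : zeroLevel μ) :
    ContDiffAt ℝ ∞ (fun p : F × B => Real.log (pullBilin g'.inner ((S x).quot ho) p.2 e e /
      (S x).redG g p e e)) 0 := by
  have h0 := (S x).zero_mem_level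
  have hq := (S x).zero_mem_quot ho
  have hG : 0 < (S x).redG g 0 e e :=
    (S x).isParam.pullBilin_pos h0 _ (hor_ne_zero x 0 he)
  have hne : tderiv B ((S x).quot ho) 0 e ≠ 0 := fun h0 =>
    he ((h.quot x).injective hq (h0.trans (map_zero _).symm))
  have hG' : 0 < bilinAt g'.inner ((S x).quot ho 0) (tderiv B ((S x).quot ho) 0 e)
      (tderiv B ((S x).quot ho) 0 e) := g'.pos ((S x).quot ho 0) _ hne
  have h1 : ContDiffAt ℝ ∞ (pullBilin g'.inner ((S x).quot ho)) (0 : F × B).2 :=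
    contDiffAt_pullBilin g'.contMDiff ((h.quot x).contMDiffAt hq)
  have h2 : ContDiffAt ℝ ∞ (fun p : F × B => pullBilin g'.inner ((S x).quot ho) p.2) 0 :=
    h1.comp (0 : F × B) contDiff_snd.contDiffAt
  have h3 : ContDiffAt ℝ ∞ (fun p : F × B => pullBilin g'.inner ((S x).quot ho) p.2 e e) 0 :=
    (h2.clm_apply contDiffAt_const).clm_apply contDiffAt_const
  have h4 : ContDiffAt ℝ ∞ (fun p : F × B => (S x).redG g p e e) 0 :=
    (((S x).contDiffAt_redG h0).clm_apply contDiffAt_const).clm_apply contDiffAt_const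
  exact (h3.div h4 hG.ne').log (div_pos hG' hG).ne'

/-- The conformal factor between a metric of the orbit space and the metric it is induced by is
smooth. -/
theorem exists_factor (h : IsReduction A S ho) {g' : RiemMetric B (ReducedSpace μ)}
    (hg' : ∀ x : zeroLevel μ, ∃ r : ℝ, 0 < r ∧ InducedBilin A g x r (bilinAt g'.inner (proj μ x))) :
    ∃ f : C^∞⟮𝓘(ℝ, A), zeroLevel μ; 𝓘(ℝ, ℝ), ℝ⟯, ∀ x : zeroLevel μ,
      InducedBilin A g x (Real.exp (f x)) (bilinAt g'.inner (proj μ x)) := by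
  rcases subsingleton_or_nontrivial B with hB | hB
  · refine ⟨0, fun x u v hu hv => ?_⟩
    have h0 := (S x).zero_mem_level
    rw [← (S x).level_zero] at hu ⊢
    obtain ⟨b, rfl⟩ := h.exists_hor_eq h0 hu
    rw [Subsingleton.elim b 0]
    simp
  · obtain ⟨e, he⟩ := exists_ne (0 : B)
    choose r hr hb using hg'
    have hsm : ContMDiff 𝓘(ℝ, A) 𝓘(ℝ, ℝ) ∞ fun x => Real.log (r x) := by
      intro x
      have h0 := (S x).zero_mem_level
      have hgoal : ContMDiffAt 𝓘(ℝ, A) 𝓘(ℝ, ℝ) ∞ (fun x => Real.log (r x)) ((S x).level 0) := by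
        refine (h.level x).contMDiffAt_of_comp h0 (ContDiffAt.contMDiffAt ?_)
        -- The factor is the ratio of the two metrics on the fixed vector `e` and its horizontal
        -- lift.
        refine (h.contDiffAt_log_factor (g := g) g' he x).congr_of_eventuallyEq ?_
        filter_upwards [(S x).level.open_source.mem_nhds h0] with p hp
        have hG : 0 < (S x).redG g p e e :=
          (S x).isParam.pullBilin_pos hp _ (hor_ne_zero x p he)
        have h3 := h.redG_of_inducedBilin hp (hb ((S x).level p)) e e
        have h4 : pullBilin g'.inner ((S x).quot ho) p.2 e e =
            r ((S x).level p) * (S x).redG g p e e := by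
          rw [← h3, pullBilin_apply, (S x).proj_level ho hp]
        rw [h4, mul_div_assoc, div_self hG.ne', mul_one]
      rwa [(S x).level_zero] at hgoal
    refine ⟨⟨_, hsm⟩, fun x u v hu hv => ?_⟩
    change _ = Real.exp (Real.log (r x)) * _
    rw [Real.exp_log (hr x)]
    exact hb x u v hu hv

end IsReduction

end ReducedMetric


/-! ### The reduced Kähler form and its Lee form -/

section ReducedForm

variable {E : Type*} [NormedAddCommGroup E] [NormedSpace ℝ E]
  {M : Type*} [TopologicalSpace M] [ChartedSpace E M] [IsManifold 𝓘(ℝ, E) ∞ M]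
  {F : Type*} [NormedAddCommGroup F] [NormedSpace ℝ F] [FiniteDimensional ℝ F]
  {G : Type*} [TopologicalSpace G] [ChartedSpace F G] [Group G] [MulAction G M]
  {B : Type*} [NormedAddCommGroup B] [NormedSpace ℝ B]
  {μ : GroupLieAlgebra 𝓘(ℝ, F) G →ₗ[ℝ] C^∞⟮𝓘(ℝ, E), M; 𝓘(ℝ, ℝ), ℝ⟯}
  {J : ComplexStructure E M} {g : HermitianMetric J}
  {θ : ∀ x : M, TangentSpace 𝓘(ℝ, E) x →L[ℝ] ℝ}
  {A : Type*} [NormedAddCommGroup A] [NormedSpace ℝ A] [ChartedSpace A (zeroLevel μ)]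
  [ChartedSpace B (ReducedSpace μ)]
  {S : ∀ x : zeroLevel μ, Slice μ B (x : M)} {ho : IsOpenMap (proj μ)}

namespace IsReduction

/-- A tangent vector of the zero level differs from a horizontal one by a vector in the kernel of
the restriction of the Kähler form. -/
theorem exists_hor_part (h : IsReduction A S ho) (hμ : IsMomentumMap μ g θ) (x : zeroLevel μ)
    (u : A) : ∃ u' : A, Hor g x u' ∧ mderiv A B (proj μ) x u' = mderiv A B (proj μ) x u ∧
      ∀ v : A, bilinAt g.inner (x : M) (endAt J.toFun (x : M) (mderiv A E (incl μ) x u))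
        (mderiv A E (incl μ) x v) =
      bilinAt g.inner (x : M) (endAt J.toFun (x : M) (mderiv A E (incl μ) x u'))
        (mderiv A E (incl μ) x v) := by
  have h0 := (S x).zero_mem_level
  have h0' : ((0 : F × B), (0 : F →L[ℝ] ℝ)) ∈ (S x).Φ.source := h0
  obtain ⟨t, rfl⟩ : ∃ t, tderiv A (S x).level 0 t = u := ⟨_, (h.level x).apply_inverse h0 u⟩
  have h1 := h.hor_lift (g := g) h0 t.2
  have h2 := h.mderiv_proj_lift (g := g) h0 t.2
  have h3 := h.mderiv_proj h0 t
  have h4 := h.mderiv_incl_lift (g := g) h0 t.2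
  have h5 := h.mderiv_incl h0
  have hx : (S x).Φ ((0 : F × B), (0 : F →L[ℝ] ℝ)) = (x : M) := (S x).apply_zero
  rw [(S x).level_zero] at h1 h2 h3 h4
  simp only [(S x).level_zero] at h5
  refine ⟨_, h1, h2.trans h3.symm, fun v => ?_⟩
  obtain ⟨s, rfl⟩ : ∃ s, tderiv A (S x).level 0 s = v := ⟨_, (h.level x).apply_inverse h0 v⟩
  rw [h4, h5, h5, ← sub_eq_zero, ← sub_apply, ← map_sub, ← map_sub, ← map_sub]
  -- The difference from the horizontal lift is vertical, hence in the kernel of `Ω` restricted to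
  -- the level.
  have h6 : (t, (0 : F →L[ℝ] ℝ)) - (S x).hor g 0 t.2 =
      ((((t, (0 : F →L[ℝ] ℝ)) - (S x).hor g 0 t.2).1.1, 0), 0) :=
    Prod.ext (Prod.ext rfl (by simp [(S x).hor_fst_snd])) (by simp [(S x).hor_snd])
  rw [h6]
  have h7 := (S x).kahler_vert hμ h0 ((t, (0 : F →L[ℝ] ℝ)) - (S x).hor g 0 t.2).1.1 s
  rw [pullBilin_apply, tderiv_pullEnd ((S x).isParam.isInvertible h0'), hx] at h7
  exact h7

/-- The forms associated with the induced metric and the induced complex structure are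
proportional on the zero level. -/
theorem kahler_of_induced (h : IsReduction A S ho) (hμ : IsMomentumMap μ g θ) {x : zeroLevel μ}
    {r : ℝ} {b : B →L[ℝ] B →L[ℝ] ℝ} (hb : InducedBilin A g x r b) {T : B →L[ℝ] B}
    (hT : InducedEnd A g x T) (u v : A) :
    b (T (mderiv A B (proj μ) x u)) (mderiv A B (proj μ) x v) =
      r * bilinAt g.inner (x : M) (endAt J.toFun (x : M) (mderiv A E (incl μ) x u))
        (mderiv A E (incl μ) x v) := by
  obtain ⟨u', hu', hu1, hu2⟩ := h.exists_hor_part hμ x u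
  obtain ⟨v', hv', hv1, hv2⟩ := h.exists_hor_part hμ x v
  obtain ⟨w, hw, hw1, hw2⟩ := hT u' hu'
  -- Skew symmetry lets the replacement by horizontal parts be made in the second argument too.
  rw [hu2, kahler_skew, hv2, ← kahler_skew, ← hw1, ← hb w v' hw hv', hw2, hu1, hv1]

-- Replacing `u` by `J u` recovers the metric from the form, up to a sign that occurs on both sides.
set_option synthInstance.maxHeartbeats 200000 in
theorem inducedBilin_of_kahler {x : zeroLevel μ} {r : ℝ} {b : B →L[ℝ] B →L[ℝ] ℝ}
    {T : B →L[ℝ] B} (hT : InducedEnd A g x T) (hsq : ∀ u, T (T u) = -u)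
    (hb : ∀ u v : A, b (T (mderiv A B (proj μ) x u)) (mderiv A B (proj μ) x v) =
      r * bilinAt g.inner (x : M) (endAt J.toFun (x : M) (mderiv A E (incl μ) x u))
        (mderiv A E (incl μ) x v)) : InducedBilin A g x r b := by
  intro u v hu hv
  obtain ⟨w, hw, hw1, hw2⟩ := hT u hu
  have h1 := hb w v
  rw [hw1, hw2, hsq, endAt_sq, map_neg, map_neg, neg_apply, neg_apply, mul_neg] at h1
  exact neg_injective h1

theorem eq_of_inducedBilin (h : IsReduction A S ho) {x : zeroLevel μ} {r r' : ℝ} (hr : 0 < r)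
    {b b' : B →L[ℝ] B →L[ℝ] ℝ} (hb : InducedBilin A g x r b) (hb' : InducedBilin A g x r' b')
    (u v : B) : b' u v = r' / r * b u v := by
  obtain ⟨u, hu, rfl⟩ := h.exists_hor_lift g x u
  obtain ⟨v, hv, rfl⟩ := h.exists_hor_lift g x v
  rw [hb u v hu hv, hb' u v hu hv]
  field_simp

variable [IsManifold 𝓘(ℝ, B) ∞ (ReducedSpace μ)] [FiniteDimensional ℝ B]

theorem conformal_of_inducedBilin (h : IsReduction A S ho) {g' g'' : RiemMetric B (ReducedSpace μ)}
    (hg' : ∀ x : zeroLevel μ, ∃ r : ℝ, 0 < r ∧ InducedBilin A g x r (bilinAt g'.inner (proj μ x)))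
    (hg'' : ∀ x : zeroLevel μ, ∃ r : ℝ, 0 < r ∧
      InducedBilin A g x r (bilinAt g''.inner (proj μ x))) : Conformal g' g'' := by
  refine conformal_of_forall_exists fun p => ?_
  obtain ⟨x, rfl⟩ := proj_surjective p
  obtain ⟨r, hr, hb⟩ := hg' x
  obtain ⟨r', hr', hb'⟩ := hg'' x
  exact ⟨r' / r, div_pos hr' hr, fun u v => h.eq_of_inducedBilin hr hb hb' u v⟩

/-- The map `q ↦ (S x).level (0, q)` is a local section of the projection. Along it the reduced form
is a positive multiple of a pullback of `Ω`, so its Lee form can be computed from `θ`. -/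
theorem pullForm_quot (h : IsReduction A S ho) (hμ : IsMomentumMap μ g θ)
    {J' : ComplexStructure B (ReducedSpace μ)} {g' : HermitianMetric J'}
    (hJ' : ∀ x : zeroLevel μ, InducedEnd A g x (endAt J'.toFun (proj μ x)))
    {f : zeroLevel μ → ℝ}
    (hf : ∀ x : zeroLevel μ, InducedBilin A g x (Real.exp (f x)) (bilinAt g'.inner (proj μ x)))
    (x : zeroLevel μ) {q : B} (hq : q ∈ ((S x).quot ho).source) :
    pullForm (kahlerForm g') ((S x).quot ho) q = Real.exp (f ((S x).level (0, q))) •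
      pullForm (kahlerForm g) (fun q : B => ((S x).level (0, q) : M)) q := by
  have hq' : ((0 : F), q) ∈ (S x).level.source := hq
  have hd : ∀ u : B, tderiv E (fun q : B => ((S x).level (0, q) : M)) q u =
      mderiv A E (incl μ) ((S x).level (0, q)) (tderiv A (S x).level (0, q) (0, u)) := by
    intro u
    have h2 : HasFDerivAt (fun q : B => ((0 : F), q)) (ContinuousLinearMap.inr ℝ F B) q :=
      (ContinuousLinearMap.inr ℝ F B).hasFDerivAt
    rw [tderiv_comp (φ := fun p => ((S x).level p : M)) (f := fun q : B => ((0 : F), q))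
      ((contMDiffAt_incl_level (S x) hq').mdifferentiableAt (by simp)) h2.differentiableAt,
      h2.fderiv, h.mderiv_incl hq', ← (S x).tderiv_level hq']
    rfl
  refine ContinuousAlternatingMap.ext fun t => ?_
  have h1 := h.kahler_of_induced hμ (hf ((S x).level (0, q))) (hJ' ((S x).level (0, q)))
    (tderiv A (S x).level (0, q) (0, t 0)) (tderiv A (S x).level (0, q) (0, t 1))
  rw [h.mderiv_proj hq', h.mderiv_proj hq', ← hd, ← hd] at h1
  exact h1

theorem isLCK [FiniteDimensional ℝ E] (h : IsReduction A S ho) (hμ : IsMomentumMap μ g θ) (hθ : IsLeeForm g θ)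
    {J' : ComplexStructure B (ReducedSpace μ)} {g' : HermitianMetric J'}
    (hJ' : ∀ x : zeroLevel μ, InducedEnd A g x (endAt J'.toFun (proj μ x)))
    (f : C^∞⟮𝓘(ℝ, A), zeroLevel μ; 𝓘(ℝ, ℝ), ℝ⟯)
    (hf : ∀ x : zeroLevel μ, InducedBilin A g x (Real.exp (f x)) (bilinAt g'.inner (proj μ x))) :
    IsLCK g' := by
  -- Gluing local Lee forms needs their uniqueness, hence dimension at least 3; below that the
  -- condition is empty.
  rcases Nat.lt_or_ge 2 (Module.finrank ℝ B) with hd | hd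
  swap
  · exact isLCK_of_finrank_le_two g' hd
  refine isLCK_of_local hd fun p => ?_
  obtain ⟨x, -, hx1, hx2, -⟩ := h.chart p
  rw [hx1, hx2]
  have hin : ∀ q ∈ ((S x).quot ho).source,
      ContMDiffAt 𝓘(ℝ, B) 𝓘(ℝ, F × B) ∞ (fun q : B => ((0 : F), q)) q := fun q _ =>
    (contDiff_const.prodMk contDiff_id).contMDiff.contMDiffAt
  have hσ : ContMDiffOn 𝓘(ℝ, B) 𝓘(ℝ, E) ∞ (fun q : B => ((S x).level (0, q) : M))
      ((S x).quot ho).source := fun q hq =>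
    (ContMDiffAt.comp (I' := 𝓘(ℝ, F × B)) (f := fun q : B => ((0 : F), q)) q
      (contMDiffAt_incl_level (S x) hq) (hin q hq)).contMDiffWithinAt
  have hfσ : ContDiffOn ℝ ∞ (fun q : B => f ((S x).level (0, q))) ((S x).quot ho).source :=
    fun q hq => by
      have h1 : ContMDiffAt 𝓘(ℝ, B) 𝓘(ℝ, A) ∞ (fun q : B => (S x).level (0, q)) q :=
        ContMDiffAt.comp (I' := 𝓘(ℝ, F × B)) (f := fun q : B => ((0 : F), q)) q
          ((h.level x).contMDiffAt hq) (hin q hq)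
      exact (ContMDiffAt.comp (I' := 𝓘(ℝ, A)) q f.contMDiff.contMDiffAt h1).contDiffAt.contDiffWithinAt
  obtain ⟨η, hη⟩ := hθ.pullback_exp ((S x).quot ho).open_source hσ hfσ
    (fun q hq => h.pullForm_quot hμ hJ' hf x hq)
  exact ⟨η, fun q hq => ⟨(hη q hq).1, (hη q hq).2.1, fun u v w => (hη q hq).2.2 u v w⟩⟩

end IsReduction

end ReducedForm

end LCK

end

/-! ### The reduction theorem -/

theorem mainTheorem1
    {E : Type*} [NormedAddCommGroup E] [NormedSpace ℝ E] [FiniteDimensional ℝ E]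
    {M : Type*} [TopologicalSpace M] [T2Space M] [SecondCountableTopology M]
    [ChartedSpace E M] [IsManifold 𝓘(ℝ, E) ∞ M]
    (hdim : 4 ≤ Module.finrank ℝ E)
    {J : LCK.ComplexStructure E M} (g : LCK.HermitianMetric J)
    (θ : ∀ x : M, TangentSpace 𝓘(ℝ, E) x →L[ℝ] ℝ) (hθ : LCK.IsLeeForm g θ)
    {F : Type*} [NormedAddCommGroup F] [NormedSpace ℝ F] [FiniteDimensional ℝ F]
    {G : Type*} [TopologicalSpace G] [T2Space G] [SecondCountableTopology G] [ConnectedSpace G]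
    [ChartedSpace F G] [Group G] [LieGroup 𝓘(ℝ, F) ∞ G]
    [MulAction G M] [ContMDiffSMul 𝓘(ℝ, F) 𝓘(ℝ, E) ∞ G M]
    (haut : LCK.ActsByAutomorphisms G g)
    (μ : GroupLieAlgebra 𝓘(ℝ, F) G →ₗ[ℝ] C^∞⟮𝓘(ℝ, E), M; 𝓘(ℝ, ℝ), ℝ⟯)
    (hμ : LCK.IsMomentumMap μ g θ)
    (hreg : LCK.ZeroIsRegularValue μ)
    (hfree : LCK.FreeOnZeroLevel μ)
    (hproper : LCK.ProperOnZeroLevel μ) :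
    (∀ (h : G), ∀ x ∈ LCK.zeroLevel μ, h • x ∈ LCK.zeroLevel μ) ∧
    T2Space (LCK.ReducedSpace μ) ∧ SecondCountableTopology (LCK.ReducedSpace μ) ∧
    -- the smooth structures of `μ⁻¹(0)` and of `μ⁻¹(0)/G`
    ∃ (k n : ℕ) (_ : ChartedSpace (EuclideanSpace ℝ (Fin k)) (LCK.zeroLevel μ))
      (_ : ChartedSpace (EuclideanSpace ℝ (Fin n)) (LCK.ReducedSpace μ))
      (_ : IsManifold 𝓘(ℝ, EuclideanSpace ℝ (Fin k)) ∞ (LCK.zeroLevel μ))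
      (_ : IsManifold 𝓘(ℝ, EuclideanSpace ℝ (Fin n)) ∞ (LCK.ReducedSpace μ)),
      Manifold.IsSmoothEmbedding 𝓘(ℝ, EuclideanSpace ℝ (Fin k)) 𝓘(ℝ, E) ∞ (LCK.incl μ) ∧
      Manifold.IsSubmersion 𝓘(ℝ, EuclideanSpace ℝ (Fin k)) 𝓘(ℝ, EuclideanSpace ℝ (Fin n)) ∞
        (LCK.proj μ) ∧
      -- existence of the reduced structure
      ∃ (J' : LCK.ComplexStructure (EuclideanSpace ℝ (Fin n)) (LCK.ReducedSpace μ))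
        (g' : LCK.HermitianMetric J'),
        LCK.IsLCK g' ∧
        LCK.IsInducedComplexStructure (EuclideanSpace ℝ (Fin k)) g J' ∧
        LCK.MetricCondition (EuclideanSpace ℝ (Fin k)) g g'.metric ∧
        LCK.FormCondition (EuclideanSpace ℝ (Fin k)) g g' ∧
        -- uniqueness of the reduced structure
        (∀ J'' : LCK.ComplexStructure (EuclideanSpace ℝ (Fin n)) (LCK.ReducedSpace μ),
          LCK.IsInducedComplexStructure (EuclideanSpace ℝ (Fin k)) g J'' → J'' = J') ∧
        (∀ (J'' : LCK.ComplexStructure (EuclideanSpace ℝ (Fin n)) (LCK.ReducedSpace μ))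
          (g'' : LCK.HermitianMetric J''), LCK.IsLCK g'' →
          LCK.MetricCondition (EuclideanSpace ℝ (Fin k)) g g''.metric →
          LCK.Conformal g'.metric g''.metric) ∧
        (∀ g'' : LCK.HermitianMetric J', LCK.IsLCK g'' →
          LCK.FormCondition (EuclideanSpace ℝ (Fin k)) g g'' →
          LCK.Conformal g'.metric g''.metric) := by
  have hinv : ∀ (h : G), ∀ x ∈ LCK.zeroLevel μ, h • x ∈ LCK.zeroLevel μ := fun h x hx =>
    hμ.smul_mem hθ h hx
  have hcs : ContinuousSMul G M := ContMDiffSMul.continuousSMul (I := 𝓘(ℝ, F)) (I' := 𝓘(ℝ, E)) ∞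
  have ho : IsOpenMap (LCK.proj μ) := LCK.isOpenMap_proj hinv
  have hT2 := LCK.t2Space_reducedSpace ho hproper
  have hsc := LCK.secondCountable_reducedSpace ho
  -- The orbit directions and their images under `J` are removed. The subtraction can be truncated
  -- only when the level is empty, where any model space will do.
  let n := Module.finrank ℝ E - 2 * Module.finrank ℝ F
  let k := Module.finrank ℝ F + n
  have hn : Module.finrank ℝ (EuclideanSpace ℝ (Fin n)) =
      Module.finrank ℝ E - 2 * Module.finrank ℝ F := finrank_euclideanSpace_fin
  let S : ∀ x : LCK.zeroLevel μ, LCK.Slice μ (EuclideanSpace ℝ (Fin n)) (x : M) := fun x =>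
    (LCK.exists_slice hμ hθ hreg hfree hproper hn x.2).some
  let κ : EuclideanSpace ℝ (Fin k) ≃L[ℝ] F × EuclideanSpace ℝ (Fin n) :=
    ContinuousLinearEquiv.ofFinrankEq (by
      rw [finrank_euclideanSpace_fin, Module.finrank_prod, finrank_euclideanSpace_fin])
  obtain ⟨cZ, cN, hZ, hN, h⟩ := LCK.exists_isReduction hinv ho S κ
  refine ⟨hinv, hT2, hsc, k, n, cZ, cN, hZ, hN, h.isSmoothEmbedding κ, h.isSubmersion κ, ?_⟩
  let J' := h.complexStructure hμ haut hinv
  have hJ' : ∀ x : LCK.zeroLevel μ, LCK.InducedEnd (EuclideanSpace ℝ (Fin k)) g x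
      (LCK.endAt J'.toFun (LCK.proj μ x)) := h.inducedEnd_redEnd hμ haut hinv
  obtain ⟨gr, hgr⟩ := h.exists_metric haut hinv
  -- Any induced metric is Hermitian for the induced complex structure, since `g` is so on
  -- horizontal vectors.
  let g' : LCK.HermitianMetric J' := ⟨gr, fun p u v => by
    obtain ⟨x, rfl⟩ := LCK.proj_surjective p
    obtain ⟨r, -, hb⟩ := hgr x
    exact h.inducedBilin_inducedEnd hb (hJ' x) u v⟩
  obtain ⟨f, hf⟩ := h.exists_factor hgr
  refine ⟨J', g', h.isLCK hμ hθ hJ' f hf, hJ', ⟨f, fun x u v hu hv => hf x u v hu hv⟩,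
    ⟨f, fun x u v => h.kahler_of_induced hμ (hf x) (hJ' x) u v⟩, ?_, ?_, ?_⟩
  · intro J'' hJ''
    refine LCK.ComplexStructure.ext (funext fun p => ?_)
    obtain ⟨x, rfl⟩ := LCK.proj_surjective p
    exact h.inducedEnd_unique (T := LCK.endAt J''.toFun (LCK.proj μ x))
      (T' := LCK.endAt J'.toFun (LCK.proj μ x)) (hJ'' x) (hJ' x)
  · rintro J'' g'' - ⟨f'', hf''⟩
    exact h.conformal_of_inducedBilin (g' := gr) hgr fun x =>
      ⟨Real.exp (f'' x), Real.exp_pos _, fun u v hu hv => hf'' x u v hu hv⟩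
  -- The condition on forms becomes the one on metrics because `J'` is induced by `J`.
  · rintro g'' - ⟨f'', hf''⟩
    exact h.conformal_of_inducedBilin (g' := gr) hgr fun x =>
      ⟨Real.exp (f'' x), Real.exp_pos _, LCK.IsReduction.inducedBilin_of_kahler (hJ' x)
        (LCK.endAt_sq _) fun u v => hf'' x u v⟩
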